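/- Let $F$ be a field, and let $\mathcal A$ be a finite arrangement of proper subspaces, either linear subspaces of the projective space $\mathbb P(F^n)$ or nonempty affine subspaces of $F^n$. Let $d\ge 0$ be the largest dimension of a member of $\mathcal A$. The intersection semilattice $L_{\mathcal A}$ consists of the whole space $\hat 0$ and all nonempty intersections of members of $\mathcal A$, ordered by reverse inclusion. For $0\le j\le d$ put $L^{\ge j}_{\mathcal A}=\{x\in L_{\mathcal A}\setminus\{\hat 0\}\mid \dim(x)\ge j\}$, and let $\widetilde\beta^{\ge j}_i=\dim_{\mathbb Q}\widetilde H_i(\Delta(L^{\ge j}_{\mathcal A});\mathbb Q)$ be the reduced rational Betti numbers of its order complex, for $i\in\mathbb Z$. Call $L_{\mathcal A}$ hereditary if for every $x\in L_{\mathcal A}\setminus\{\hat 0\}$ with $\dim(x)>0$ there is $y>x$ in $L_{\mathcal A}$ with $\dim(y)=\dim(x)-1$. For an integer $m\ge 0$, call $L_{\mathcal A}$ mod-$m$-pure if the lengths of all its maximal chains are congruent modulo $m$ (congruence modulo $0$ being equality). Call $L_{\mathcal A}$ CL-shellable if the bounded poset $L_{\mathcal A}\cup\{\hat 1\}$, with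 a new top element $\hat 1$, has a CL-labeling (in the nonpure sense of Björner and Wachs). Theorem M. Suppose that $L_{\mathcal A}$ is hereditary, mod-$m$-pure and CL-shellable. Then $\widetilde\beta^{\ge j}_i=0$ for all $0\le j\le d$ and all $i$, unless $i+j\equiv d \pmod m$. Moreover, let $k\ge 2$. The three conditions hold, with $m=k-2$, for the following projective arrangements in $\mathbb P(F^n)$: the $k$-equal arrangement of type A, $\mathcal A_{n,k}=\{x_{i_1}=\dots=x_{i_k}\mid 1\le i_1<\dots<i_k\le n\}$; and, if the characteristic of $F$ is not $2$, the $k$-equal arrangement of type B, $\mathcal B_{n,k}=\{\varepsilon_1x_{i_1}=\dots=\varepsilon_kx_{i_k}\mid 1\le i_1<\dots<i_k\le n,\ \varepsilon_r\in\{+1,-1\}\}\cup\{x_{j_1}=\dots=x_{j_{k-1}}=0\mid 1\le j_1<\dots<j_{k-1}\le n\}$. -/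

import Mathlib

noncomputable section

/-! ## Reduced rational homology of the order complex of a poset -/

section OrderHomology

variable (P : Type*) [PartialOrder P]

/-- The space of simplicial `i`-chains of the order complex of `P` with rational coefficients:
combinations of the chains of `P` with `i + 1` elements. The empty chain is the simplex of
dimension `-1`. -/
def simplicialChains (i : ℤ) : Submodule ℚ (Finset P →₀ ℚ) :=
  Finsupp.supported ℚ ℚ {s : Finset P | IsChain (· ≤ ·) (s : Set P) ∧ (s.card : ℤ) = i + 1}

open Classical in
/-- The simplicial boundary (augmented): the simplex `p₀ < p₁ < ⋯ < pᵢ` is sent to the sum over `k`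
of `(-1)^k` times the simplex with `pₖ` removed; here `k` is the number of elements of the
simplex below `pₖ`. -/
def simplicialBoundary : (Finset P →₀ ℚ) →ₗ[ℚ] (Finset P →₀ ℚ) :=
  Finsupp.linearCombination ℚ fun s : Finset P =>
    ∑ p ∈ s, Finsupp.single (s.erase p) ((-1 : ℚ) ^ (s.filter (· < p)).card)

/-- Reduced simplicial `i`-cycles of the order complex. -/
def reducedCycles (i : ℤ) : Submodule ℚ (Finset P →₀ ℚ) :=
  simplicialChains P i ⊓ LinearMap.ker (simplicialBoundary P)

/-- Simplicial `i`-boundaries of the order complex. -/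
def reducedBoundaries (i : ℤ) : Submodule ℚ (Finset P →₀ ℚ) :=
  (simplicialChains P (i + 1)).map (simplicialBoundary P)

/-- The `i`-th reduced rational homology of the order complex of `P`. -/
abbrev ReducedHomology (i : ℤ) : Type _ :=
  reducedCycles P i ⧸ (reducedBoundaries P i).submoduleOf (reducedCycles P i)

/-- The `i`-th reduced rational Betti number of the order complex of `P`. -/
def reducedBetti (i : ℤ) : ℕ := Module.finrank ℚ (ReducedHomology P i)

end OrderHomology

/-! ## CL-shellable posets -/

section CLShellable

variable {P Λ : Type*} [PartialOrder P] [PartialOrder Λ]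

/-- The list `c` consists of the elements after `x` in a maximal chain
`x ⋖ z₁ ⋖ ⋯ ⋖ zₗ = y` of the closed interval `[x, y]`. -/
def IsMaximalChainBetween (x y : P) (c : List P) : Prop :=
  (x :: c).IsChain (· ⋖ ·) ∧ (x :: c).getLast? = some y

/-- The word of labels of the chain that starts at the end of the root `r` and continues through
`c`. In a chain-edge labeling the label of an edge of a maximal chain is determined by the part of
the chain up to this edge; thus `lab r z` is the label of the edge from the end of the root `r` (a
chain that starts at the bottom element, which is left out of the list) to `z`. -/
def labelWord (lab : List P → P → Λ) : List P → List P → List Λ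
  | _, [] => []
  | r, z :: c => lab r z :: labelWord lab (r ++ [z]) c

/-- The chain-edge labeling `lab` is a CL-labeling: each rooted interval `[x, y]_r` has a
unique maximal chain with strictly increasing labels, and its word of labels lexicographically
precedes those of all other maximal chains of the interval. -/
def IsCLLabeling [OrderBot P] (lab : List P → P → Λ) : Prop :=
  ∀ (x y : P) (r : List P), x < y → IsMaximalChainBetween ⊥ x r →
    ∃ c : List P, IsMaximalChainBetween x y c ∧ (labelWord lab r c).Pairwise (· < ·) ∧
      ∀ c' : List P, IsMaximalChainBetween x y c' → c' ≠ c →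
        ¬ (labelWord lab r c').Pairwise (· < ·) ∧
          List.Lex (· < ·) (labelWord lab r c) (labelWord lab r c')

/-- A bounded (finite) poset is CL-shellable if it has a CL-labeling, with labels in some poset. -/
def IsCLShellable (P : Type*) [PartialOrder P] [BoundedOrder P] : Prop :=
  ∃ (Λ : Type) (_ : PartialOrder Λ) (lab : List P → P → Λ), IsCLLabeling lab

end CLShellable

/-! ## Intersection semilattices

Subspaces are elements of a complete lattice `C` (all affine subspaces of affine space, or all
projective subspaces of projective space), whose bottom is the empty subspace. -/

section Intersection

variable {C : Type*} [CompleteLattice C]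

/-- The intersection semilattice: all nonempty intersections of subfamilies of `A`, together with
the whole space (the empty intersection), ordered by reverse inclusion. -/
abbrev IntersectionSemilattice (A : Set C) : Type _ :=
  {x : Cᵒᵈ // ∃ S ⊆ A, OrderDual.ofDual x = sInf S ∧ (S = ∅ ∨ OrderDual.ofDual x ≠ ⊥)}

/-- The least element of the intersection semilattice is the whole space. -/
instance intersectionSemilatticeOrderBot (A : Set C) :
    OrderBot (IntersectionSemilattice A) where
  bot := ⟨OrderDual.toDual ⊤, ∅, Set.empty_subset _, by simp, Or.inl rfl⟩
  bot_le x := show OrderDual.ofDual x.1 ≤ ⊤ from le_top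

variable (dim : C → ℤ) (A : Set C)

/-- Every element other than the least one and of positive dimension contains another
element of dimension one less. -/
def IsHereditary : Prop :=
  ∀ x : IntersectionSemilattice A, x ≠ ⊥ → 0 < dim (OrderDual.ofDual x.1) →
    ∃ y : IntersectionSemilattice A, x < y ∧
      dim (OrderDual.ofDual y.1) = dim (OrderDual.ofDual x.1) - 1

/-- The lengths (numbers of elements minus one) of all maximal chains are congruent mod `m`. -/
def IsModPure (m : ℕ) : Prop :=
  ∀ s t : Flag (IntersectionSemilattice A),
    ((s : Set (IntersectionSemilattice A)).ncard : ℤ) - 1 ≡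
      ((t : Set (IntersectionSemilattice A)).ncard : ℤ) - 1 [ZMOD m]

/-- The truncation: all elements other than the least one that have dimension at least `j`. -/
abbrev Truncation (j : ℤ) : Type _ :=
  {x : IntersectionSemilattice A // x ≠ ⊥ ∧ j ≤ dim (OrderDual.ofDual x.1)}

end Intersection

/-! ## Subspaces of projective and affine space -/

section Spaces

variable {F : Type*} [Field F] {n : ℕ}

/-- The dimension of the linear subspace of projective `(n-1)`-space that is given by the vector
subspace `K` of `Fⁿ`; the empty subspace has dimension `-1`. -/
def projDim (K : Submodule F (Fin n → F)) : ℤ := (Module.finrank F K : ℤ) - 1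

/-- The dimension of a nonempty affine subspace of `Fⁿ`. -/
def affDim (K : AffineSubspace F (Fin n → F)) : ℤ := Module.finrank F K.direction

end Spaces

/-! ## The `k`-equal arrangements -/

section KEqual

variable (F : Type*) [Field F] (n : ℕ)

/-- The subspace `ε i₁ x i₁ = ε i₂ x i₂ = ⋯`, for all indices in `S`. -/
def signedEqualSubspace (ε : Fin n → ℤˣ) (S : Finset (Fin n)) : Submodule F (Fin n → F) where
  carrier := {x | ∀ a ∈ S, ∀ b ∈ S, ((ε a : ℤ) : F) * x a = ((ε b : ℤ) : F) * x b}
  zero_mem' := by intro a _ b _; simp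
  add_mem' := by
    intro x y hx hy a ha b hb
    simp only [Pi.add_apply, mul_add, hx a ha b hb, hy a ha b hb]
  smul_mem' := by
    intro t x hx a ha b hb
    simp only [Pi.smul_apply, smul_eq_mul, mul_left_comm _ t, hx a ha b hb]

/-- The subspace `x i = 0`, for all indices in `S`. -/
def zeroSubspace (S : Finset (Fin n)) : Submodule F (Fin n → F) where
  carrier := {x | ∀ a ∈ S, x a = 0}
  zero_mem' := by intro a _; simp
  add_mem' := by
    intro x y hx hy a ha
    simp [hx a ha, hy a ha]
  smul_mem' := by
    intro t x hx a ha
    simp [hx a ha]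

/-- The `k`-equal arrangement of type A. -/
def kEqualA (k : ℕ) : Set (Submodule F (Fin n → F)) :=
  {K | ∃ S : Finset (Fin n), S.card = k ∧ K = signedEqualSubspace F n 1 S}

/-- The `k`-equal arrangement of type D. -/
def kEqualD (k : ℕ) : Set (Submodule F (Fin n → F)) :=
  {K | ∃ (S : Finset (Fin n)) (ε : Fin n → ℤˣ), S.card = k ∧ K = signedEqualSubspace F n ε S}

/-- The `k`-equal arrangement of type B. -/
def kEqualB (k : ℕ) : Set (Submodule F (Fin n → F)) :=
  kEqualD F n k ∪ {K | ∃ S : Finset (Fin n), S.card = k - 1 ∧ K = zeroSubspace F n S}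

end KEqual

end

/-! ## Maximal chains of intervals -/

section MaximalChains

variable {P : Type*} [PartialOrder P]

/-! Vanishing. Everything rests on sequential acyclicity: for each r, the subcomplex generated by
the chains with at least r elements has no reduced homology in dimensions below r - 1. A CL-labeling
gives this for every open interval (0̂, y) of L ∪ {1̂}. In the lexicographic order, a face of a
maximal chain lies in an earlier chain exactly if it misses a descent, and exchanging a descent for
a rising chain never shortens the chain; so the long chains can be attached one after another
(`IsCLLabeling.facetComplex_acyclic`). The property passes from L^{≥j} to L^{≥j+1}
(`IsSequentiallyAcyclic.sdiff`): the deleted elements, of dimension j, are maximal, their links are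
intervals (0̂, x), and by heredity every remaining nonempty chain has a deleted element above it.

Heredity also makes each maximal chain of L^{≥j} end in dimension exactly j and extend to a maximal
chain of L by j + 1 further elements (`exists_flag_ncard`). Mod-m-purity then forces i + j ≡ d
whenever a maximal chain of L^{≥j} has i + 1 elements. For all other i, every i-simplex lies in a
larger one, so each i-cycle lives in the subcomplex generated by the chains with at least i + 2
elements, and bounds there (`reducedBetti_truncation_eq_zero`).

The k-equal arrangements. With an extra coordinate x₀ = 0, types A and B are treated together. A
flat divides the coordinates into blocks on which they agree up to sign. Each cover merges two
nontrivial blocks (or one with the zero block), adjoins a free coordinate to a nontrivial block, or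
creates a block of k free coordinates (`exists_step`). The dimension drops by 1, 1 and k - 1, always
by 1 modulo k - 2; as maximal chains end in dimension 0, purity follows. Heredity holds because two
blocks can be identified as long as the dimension allows it.

For shellability, a merge is labeled by the leader that it destroys, shifted to be negative, and the
other steps by the largest coordinate that ceases to be free. In each interval the cover of least
label is unique and is followed by larger labels only, since a small label afterwards would have
given a smaller label before. Any other cover can be followed by a label that is not larger, since
the least step, or what is left of it, remains to be done (`isGreedyLabeling_kEqual`). This local
property already makes the greedy chain the unique rising one (`IsGreedyLabeling.exists_chain`). -/

theorem isMaximalChainBetween_nil {x y : P} : IsMaximalChainBetween x y [] ↔ x = y := by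
  simp [IsMaximalChainBetween]

theorem isMaximalChainBetween_cons {x y z : P} {c : List P} :
    IsMaximalChainBetween x y (z :: c) ↔ x ⋖ z ∧ IsMaximalChainBetween z y c := by
  simp [IsMaximalChainBetween, List.isChain_cons_cons, List.getLast?_cons_cons, and_assoc]

theorem isMaximalChainBetween_append {x y : P} {c d : List P} :
    IsMaximalChainBetween x y (c ++ d) ↔
      ∃ m, IsMaximalChainBetween x m c ∧ IsMaximalChainBetween m y d := by
  induction c generalizing x with
  | nil => simp [isMaximalChainBetween_nil]
  | cons z c ih => simp [isMaximalChainBetween_cons, ih, and_assoc]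

theorem IsMaximalChainBetween.le {x y : P} {c : List P} (h : IsMaximalChainBetween x y c) :
    x ≤ y := by
  induction c generalizing x with
  | nil => exact (isMaximalChainBetween_nil.1 h).le
  | cons z c ih =>
    obtain ⟨h1, h2⟩ := isMaximalChainBetween_cons.1 h
    exact h1.le.trans (ih h2)

theorem IsMaximalChainBetween.lt_of_mem {x y : P} {c : List P} (h : IsMaximalChainBetween x y c)
    {p : P} (hp : p ∈ c) : x < p ∧ p ≤ y := by
  obtain ⟨l, r, rfl⟩ := List.append_of_mem hp
  obtain ⟨m, h1, h2⟩ := isMaximalChainBetween_append.1 h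
  obtain ⟨h3, h4⟩ := isMaximalChainBetween_cons.1 h2
  exact ⟨h1.le.trans_lt h3.lt, h4.le⟩

theorem IsMaximalChainBetween.getLast_eq {x y : P} {c : List P}
    (h : IsMaximalChainBetween x y c) : c.getLast?.getD x = y := by
  have h2 := h.2
  rw [List.getLast?_cons] at h2
  exact Option.some.inj h2

theorem IsMaximalChainBetween.pairwise {x y : P} {c : List P}
    (h : IsMaximalChainBetween x y c) : c.Pairwise (· < ·) := by
  have h1 : (x :: c).IsChain (· < ·) := h.1.imp fun _ _ h => h.lt
  exact (List.isChain_iff_pairwise.1 h1).of_cons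

theorem IsMaximalChainBetween.snoc {x y z : P} {c : List P}
    (h : IsMaximalChainBetween x y c) (hz : y ⋖ z) : IsMaximalChainBetween x z (c ++ [z]) :=
  isMaximalChainBetween_append.2
    ⟨y, h, isMaximalChainBetween_cons.2 ⟨hz, isMaximalChainBetween_nil.2 rfl⟩⟩

end MaximalChains

/-! ## A local criterion for edge labelings -/

section Criterion

/-- A local form of the conditions on an EL-labeling with linearly ordered labels: in each interval
there is a cover of the bottom with the least label, it is followed by larger labels only, and any
other cover can be followed by a label that is not larger. -/
def IsGreedyLabeling {P Λ : Type*} [PartialOrder P] [LinearOrder Λ] (lab : P → P → Λ) : Prop :=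
  ∀ x y : P, x < y → ∃ z, x ⋖ z ∧ z ≤ y ∧ (∀ w, z ⋖ w → w ≤ y → lab x z < lab z w) ∧
    ∀ z', x ⋖ z' → z' ≤ y → z' ≠ z →
      lab x z < lab x z' ∧ ∃ w, z' ⋖ w ∧ w ≤ y ∧ lab z' w ≤ lab x z'

variable {P Λ : Type*} [PartialOrder P] [LinearOrder Λ] {lab : P → P → Λ}

/-- Take the cover of least label again and again. The clause on the first label serves the
induction: a rising chain through another cover z' would continue with the greedy chain of [z', y],
whose first label is minimal there, hence not above the label of the edge to z'. -/
theorem IsGreedyLabeling.exists_chain [OrderBot P] [Finite P] (h : IsGreedyLabeling lab)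
    (x y : P) (hxy : x ≤ y) (r : List P) (hr : IsMaximalChainBetween ⊥ x r) :
    ∃ c : List P, IsMaximalChainBetween x y c ∧
      (labelWord (fun r z => lab (r.getLast?.getD ⊥) z) r c).Pairwise (· < ·) ∧
      (∀ w, x ⋖ w → w ≤ y → ∃ z t, c = z :: t ∧ lab x z ≤ lab x w) ∧
      ∀ c' : List P, IsMaximalChainBetween x y c' → c' ≠ c →
        ¬ (labelWord (fun r z => lab (r.getLast?.getD ⊥) z) r c').Pairwise (· < ·) ∧
          List.Lex (· < ·) (labelWord (fun r z => lab (r.getLast?.getD ⊥) z) r c)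
            (labelWord (fun r z => lab (r.getLast?.getD ⊥) z) r c') := by
  induction x using WellFoundedGT.induction generalizing r with
  | ind x ih =>
    rcases hxy.eq_or_lt with rfl | hlt
    · refine ⟨[], isMaximalChainBetween_nil.2 rfl, by simp [labelWord], ?_, ?_⟩
      · intro w hw hw'
        exact absurd hw.lt hw'.not_gt
      · intro c' hc' hne
        cases c' with
        | nil => exact absurd rfl hne
        | cons z t =>
          obtain ⟨h1, h2⟩ := isMaximalChainBetween_cons.1 hc'
          exact absurd h1.lt h2.le.not_gt
    · obtain ⟨z, hxz, hzy, hrise, hother⟩ := h x y hlt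
      obtain ⟨c, hc, hcp, hcm, hcu⟩ := ih z hxz.lt hzy (r ++ [z]) (hr.snoc hxz)
      have hlast := hr.getLast_eq
      refine ⟨z :: c, isMaximalChainBetween_cons.2 ⟨hxz, hc⟩, ?_, ?_, ?_⟩
      · rw [← List.isChain_iff_pairwise] at hcp ⊢
        cases c with
        | nil => simp [labelWord]
        | cons w t =>
          simp only [labelWord, List.isChain_cons_cons] at hcp ⊢
          refine ⟨?_, hcp⟩
          obtain ⟨h1, h2⟩ := isMaximalChainBetween_cons.1 hc
          simpa [hlast] using hrise w h1 h2.le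
      · intro w hw hwy
        refine ⟨z, c, rfl, ?_⟩
        by_cases hwz : w = z
        · rw [hwz]
        · exact (hother w hw hwy hwz).1.le
      · intro c' hc' hne
        cases c' with
        | nil => exact absurd (isMaximalChainBetween_nil.1 hc') hlt.ne
        | cons z' c' =>
          obtain ⟨hxz', hc''⟩ := isMaximalChainBetween_cons.1 hc'
          by_cases hzz : z' = z
          · subst hzz
            obtain ⟨h1, h2⟩ := hcu c' hc'' (fun h => hne (by rw [h]))
            simp only [labelWord]
            exact ⟨fun h => h1 h.of_cons, List.Lex.cons h2⟩
          · obtain ⟨hlt', w, hw, hwy, hle⟩ := hother z' hxz' hc''.le hzz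
            refine ⟨fun hp => ?_, List.Lex.rel (by simpa [hlast] using hlt')⟩
            obtain ⟨d, hd, -, hdm, hdu⟩ := ih z' hxz'.lt hc''.le (r ++ [z']) (hr.snoc hxz')
            have hcd : c' = d := by
              by_contra hcd
              exact (hdu c' hc'' hcd).1 hp.of_cons
            subst hcd
            obtain ⟨v, t, rfl, hv⟩ := hdm w hw hwy
            simp only [labelWord, List.pairwise_cons] at hp
            have := hp.1 _ (List.mem_cons_self)
            simp only [hlast, List.getLast?_append, List.getLast?_singleton,
              Option.some_or, Option.getD_some] at this
            exact absurd this (hv.trans hle).not_gt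

theorem IsGreedyLabeling.isCLShellable {P : Type*} [PartialOrder P] {Λ : Type} [LinearOrder Λ]
    {lab : P → P → Λ} [BoundedOrder P] [Finite P] (h : IsGreedyLabeling lab) :
    IsCLShellable P := by
  refine ⟨Λ, inferInstance, fun r z => lab (r.getLast?.getD ⊥) z, ?_⟩
  intro x y r hxy hr
  obtain ⟨c, h1, h2, -, h3⟩ := h.exists_chain x y hxy.le r hr
  exact ⟨c, h1, h2, h3⟩

theorem IsGreedyLabeling.comp_orderIso {Q : Type*} [PartialOrder Q] (f : Q ≃o P)
    (h : IsGreedyLabeling lab) : IsGreedyLabeling fun x y => lab (f x) (f y) := by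
  intro x y hxy
  obtain ⟨z, h1, h2, h3, h4⟩ := h (f x) (f y) (f.lt_iff_lt.2 hxy)
  obtain ⟨z, rfl⟩ := f.surjective z
  refine ⟨z, (apply_covBy_apply_iff f).1 h1, f.le_iff_le.1 h2, fun w hw hwy =>
    h3 _ ((apply_covBy_apply_iff f).2 hw) (f.le_iff_le.2 hwy), fun z' hz' hzy hne => ?_⟩
  obtain ⟨h5, w, h6, h7, h8⟩ := h4 _ ((apply_covBy_apply_iff f).2 hz') (f.le_iff_le.2 hzy)
    (fun h => hne (f.injective h))
  obtain ⟨w, rfl⟩ := f.surjective w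
  exact ⟨h5, w, (apply_covBy_apply_iff f).1 h6, f.le_iff_le.1 h7, h8⟩

/-- Adding a new top element to a poset with a greatest element. -/
theorem IsGreedyLabeling.withTop [OrderTop P] (h : IsGreedyLabeling lab) :
    IsGreedyLabeling (fun x y : WithTop P =>
      WithTop.recTopCoe (C := fun _ => WithTop Λ) ⊤
        (fun b => WithTop.recTopCoe (C := fun _ => WithTop Λ) ⊤ (fun a => (lab a b : WithTop Λ)) x)
        y) := by
  have hcov : ∀ {a b : P}, (a : WithTop P) ⋖ b ↔ a ⋖ b := fun {a b} => WithTop.coe_covBy_coe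
  have hcovtop : ∀ {a : P}, (a : WithTop P) ⋖ ⊤ → a = ⊤ := by
    intro a ha
    by_contra hne
    exact ha.2 (WithTop.coe_lt_coe.2 (lt_top_iff_ne_top.2 hne)) (WithTop.coe_lt_top _)
  -- The new top covers only the old one, and this edge has the label `⊤`, above all old labels, so
  -- it never creates a descent.
  have htop : ((⊤ : P) : WithTop P) ⋖ ⊤ := by
    refine ⟨WithTop.coe_lt_top _, fun c hc hc' => ?_⟩
    induction c using WithTop.recTopCoe with
    | top => exact lt_irrefl _ hc'
    | coe c => exact absurd (WithTop.coe_lt_coe.1 hc) (not_lt_of_ge le_top)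
  intro x y hxy
  induction x using WithTop.recTopCoe with
  | top => exact absurd hxy not_top_lt
  | coe x =>
  by_cases hx : x = ⊤
  · subst hx
    have hy : y = ⊤ := by
      induction y using WithTop.recTopCoe with
      | top => rfl
      | coe y => exact absurd (WithTop.coe_lt_coe.1 hxy) (not_lt_of_ge le_top)
    subst hy
    refine ⟨⊤, htop, le_rfl, fun w hw => absurd hw.lt not_top_lt, fun z' hz' _ hne => ?_⟩
    exact absurd (WithTop.lt_top_iff_ne_top.2 hne) (htop.2 hz'.lt)
  -- An interval that ends in the new top has the same old elements as the one that ends in the old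
  -- top.
  · obtain ⟨y', hxy', hle⟩ : ∃ y' : P, x < y' ∧ ∀ a : P, (a : WithTop P) ≤ y ↔ a ≤ y' := by
      induction y using WithTop.recTopCoe with
      | top => exact ⟨⊤, lt_top_iff_ne_top.2 hx, by simp⟩
      | coe y => exact ⟨y, WithTop.coe_lt_coe.1 hxy, by simp⟩
    obtain ⟨z, h1, h2, h3, h4⟩ := h x y' hxy'
    refine ⟨z, hcov.2 h1, (hle _).2 h2, fun w hw hwy => ?_, fun z' hz' hzy hne => ?_⟩
    · induction w using WithTop.recTopCoe with
      | top => exact WithTop.coe_lt_top _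
      | coe w => exact WithTop.coe_lt_coe.2 (h3 w (hcov.1 hw) ((hle _).1 hwy))
    · induction z' using WithTop.recTopCoe with
      | top => exact absurd (hcovtop hz') hx
      | coe z' =>
        obtain ⟨h5, w, h6, h7, h8⟩ := h4 z' (hcov.1 hz') ((hle _).1 hzy) (by simpa using hne)
        exact ⟨WithTop.coe_lt_coe.2 h5, w, hcov.2 h6, (hle _).2 h7, WithTop.coe_le_coe.2 h8⟩

end Criterion

/-! ## The augmented chain complex of a poset -/

section ChainComplex

variable {P : Type*} [PartialOrder P]

theorem map_mem_of_supported {ι M : Type*} [AddCommGroup M] [Module ℚ M] {X : Set ι}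
    (f : (ι →₀ ℚ) →ₗ[ℚ] M) (N : Submodule ℚ M) (h : ∀ s ∈ X, f (Finsupp.single s 1) ∈ N)
    {z : ι →₀ ℚ} (hz : z ∈ Finsupp.supported ℚ ℚ X) : f z ∈ N := by
  rw [Finsupp.supported_eq_span_single] at hz
  have : Submodule.span ℚ ((fun i => Finsupp.single i (1 : ℚ)) '' X) ≤ N.comap f := by
    rw [Submodule.span_le]
    rintro _ ⟨s, hs, rfl⟩
    exact h s hs
  exact this hz

theorem eq_of_supported {ι M : Type*} [AddCommGroup M] [Module ℚ M] {X : Set ι}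
    (f g : (ι →₀ ℚ) →ₗ[ℚ] M) (h : ∀ s ∈ X, f (Finsupp.single s 1) = g (Finsupp.single s 1))
    {z : ι →₀ ℚ} (hz : z ∈ Finsupp.supported ℚ ℚ X) : f z = g z := by
  have := map_mem_of_supported (f - g) ⊥ (fun s hs => by simp [h s hs]) hz
  rw [Submodule.mem_bot, LinearMap.sub_apply, sub_eq_zero] at this
  exact this

open Classical in
theorem simplicialBoundary_single (s : Finset P) :
    simplicialBoundary P (Finsupp.single s 1) =
      ∑ p ∈ s, Finsupp.single (s.erase p) ((-1 : ℚ) ^ (s.filter (· < p)).card) := by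
  simp [simplicialBoundary]

open Classical in
theorem simplicialBoundary_mem {X Y : Set (Finset P)} (h : ∀ s ∈ X, ∀ p ∈ s, s.erase p ∈ Y)
    {z : Finset P →₀ ℚ} (hz : z ∈ Finsupp.supported ℚ ℚ X) :
    simplicialBoundary P z ∈ Finsupp.supported ℚ ℚ Y := by
  refine map_mem_of_supported _ _ (fun s hs => ?_) hz
  rw [simplicialBoundary_single]
  exact Submodule.sum_mem _ fun p hp => Finsupp.single_mem_supported _ _ (h s hs p hp)

open Classical in
/-- The cone with apex `v`, up to sign. -/
noncomputable def coneOperator (v : P) : (Finset P →₀ ℚ) →ₗ[ℚ] (Finset P →₀ ℚ) :=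
  Finsupp.linearCombination ℚ fun s : Finset P =>
    if v ∈ s then 0 else Finsupp.single (insert v s) ((-1 : ℚ) ^ (s.filter (· < v)).card)

open Classical in
theorem coneOperator_single (v : P) (s : Finset P) (a : ℚ) :
    coneOperator v (Finsupp.single s a) =
      if v ∈ s then 0
      else Finsupp.single (insert v s) (a * (-1 : ℚ) ^ (s.filter (· < v)).card) := by
  simp only [coneOperator, Finsupp.linearCombination_single]
  split_ifs <;> simp

open Classical in
theorem coneOperator_mem {v : P} {X Y : Set (Finset P)}
    (h : ∀ s ∈ X, v ∉ s → insert v s ∈ Y)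
    {z : Finset P →₀ ℚ} (hz : z ∈ Finsupp.supported ℚ ℚ X) :
    coneOperator v z ∈ Finsupp.supported ℚ ℚ Y := by
  refine map_mem_of_supported _ _ (fun s hs => ?_) hz
  rw [coneOperator_single]
  split_ifs with hv
  · exact Submodule.zero_mem _
  · exact Finsupp.single_mem_supported _ _ (h s hs hv)

open Classical in
-- The sign carries `v` from the front of the simplex to its place in the order, which gives the
-- usual cone formula: faces that omit an old vertex cancel. If `v` is a vertex already, the cone is
-- zero and only the face opposite to `v` contributes.
theorem boundary_coneOperator_single (v : P) (s : Finset P)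
    (hs : IsChain (· ≤ ·) (insert v s : Set P)) :
    simplicialBoundary P (coneOperator v (Finsupp.single s 1)) +
      coneOperator v (simplicialBoundary P (Finsupp.single s 1)) = Finsupp.single s 1 := by
  have hsq : ∀ a : ℕ, (-1 : ℚ) ^ a * (-1) ^ a = 1 := fun a => by
    rw [← mul_pow]; norm_num
  rw [simplicialBoundary_single, map_sum, coneOperator_single]
  simp only [coneOperator_single]
  by_cases hv : v ∈ s
  · rw [if_pos hv, map_zero, zero_add, Finset.sum_eq_single v]
    · rw [if_neg (Finset.notMem_erase _ _), Finset.insert_erase hv]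
      congr 1
      have : (s.erase v).filter (· < v) = s.filter (· < v) := by
        ext u
        simp only [Finset.mem_filter, Finset.mem_erase]
        exact ⟨fun h => ⟨h.1.2, h.2⟩, fun h => ⟨⟨h.2.ne, h.1⟩, h.2⟩⟩
      rw [this, hsq]
    · intro p _ hp
      rw [if_pos (Finset.mem_erase.2 ⟨Ne.symm hp, hv⟩)]
    · exact fun h => absurd hv h
  · rw [if_neg hv, one_mul, ← mul_one ((-1 : ℚ) ^ _), ← smul_eq_mul, ← Finsupp.smul_single,
      map_smul, simplicialBoundary_single, Finset.sum_insert hv, Finset.erase_insert hv]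
    have hf : (insert v s).filter (· < v) = s.filter (· < v) := by
      rw [Finset.filter_insert, if_neg (lt_irrefl v)]
    rw [hf, smul_add, Finsupp.smul_single, smul_eq_mul, hsq, add_assoc, Finset.smul_sum,
      ← Finset.sum_add_distrib, Finset.sum_eq_zero, add_zero]
    intro p hp
    have hpv : p ≠ v := fun h => hv (h ▸ hp)
    rw [if_neg (fun h => hv (Finset.mem_of_mem_erase h)), Finset.erase_insert_of_ne hpv.symm,
      Finsupp.smul_single, ← Finsupp.single_add, smul_eq_mul]
    refine (congrArg _ ?_).trans (Finsupp.single_zero _)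
    have hcomp : p < v ∨ v < p := by
      rcases hs (Set.mem_insert_of_mem _ hp) (Set.mem_insert _ _) hpv with h | h
      · exact Or.inl (lt_of_le_of_ne h hpv)
      · exact Or.inr (lt_of_le_of_ne h hpv.symm)
    -- The two products of signs differ by one factor -1: deleting p < v moves `v` down one place,
    -- while inserting v < p moves p up one place.
    rcases hcomp with h | h
    · have h1 : (insert v s).filter (· < p) = s.filter (· < p) := by
        rw [Finset.filter_insert, if_neg h.not_gt]
      have h2 : s.filter (· < v) = insert p ((s.erase p).filter (· < v)) := by
        rw [← Finset.insert_erase hp, Finset.filter_insert, if_pos h]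
        simp
      rw [h1, h2, Finset.card_insert_of_notMem (by simp)]
      ring
    · have h1 : (insert v s).filter (· < p) = insert v (s.filter (· < p)) := by
        rw [Finset.filter_insert, if_pos h]
      have h2 : (s.erase p).filter (· < v) = s.filter (· < v) := by
        ext u
        simp only [Finset.mem_filter, Finset.mem_erase]
        exact ⟨fun h => ⟨h.1.2, h.2⟩, fun hu => ⟨⟨(hu.2.trans h).ne, hu.1⟩, hu.2⟩⟩
      rw [h1, h2, Finset.card_insert_of_notMem (by simp [hv])]
      ring

open Classical in
theorem boundary_coneOperator {v : P} {X : Set (Finset P)}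
    (h : ∀ s ∈ X, IsChain (· ≤ ·) (insert v s : Set P))
    {z : Finset P →₀ ℚ} (hz : z ∈ Finsupp.supported ℚ ℚ X) :
    simplicialBoundary P (coneOperator v z) = z - coneOperator v (simplicialBoundary P z) := by
  rw [eq_sub_iff_add_eq]
  exact eq_of_supported (simplicialBoundary P ∘ₗ coneOperator v +
    coneOperator v ∘ₗ simplicialBoundary P) LinearMap.id
    (fun s hs => boundary_coneOperator_single v s (h s hs)) hz

open Classical in
-- Induction on the vertices by the cone formula alone: ∂∂(v∗s) = ∂(s - v∗∂s) = ∂s - (∂s - v∗∂∂s) =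
-- 0.
theorem boundary_boundary_single (s : Finset P) (hs : IsChain (· ≤ ·) (s : Set P)) :
    simplicialBoundary P (simplicialBoundary P (Finsupp.single s 1)) = 0 := by
  induction s using Finset.induction_on with
  | empty => simp [simplicialBoundary_single]
  | insert v s hv ih =>
    have hs' : IsChain (· ≤ ·) (s : Set P) := hs.mono (by simp)
    have hsupp : Finsupp.single s (1 : ℚ) ∈ Finsupp.supported ℚ ℚ {s} :=
      Finsupp.single_mem_supported _ _ rfl
    have h1 := boundary_coneOperator (v := v) (X := {s})
      (by rintro _ rfl; simpa using hs) hsupp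
    have hb : simplicialBoundary P (Finsupp.single s 1) ∈
        Finsupp.supported ℚ ℚ {t : Finset P | t ⊆ s} :=
      simplicialBoundary_mem (by rintro _ rfl p hp; exact Finset.erase_subset _ _) hsupp
    have h2 := boundary_coneOperator (v := v) (X := {t : Finset P | t ⊆ s})
      (fun t ht => hs.mono (by
        rw [Finset.coe_insert]
        exact Set.insert_subset_insert (Finset.coe_subset.2 ht))) hb
    have h3 : simplicialBoundary P (simplicialBoundary P (coneOperator v (Finsupp.single s 1)))
        = 0 := by
      rw [h1, map_sub, h2, ih hs', map_zero, sub_zero, sub_self]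
    rw [coneOperator_single, if_neg hv, one_mul, ← mul_one ((-1 : ℚ) ^ _), ← smul_eq_mul,
      ← Finsupp.smul_single, map_smul, map_smul] at h3
    exact (smul_eq_zero.1 h3).resolve_left (pow_ne_zero _ (by norm_num))

theorem boundary_boundary {X : Set (Finset P)} (h : ∀ s ∈ X, IsChain (· ≤ ·) (s : Set P))
    {z : Finset P →₀ ℚ} (hz : z ∈ Finsupp.supported ℚ ℚ X) :
    simplicialBoundary P (simplicialBoundary P z) = 0 :=
  eq_of_supported (simplicialBoundary P ∘ₗ simplicialBoundary P) 0
    (fun s hs => boundary_boundary_single s (h s hs)) hz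

/-- A filtration by complexes, the `r`-th one generated by simplices with at least `r` vertices, is
sequentially acyclic if the `r`-th complex has no reduced homology below the top dimension. -/
def IsSequentiallyAcyclic (K : ℕ → Set (Finset P)) : Prop :=
  ∀ q r : ℕ, q < r → ∀ z ∈ Finsupp.supported ℚ ℚ {s | s ∈ K r ∧ s.card = q},
    simplicialBoundary P z = 0 →
      ∃ w ∈ Finsupp.supported ℚ ℚ {s | s ∈ K r ∧ s.card = q + 1}, simplicialBoundary P w = z

/-- The subcomplex of the order complex of `Q` generated by chains with at least `r` elements. -/
def largeChains (Q : Set P) (r : ℕ) : Set (Finset P) :=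
  {s | ∃ t : Finset P, s ⊆ t ∧ (t : Set P) ⊆ Q ∧ IsChain (· ≤ ·) (t : Set P) ∧ r ≤ t.card}

theorem largeChains_isChain {Q : Set P} {r : ℕ} {s : Finset P} (h : s ∈ largeChains Q r) :
    IsChain (· ≤ ·) (s : Set P) := by
  obtain ⟨u, h1, -, h2, -⟩ := h
  exact h2.mono (Finset.coe_subset.2 h1)

theorem largeChains_coe_subset {Q : Set P} {r : ℕ} {s : Finset P} (h : s ∈ largeChains Q r) :
    (s : Set P) ⊆ Q := by
  obtain ⟨u, h1, h2, -⟩ := h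
  exact (Finset.coe_subset.2 h1).trans h2

/-- Reindexing along an order embedding. -/
theorem boundary_mapDomain {P' : Type*} [PartialOrder P'] (f : P ↪o P') (z : Finset P →₀ ℚ) :
    simplicialBoundary P' (Finsupp.mapDomain (Finset.map f.toEmbedding) z) =
      Finsupp.mapDomain (Finset.map f.toEmbedding) (simplicialBoundary P z) := by
  classical
  refine eq_of_supported (X := Set.univ)
    (simplicialBoundary P' ∘ₗ Finsupp.lmapDomain ℚ ℚ (Finset.map f.toEmbedding))
    (Finsupp.lmapDomain ℚ ℚ (Finset.map f.toEmbedding) ∘ₗ simplicialBoundary P)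
    (fun s _ => ?_) (by simp)
  simp only [LinearMap.comp_apply, Finsupp.lmapDomain_apply, Finsupp.mapDomain_single,
    simplicialBoundary_single, Finset.sum_map, Finsupp.mapDomain_finsetSum]
  refine Finset.sum_congr rfl fun p _ => ?_
  have h2 : (s.map f.toEmbedding).filter (· < f.toEmbedding p) =
      (s.filter (· < p)).map f.toEmbedding := by
    rw [Finset.filter_map]
    congr 1
    ext u
    simp
  rw [Finset.map_erase, h2, Finset.card_map]

/-- Transfers acyclicity from intervals of `WithTop L` to `L`, and from subsets to subtypes. A
filling of the image of a cycle consists of image simplices only, so it can be pulled back. -/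
theorem IsSequentiallyAcyclic.comap {P' : Type*} [PartialOrder P'] (f : P ↪o P') {Q : Set P}
    (h : IsSequentiallyAcyclic (largeChains (f '' Q))) :
    IsSequentiallyAcyclic (largeChains Q) := by
  classical
  have hinj : Function.Injective (Finset.map f.toEmbedding) := Finset.map_injective _
  intro q r hqr z hz hbz
  have hz' : Finsupp.mapDomain (Finset.map f.toEmbedding) z ∈
      Finsupp.supported ℚ ℚ {s | s ∈ largeChains (f '' Q) r ∧ s.card = q} := by
    refine map_mem_of_supported (Finsupp.lmapDomain ℚ ℚ (Finset.map f.toEmbedding)) _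
      (fun s hs => ?_) hz
    rw [Finsupp.lmapDomain_apply, Finsupp.mapDomain_single]
    refine Finsupp.single_mem_supported _ _ ⟨?_, by rw [Finset.card_map]; exact hs.2⟩
    obtain ⟨t, h1, h2, h3, h4⟩ := hs.1
    refine ⟨t.map f.toEmbedding, Finset.map_subset_map.2 h1, ?_, ?_, by simpa using h4⟩
    · rw [Finset.coe_map]
      exact Set.image_mono h2
    · rw [Finset.coe_map]
      rintro _ ⟨a, ha, rfl⟩ _ ⟨b, hb, rfl⟩ hab
      exact (h3 ha hb fun h => hab (by rw [h])).imp (fun h => f.monotone h) fun h => f.monotone h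
  obtain ⟨w, hw, hbw⟩ := h q r hqr _ hz' (by rw [boundary_mapDomain, hbz, Finsupp.mapDomain_zero])
  have hrange : ∀ s ∈ largeChains (f '' Q) r, ∃ t ∈ largeChains Q r, t.map f.toEmbedding = s := by
    rintro s ⟨t, h1, h2, h3, h4⟩
    obtain ⟨t, h2', rfl⟩ := Finset.subset_set_image_iff.1 h2
    obtain ⟨s, hs, rfl⟩ := Finset.subset_image_iff.1 h1
    refine ⟨s, ⟨t, hs, h2', ?_, ?_⟩, by rw [Finset.map_eq_image]; rfl⟩
    · intro a ha b hb hab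
      have := h3 (Finset.mem_coe.2 (Finset.mem_image_of_mem f ha))
        (Finset.mem_coe.2 (Finset.mem_image_of_mem f hb)) (fun h => hab (f.injective h))
      simpa using this
    · rwa [Finset.card_image_of_injective _ f.injective] at h4
  have hsub : (w.support : Set (Finset P')) ⊆ Set.range (Finset.map f.toEmbedding) := by
    intro s hs
    obtain ⟨t, -, ht⟩ := hrange s ((Finsupp.mem_supported _ _).1 hw hs).1
    exact ⟨t, ht⟩
  refine ⟨Finsupp.comapDomain _ w hinj.injOn, ?_, ?_⟩
  · rw [Finsupp.mem_supported]
    intro s hs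
    rw [Finsupp.comapDomain_support, Finset.mem_coe, Finset.mem_preimage] at hs
    have := (Finsupp.mem_supported _ _).1 hw hs
    obtain ⟨t, ht, hts⟩ := hrange _ this.1
    rw [← hinj hts]
    refine ⟨ht, ?_⟩
    have h2 := this.2
    rwa [← hts, Finset.card_map] at h2
  · apply Finsupp.mapDomain_injective hinj
    rw [← boundary_mapDomain, Finsupp.mapDomain_comapDomain _ hinj _ hsub, hbw]

end ChainComplex

/-! ## Sequential acyclicity of CL-shellable posets -/

section LexBefore

variable {Λ : Type*} [PartialOrder Λ]

/-- The first word is smaller at the first position where the words differ, and there is one. -/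
inductive LexBefore : List Λ → List Λ → Prop
  | rel {a b : Λ} {u v : List Λ} : a < b → LexBefore (a :: u) (b :: v)
  | cons {a : Λ} {u v : List Λ} : LexBefore u v → LexBefore (a :: u) (a :: v)

theorem LexBefore.trans {u v w : List Λ} (h : LexBefore u v) (h' : LexBefore v w) :
    LexBefore u w := by
  induction h generalizing w with
  | rel h =>
    cases h' with
    | rel h2 => exact .rel (h.trans h2)
    | cons h2 => exact .rel h
  | cons h ih =>
    cases h' with
    | rel h2 => exact .rel h2
    | cons h2 => exact .cons (ih h2)

theorem LexBefore.irrefl (u : List Λ) : ¬ LexBefore u u := by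
  induction u with
  | nil => exact fun h => nomatch h
  | cons a u ih =>
    intro h
    cases h with
    | rel h => exact lt_irrefl _ h
    | cons h => exact ih h

/-- This fails for `List.Lex`, where a proper prefix counts as smaller; hence the separate relation,
which asks for an actual difference. -/
theorem LexBefore.append {u v : List Λ} (h : LexBefore u v) (s t : List Λ) :
    LexBefore (u ++ s) (v ++ t) := by
  induction h with
  | rel h => exact .rel h
  | cons h ih => exact .cons ih

theorem LexBefore.append_left {u v : List Λ} (h : LexBefore u v) (s : List Λ) :
    LexBefore (s ++ u) (s ++ v) := by
  induction s with
  | nil => exact h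
  | cons a s ih => exact .cons ih

/-- With the same first letter `a`, the second letter of `W` would lie above `a` and not above `b`,
contrary to the descent. The strict drop in the first letter is what leads from `List.Lex` to
`LexBefore`. -/
theorem exists_head_lt_of_lex_pair {W : List Λ} {a b : Λ} (hW : W.Pairwise (· < ·))
    (hlen : 2 ≤ W.length) (hlex : List.Lex (· < ·) W [a, b]) (hab : ¬ a < b) :
    ∃ w t, W = w :: t ∧ w < a := by
  obtain _ | ⟨w, _ | ⟨w', t⟩⟩ := W
  · simp at hlen
  · simp at hlen
  · refine ⟨w, w' :: t, rfl, ?_⟩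
    simp only [List.pairwise_cons] at hW
    have hww : w < w' := hW.1 _ List.mem_cons_self
    cases hlex with
    | rel h => exact h
    | cons h =>
      cases h with
      | rel h => exact absurd (hww.trans h) hab
      | cons h => exact absurd hww hab

end LexBefore

/-! ### Lexicographic shelling by descents. -/

section LexShelling

variable {P Λ : Type*}

theorem labelWord_append (lab : List P → P → Λ) (r c d : List P) :
    labelWord lab r (c ++ d) = labelWord lab r c ++ labelWord lab (r ++ c) d := by
  induction c generalizing r with
  | nil => simp [labelWord]
  | cons z c ih => simp [labelWord, ih]

variable [PartialOrder Λ]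

/-- The label of `p` in the chain `c` with root `r` is not smaller than the next label. -/
def IsDescent (lab : List P → P → Λ) (r c : List P) (p : P) : Prop :=
  ∃ (l : List P) (b : P) (t : List P), c = l ++ p :: b :: t ∧
    ¬ lab (r ++ l) p < lab (r ++ l ++ [p]) b

theorem pairwise_of_no_descent {lab : List P → P → Λ} {r c : List P}
    (h : ∀ p, ¬ IsDescent lab r c p) : (labelWord lab r c).Pairwise (· < ·) := by
  induction c generalizing r with
  | nil => simp [labelWord]
  | cons p c ih =>
    have hc := ih (r := r ++ [p]) fun q ⟨l, b, t, h1, h2⟩ =>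
      h q ⟨p :: l, b, t, by simp [h1], by simpa using h2⟩
    rw [← List.isChain_iff_pairwise] at hc ⊢
    cases c with
    | nil => simp [labelWord]
    | cons b t =>
      simp only [labelWord, List.isChain_cons_cons] at hc ⊢
      refine ⟨?_, hc⟩
      by_contra hlt
      exact h p ⟨[], b, t, rfl, by simpa using hlt⟩

theorem lexBefore_isStrictOrder (lab : List P → P → Λ) (r : List P) :
    IsStrictOrder (List P) fun c c' => LexBefore (labelWord lab r c) (labelWord lab r c') where
  irrefl _ := LexBefore.irrefl _
  trans _ _ _ := LexBefore.trans

variable [PartialOrder P]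

/-- Replace the descent, between its neighbours m and b, by the rising chain of the rooted interval
[m, b]. The label at its start drops strictly, so the later labels, which may change with the root,
do not matter. The rising chain has at least two entries because p lies strictly between m and b;
hence no length is lost, as the nonpure setting requires. -/
theorem IsCLLabeling.exists_lexBefore_of_descent [OrderBot P] {lab : List P → P → Λ}
    (hlab : IsCLLabeling lab) {x y p : P} {r c : List P} (hr : IsMaximalChainBetween ⊥ x r)
    (hc : IsMaximalChainBetween x y c) (hp : IsDescent lab r c p) :
    ∃ c', IsMaximalChainBetween x y c' ∧ LexBefore (labelWord lab r c') (labelWord lab r c) ∧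
      (∀ u ∈ c, u ≠ p → u ∈ c') ∧ c.length ≤ c'.length := by
  obtain ⟨l, b, t, rfl, hlt⟩ := hp
  obtain ⟨m, hl, hm⟩ := isMaximalChainBetween_append.1 hc
  obtain ⟨hmp, hpt⟩ := isMaximalChainBetween_cons.1 hm
  obtain ⟨hpb, hbt⟩ := isMaximalChainBetween_cons.1 hpt
  have hpb2 : IsMaximalChainBetween m b [p, b] := by
    simp [isMaximalChainBetween_cons, isMaximalChainBetween_nil, hmp, hpb]
  have hroot : IsMaximalChainBetween ⊥ m (r ++ l) := isMaximalChainBetween_append.2 ⟨x, hr, hl⟩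
  obtain ⟨d, hd, hdp, hdu⟩ := hlab m b (r ++ l) (hmp.lt.trans hpb.lt) hroot
  have hne : [p, b] ≠ d := by
    rintro rfl
    simp [labelWord] at hdp
    exact hlt (by simpa using hdp)
  have hlen : 2 ≤ d.length := by
    obtain _ | ⟨w, _ | ⟨w', t'⟩⟩ := d
    · exact absurd (isMaximalChainBetween_nil.1 hd) (hmp.lt.trans hpb.lt).ne
    · obtain ⟨h1, h2⟩ := isMaximalChainBetween_cons.1 hd
      rw [isMaximalChainBetween_nil] at h2
      subst h2
      exact absurd hpb.lt (h1.2 hmp.lt)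
    · simp
  have hwlen : (labelWord lab (r ++ l) d).length = d.length := by
    generalize r ++ l = r'
    clear hlen hdu hdp hd hne
    induction d generalizing r' with
    | nil => rfl
    | cons z d ih => simp [labelWord, ih]
  obtain ⟨w, W, hw, hwlt⟩ := exists_head_lt_of_lex_pair hdp (by rw [hwlen]; exact hlen)
    (b := lab (r ++ l ++ [p]) b) (a := lab (r ++ l) p)
    (by simpa [labelWord] using (hdu _ hpb2 hne).2) hlt
  refine ⟨l ++ (d ++ t), isMaximalChainBetween_append.2 ⟨m, hl,
    isMaximalChainBetween_append.2 ⟨b, hd, hbt⟩⟩, ?_, ?_, ?_⟩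
  · rw [labelWord_append lab r l, labelWord_append lab r l, labelWord_append _ _ d, hw]
    refine LexBefore.append_left ?_ _
    exact LexBefore.rel hwlt
  · intro u hu hup
    have hbd : b ∈ d := by
      have := hd.2
      rw [List.getLast?_cons] at this
      cases hdl : d.getLast? with
      | none => simp [List.getLast?_eq_none_iff.1 hdl] at hlen
      | some v =>
        rw [hdl] at this
        simp at this
        subst this
        exact List.mem_of_getLast? hdl
    simp only [List.mem_append, List.mem_cons] at hu ⊢
    rcases hu with h | rfl | rfl | h
    · exact Or.inl h
    · exact absurd rfl hup
    · exact Or.inr (Or.inl hbd)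
    · exact Or.inr (Or.inr h)
  · simp only [List.length_append, List.length_cons]
    omega

theorem finite_maximalChainBetween [Finite P] (x y : P) :
    {c : List P | IsMaximalChainBetween x y c}.Finite := by
  have := Fintype.ofFinite P
  refine (List.finite_length_le P (Fintype.card P)).subset fun c hc => ?_
  have hnd : c.Nodup := (IsMaximalChainBetween.pairwise hc).imp fun h => h.ne
  exact hnd.length_le_card

/-- Strengthens `List.Lex` to `LexBefore`. Any other chain has a descent, and exchanging it leads to
a strictly earlier chain; by finiteness this ends at the rising one. -/
theorem IsCLLabeling.lexBefore_of_pairwise [OrderBot P] [Finite P] {lab : List P → P → Λ}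
    (hlab : IsCLLabeling lab) {x y : P} {r c : List P} (hxy : x < y)
    (hr : IsMaximalChainBetween ⊥ x r) (hc : IsMaximalChainBetween x y c)
    (hcp : (labelWord lab r c).Pairwise (· < ·)) {c' : List P}
    (hc' : IsMaximalChainBetween x y c') (hne : c' ≠ c) :
    LexBefore (labelWord lab r c) (labelWord lab r c') := by
  have := lexBefore_isStrictOrder lab r
  have hwf := (finite_maximalChainBetween x y).wellFoundedOn
    (r := fun c c' => LexBefore (labelWord lab r c) (labelWord lab r c'))
  revert hne
  refine hwf.induction (P := fun c' => c' ≠ c →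
    LexBefore (labelWord lab r c) (labelWord lab r c')) hc' ?_
  intro c' hc' ih hne
  obtain ⟨d, hd, hdp, hdu⟩ := hlab x y r hxy hr
  have hcd : c = d := by
    by_contra hcd
    exact (hdu c hc hcd).1 hcp
  subst hcd
  have hnp := (hdu c' hc' hne).1
  obtain ⟨p, hp⟩ : ∃ p, IsDescent lab r c' p := by
    by_contra hcon
    push Not at hcon
    exact hnp (pairwise_of_no_descent hcon)
  obtain ⟨c2, h1, h2, -⟩ := hlab.exists_lexBefore_of_descent hr hc' hp
  by_cases h : c2 = c
  · exact h ▸ h2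
  · exact (ih c2 h1 h2 h).trans h2

theorem IsMaximalChainBetween.mem_end {x y : P} {c : List P} (h : IsMaximalChainBetween x y c)
    (hne : c ≠ []) : y ∈ c := by
  have h2 := h.getLast_eq
  rw [List.getLast?_eq_some_getLast hne, Option.getD_some] at h2
  exact h2 ▸ List.getLast_mem hne

theorem exists_split_first {α : Type*} (p : α → Prop) (c : List α) (h : ∃ q ∈ c, p q) :
    ∃ s q t, c = s ++ q :: t ∧ p q ∧ ∀ u ∈ s, ¬ p u := by
  induction c with
  | nil => simp at h
  | cons a c ih =>
    by_cases ha : p a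
    · exact ⟨[], a, c, rfl, ha, by simp⟩
    · obtain ⟨s, q, t, h1, h2, h3⟩ := ih (by simpa [ha] using h)
      exact ⟨a :: s, q, t, by simp [h1], h2, by simpa [ha] using h3⟩

/-- A maximal chain comes first among those through all its descents. Where the chains part, `c`
rises up to its next element q in `G` (or to the end y), and `c'` also passes through q, so the
rising chain of the interval up to q decides. -/
theorem IsCLLabeling.lexBefore_of_descents_subset [OrderBot P] [Finite P] {lab : List P → P → Λ}
    (hlab : IsCLLabeling lab) (G : Set P) {x y : P} {r c c' : List P}
    (hr : IsMaximalChainBetween ⊥ x r) (hc : IsMaximalChainBetween x y c)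
    (hc' : IsMaximalChainBetween x y c') (hdesc : ∀ p, IsDescent lab r c p → p ∈ G)
    (hG : ∀ p ∈ G, p ∈ c → p ∈ c') (hne : c ≠ c') :
    LexBefore (labelWord lab r c) (labelWord lab r c') := by
  induction c generalizing x r c' with
  | nil =>
    rw [isMaximalChainBetween_nil] at hc
    subst hc
    cases c' with
    | nil => exact absurd rfl hne
    | cons z t =>
      obtain ⟨h1, h2⟩ := isMaximalChainBetween_cons.1 hc'
      exact absurd h2.le h1.lt.not_ge
  | cons p t ih =>
    obtain ⟨hxp, ht⟩ := isMaximalChainBetween_cons.1 hc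
    cases c' with
    | nil => exact absurd (isMaximalChainBetween_nil.1 hc') (hxp.lt.trans_le ht.le).ne
    | cons p' t' =>
      obtain ⟨hxp', ht'⟩ := isMaximalChainBetween_cons.1 hc'
      by_cases hpp : p = p'
      · subst hpp
        refine .cons (ih (hr.snoc hxp) ht ht' ?_ ?_ fun h => hne (by rw [h]))
        · rintro q ⟨l, b, s, h1, h2⟩
          exact hdesc q ⟨p :: l, b, s, by simp [h1], by simpa using h2⟩
        · intro q hq hqt
          rcases List.mem_cons.1 (hG q hq (List.mem_cons_of_mem _ hqt)) with rfl | h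
          · exact absurd rfl (ht.lt_of_mem hqt).1.ne
          · exact h
      · obtain ⟨s, q, u, h1, h2, h3⟩ := exists_split_first (fun q => q ∈ G ∨ q = y) (p :: t)
          ⟨y, hc.mem_end (by simp), Or.inr rfl⟩
        have hq : q ∈ p' :: t' := by
          rcases h2 with h2 | rfl
          · exact hG q h2 (by rw [h1]; simp)
          · exact hc'.mem_end (by simp)
        obtain ⟨s', u', h1'⟩ := List.append_of_mem hq
        have key : ∀ {s u : List P}, IsMaximalChainBetween x y (s ++ q :: u) →
            IsMaximalChainBetween x q (s ++ [q]) := by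
          intro s u h
          obtain ⟨m, hm, hm'⟩ := isMaximalChainBetween_append.1 h
          exact hm.snoc (isMaximalChainBetween_cons.1 hm').1
        have hs := key (h1 ▸ hc)
        have hs' := key (h1' ▸ hc')
        have hne' : s' ++ [q] ≠ s ++ [q] := by
          intro h
          have : s' = s := by simpa using h
          subst this
          apply hpp
          cases s' <;> simp_all
        have hrise : (labelWord lab r (s ++ [q])).Pairwise (· < ·) := by
          refine pairwise_of_no_descent fun v ⟨l, b, w, h4, h5⟩ => ?_
          have hv : v ∈ G := hdesc v ⟨l, b, w ++ u, by rw [h1]; simpa using congrArg (· ++ u) h4, h5⟩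
          have hpw := hs.pairwise
          have hvs : v ∈ s := by
            have hvm : v ∈ s ++ [q] := by rw [h4]; simp
            rcases List.mem_append.1 hvm with h | h
            · exact h
            · rw [List.mem_singleton] at h
              subst h
              rw [h4] at hs
              obtain ⟨m, hm, hm'⟩ := isMaximalChainBetween_append.1 hs
              have h6 := (isMaximalChainBetween_cons.1 hm').2
              have h7 := isMaximalChainBetween_cons.1 h6
              exact absurd h7.2.le h7.1.lt.not_ge
          exact h3 v hvs (Or.inl hv)
        have hxq : x < q := (hs.lt_of_mem (by simp)).1
        have := (hlab.lexBefore_of_pairwise hxq hr hs hrise hs' hne').append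
          (labelWord lab (r ++ (s ++ [q])) u) (labelWord lab (r ++ (s' ++ [q])) u')
        rw [← labelWord_append, ← labelWord_append] at this
        rw [h1, h1']
        simpa using this

theorem exists_maximalChain_superset [Finite P] {x y : P} (hxy : x ≤ y) (t : Finset P)
    (ht : IsChain (· ≤ ·) (t : Set P)) (hxt : ∀ p ∈ t, x < p ∧ p ≤ y) :
    ∃ c, IsMaximalChainBetween x y c ∧ ∀ p ∈ t, p ∈ c := by
  classical
  induction x using WellFoundedGT.induction generalizing t with
  | ind x ih =>
    rcases hxy.eq_or_lt with rfl | hlt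
    · refine ⟨[], isMaximalChainBetween_nil.2 rfl, fun p hp => ?_⟩
      exact absurd (hxt p hp).1 (hxt p hp).2.not_gt
    · obtain ⟨m, hxm, hmy, hmt⟩ : ∃ m, x < m ∧ m ≤ y ∧ ∀ p ∈ t, m ≤ p := by
        rcases t.eq_empty_or_nonempty with rfl | hne
        · exact ⟨y, hlt, le_rfl, by simp⟩
        · obtain ⟨m, hm, hmin⟩ := t.exists_minimal hne
          refine ⟨m, (hxt m hm).1, (hxt m hm).2, fun p hp => ?_⟩
          rcases ht.total hm hp with h | h
          · exact h
          · exact hmin hp h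
      obtain ⟨z, hz, hzm⟩ := exists_covBy_le_of_lt hxm
      obtain ⟨c, hc, hct⟩ := ih z hz.lt (hzm.trans hmy) (t.erase z)
        (ht.mono (by simp)) fun p hp => by
          obtain ⟨h1, h2⟩ := Finset.mem_erase.1 hp
          exact ⟨lt_of_le_of_ne (hzm.trans (hmt p h2)) (Ne.symm h1), (hxt p h2).2⟩
      refine ⟨z :: c, isMaximalChainBetween_cons.2 ⟨hz, hc⟩, fun p hp => ?_⟩
      by_cases h : p = z
      · exact h ▸ List.mem_cons_self
      · exact List.mem_cons_of_mem _ (hct p (Finset.mem_erase.2 ⟨h, hp⟩))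

open Classical in
/-- The facet of the order complex of an open interval with top `y` given by a maximal chain. -/
noncomputable def chainFacet (y : P) (c : List P) : Finset P := c.toFinset.erase y

open Classical in
/-- The complexes generated by the large facets in a family of maximal chains. -/
def facetComplex (y : P) (𝓕 : Finset (List P)) (r : ℕ) : Set (Finset P) :=
  {s | ∃ c ∈ 𝓕, s ⊆ chainFacet y c ∧ r ≤ (chainFacet y c).card}

theorem mem_chainFacet {P : Type*} {y p : P} {c : List P} : p ∈ chainFacet y c ↔ p ≠ y ∧ p ∈ c := by
  simp [chainFacet]

theorem IsMaximalChainBetween.isChain {x y : P} {c : List P} (h : IsMaximalChainBetween x y c) :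
    IsChain (· ≤ ·) {p | p ∈ c} := by
  intro a ha b hb hab
  obtain ⟨l, r, rfl⟩ := List.append_of_mem ha
  have hp := h.pairwise
  simp only [List.pairwise_append, List.pairwise_cons, List.mem_cons] at hp
  have hb' : b ∈ l ∨ b = a ∨ b ∈ r := by simpa using hb
  rcases hb' with h1 | h1 | h1
  · exact Or.inr (hp.2.2 b h1 a (Or.inl rfl)).le
  · exact absurd h1.symm hab
  · exact Or.inl (hp.2.1.1 b h1).le

theorem IsMaximalChainBetween.card_chainFacet {x y : P} {c : List P}
    (h : IsMaximalChainBetween x y c) : (chainFacet y c).card = c.length - 1 := by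
  classical
  have hnd : c.Nodup := h.pairwise.imp fun h => h.ne
  by_cases hc : c = []
  · simp [chainFacet, hc]
  · rw [chainFacet, Finset.card_erase_of_mem (List.mem_toFinset.2 (h.mem_end hc)),
      List.toFinset_card_of_nodup hnd]

/-- Induction on a lexicographically initial family: remove a last facet F, and let K be generated
by the other large facets. When F is large, its faces in K are those that miss a descent (`ha`,
`hb`). A vertex of F that is not a descent is then an apex for coning: it pushes the part of a cycle
outside K into K, up to a boundary. -/
theorem IsCLLabeling.facetComplex_acyclic [OrderBot P] [Finite P] {lab : List P → P → Λ}
    (hlab : IsCLLabeling lab) (y : P) (𝓕 : Finset (List P))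
    (hF : ∀ c ∈ 𝓕, IsMaximalChainBetween ⊥ y c)
    (hcl : ∀ c ∈ 𝓕, ∀ c', IsMaximalChainBetween ⊥ y c' →
      LexBefore (labelWord lab [] c') (labelWord lab [] c) → c' ∈ 𝓕) :
    IsSequentiallyAcyclic (facetComplex y 𝓕) := by
  classical
  induction h𝓕 : 𝓕.card using Nat.strong_induction_on generalizing 𝓕 with
  | _ N ih =>
  subst h𝓕
  intro q r hqr z hz hbz
  have hroot : IsMaximalChainBetween (⊥ : P) ⊥ [] := isMaximalChainBetween_nil.2 rfl
  rcases 𝓕.eq_empty_or_nonempty with rfl | hne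
  · refine ⟨0, Submodule.zero_mem _, ?_⟩
    have : z = 0 := by
      rw [← Finsupp.support_eq_empty, Finset.eq_empty_iff_forall_notMem]
      intro s hs
      obtain ⟨⟨c, hc, -⟩, -⟩ := (Finsupp.mem_supported _ _).1 hz hs
      simp at hc
    rw [this, map_zero]
  · obtain ⟨F, hFm, hFmax⟩ : ∃ F ∈ 𝓕, ∀ c ∈ 𝓕,
        ¬ LexBefore (labelWord lab [] F) (labelWord lab [] c) := by
      have := lexBefore_isStrictOrder lab []
      have hwf := (𝓕.finite_toSet).wellFoundedOn
        (r := Function.swap fun c c' => LexBefore (labelWord lab [] c) (labelWord lab [] c'))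
      by_contra hcon
      push Not at hcon
      obtain ⟨F, hF⟩ := hne
      refine hwf.induction (P := fun _ => False) hF fun c hc ih => ?_
      obtain ⟨c', hc', hlt⟩ := hcon c hc
      exact ih c' hc' hlt
    have hFc := hF F hFm
    set K := facetComplex y (𝓕.erase F) r with hK
    have hIH := ih _ (Finset.card_erase_lt_of_mem hFm) (𝓕.erase F)
      (fun c hc => hF c (Finset.mem_of_mem_erase hc))
      (fun c hc c' hc' hlex => by
        refine Finset.mem_erase.2 ⟨?_, hcl c (Finset.mem_of_mem_erase hc) c' hc' hlex⟩
        rintro rfl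
        exact hFmax c (Finset.mem_of_mem_erase hc) hlex) rfl q r hqr
    -- faces that miss a descent lie in earlier facets
    have ha : ∀ s ⊆ chainFacet y F, r ≤ (chainFacet y F).card →
        ∀ p, IsDescent lab [] F p → p ∉ s → s ∈ K := by
      intro s hs hr p hp hps
      obtain ⟨c', h1, h2, h3, h4⟩ := hlab.exists_lexBefore_of_descent hroot hFc hp
      refine ⟨c', Finset.mem_erase.2 ⟨?_, hcl F hFm c' h1 h2⟩, ?_, ?_⟩
      · rintro rfl
        exact LexBefore.irrefl _ h2
      · intro u hu
        obtain ⟨h5, h6⟩ := mem_chainFacet.1 (hs hu)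
        exact mem_chainFacet.2 ⟨h5, h3 u h6 (fun h => hps (h ▸ hu))⟩
      · rw [h1.card_chainFacet]
        rw [hFc.card_chainFacet] at hr
        omega
    have hb : ∀ s ⊆ chainFacet y F, s ∈ K → ∃ p, IsDescent lab [] F p ∧ p ∉ s := by
      rintro s hs ⟨c, hc, hsc, -⟩
      by_contra hcon
      push Not at hcon
      obtain ⟨hne, hc⟩ := Finset.mem_erase.1 hc
      refine hFmax c hc (hlab.lexBefore_of_descents_subset (s : Set P) hroot hFc (hF c hc) hcon
        (fun p hp _ => (mem_chainFacet.1 (hsc hp)).2) (Ne.symm hne))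
    have hKsub : K ⊆ facetComplex y 𝓕 r := fun s ⟨c, hc, h⟩ => ⟨c, Finset.mem_of_mem_erase hc, h⟩
    have hKdown : ∀ s ∈ K, ∀ t ⊆ s, t ∈ K := fun s ⟨c, hc, h, h'⟩ t ht => ⟨c, hc, ht.trans h, h'⟩
    have hsplit : ∀ s ∈ facetComplex y 𝓕 r, s ∉ K →
        s ⊆ chainFacet y F ∧ r ≤ (chainFacet y F).card := by
      rintro s ⟨c, hc, h⟩ hs
      by_cases hcF : c = F
      · exact hcF ▸ h
      · exact absurd ⟨c, Finset.mem_erase.2 ⟨hcF, hc⟩, h⟩ hs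
    have hlift : ∀ z' ∈ Finsupp.supported ℚ ℚ {s | s ∈ K ∧ s.card = q},
        simplicialBoundary P z' = 0 → ∃ w ∈ Finsupp.supported ℚ ℚ
          {s | s ∈ facetComplex y 𝓕 r ∧ s.card = q + 1}, simplicialBoundary P w = z' := by
      intro z' hz' hbz'
      obtain ⟨w, hw, hbw⟩ := hIH z' hz' hbz'
      exact ⟨w, Finsupp.supported_mono (fun s hs => And.intro (hKsub hs.1) hs.2) hw, hbw⟩
    by_cases hall : ∀ s, s ∈ facetComplex y 𝓕 r → s.card = q → s ∈ K
    · exact hlift z (Finsupp.supported_mono (fun s hs => And.intro (hall s hs.1 hs.2) hs.2) hz) hbz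
    · push Not at hall
      obtain ⟨s₀, hs₀, hs₀q, hs₀K⟩ := hall
      obtain ⟨hs₀F, hrF⟩ := hsplit s₀ hs₀ hs₀K
      -- Here q < r ≤ |F| is used. The vertex `v` missed by `s₀` is not a descent, as otherwise `s₀`
      -- would lie in `K`; this one apex then works for all of `z0`.
      obtain ⟨v, hvF, hvs₀⟩ := Finset.exists_mem_notMem_of_card_lt_card
        (s := s₀) (t := chainFacet y F) (by omega)
      have hvd : ¬ IsDescent lab [] F v := fun h => hs₀K (ha s₀ hs₀F hrF v h hvs₀)
      -- decompose the cycle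
      set z0 := z.filter fun s => s ∉ K with hz0
      have hz0s : z0 ∈ Finsupp.supported ℚ ℚ
          {s | s ⊆ chainFacet y F ∧ s.card = q} := by
        rw [Finsupp.mem_supported]
        intro s hs
        rw [hz0, Finsupp.support_filter, Finset.mem_coe, Finset.mem_filter] at hs
        have h1 := (Finsupp.mem_supported _ _).1 hz hs.1
        exact ⟨(hsplit s h1.1 hs.2).1, h1.2⟩
      have hz1s : z - z0 ∈ Finsupp.supported ℚ ℚ {s | s ∈ K ∧ s.card = q} := by
        rw [sub_eq_of_eq_add (Finsupp.filter_add_filter_not z (fun s => s ∈ K)).symm,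
          Finsupp.mem_supported]
        intro s hs
        rw [Finsupp.support_filter, Finset.mem_coe, Finset.mem_filter] at hs
        exact ⟨hs.2, ((Finsupp.mem_supported _ _).1 hz hs.1).2⟩
      have hbz0 : simplicialBoundary P z0 = - simplicialBoundary P (z - z0) := by
        rw [map_sub, hbz, zero_sub, neg_neg]
      have hchainF : IsChain (· ≤ ·) (chainFacet y F : Set P) :=
        hFc.isChain.mono fun p hp => (mem_chainFacet.1 hp).2
      have hb0 : simplicialBoundary P z0 ∈ Finsupp.supported ℚ ℚ
          {s | s ⊆ chainFacet y F ∧ s ∈ K ∧ s.card + 1 = q} := by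
        have h1 : simplicialBoundary P z0 ∈ Finsupp.supported ℚ ℚ
            {s | s ⊆ chainFacet y F ∧ s.card + 1 = q} :=
          by
          refine simplicialBoundary_mem (fun s hs p hp => ?_) hz0s
          exact ⟨(Finset.erase_subset _ _).trans hs.1, by
            rw [Finset.card_erase_add_one hp]; exact hs.2⟩
        have h2 : simplicialBoundary P z0 ∈ Finsupp.supported ℚ ℚ K := by
          rw [hbz0]
          refine Submodule.neg_mem _ (simplicialBoundary_mem (fun s hs p hp => ?_) hz1s)
          exact hKdown s hs.1 _ (Finset.erase_subset _ _)
        rw [Finsupp.mem_supported] at h1 h2 ⊢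
        exact fun s hs => ⟨(h1 hs).1, h2 hs, (h1 hs).2⟩
      have hcone := boundary_coneOperator (v := v) (fun s hs => hchainF.mono (by
        rw [Set.insert_subset_iff]
        exact ⟨hvF, Finset.coe_subset.2 hs.1⟩)) hz0s
      -- The faces in ∂z0 lie in `K`, so each misses a descent, which is not `v`; the cone with apex
      -- `v` misses it as well and stays in `K`.
      have hcb : coneOperator v (simplicialBoundary P z0) ∈
          Finsupp.supported ℚ ℚ {s | s ∈ K ∧ s.card = q} := by
        refine coneOperator_mem (fun s hs hvs => ?_) hb0
        obtain ⟨p, hp, hps⟩ := hb s hs.1 hs.2.1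
        refine ⟨ha _ (Finset.insert_subset hvF hs.1) hrF p hp ?_, ?_⟩
        · rw [Finset.mem_insert, not_or]
          exact ⟨fun h => hvd (h ▸ hp), hps⟩
        · rw [Finset.card_insert_of_notMem hvs]
          exact hs.2.2
      -- The cycle z - ∂(v∗z0) is supported in `K`, so the induction hypothesis fills it; adding
      -- v∗z0 to the filling gives one of z.
      obtain ⟨w, hw, hbw⟩ := hlift ((z - z0) + coneOperator v (simplicialBoundary P z0))
        (Submodule.add_mem _ hz1s hcb) (by
          have : (z - z0) + coneOperator v (simplicialBoundary P z0) =
              z - simplicialBoundary P (coneOperator v z0) := by rw [hcone]; abel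
          rw [this, map_sub, hbz, zero_sub, neg_eq_zero]
          refine boundary_boundary (X := {s | s ⊆ chainFacet y F})
            (fun s hs => hchainF.mono (Finset.coe_subset.2 hs)) ?_
          exact coneOperator_mem (fun s hs _ => Finset.insert_subset hvF hs.1) hz0s)
      refine ⟨w + coneOperator v z0, Submodule.add_mem _ hw ?_, ?_⟩
      · refine coneOperator_mem (fun s hs hvs => ?_) hz0s
        refine ⟨⟨F, hFm, Finset.insert_subset hvF hs.1, hrF⟩, ?_⟩
        rw [Finset.card_insert_of_notMem hvs, hs.2]
      · rw [map_add, hbw, hcone]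
        abel

theorem IsCLShellable.acyclic_Ioo [BoundedOrder P] [Finite P] (h : IsCLShellable P) (y : P)
    (hy : ⊥ < y) : IsSequentiallyAcyclic (largeChains (Set.Ioo ⊥ y)) := by
  classical
  obtain ⟨Λ, _, lab, hlab⟩ := h
  have hfin := finite_maximalChainBetween (⊥ : P) y
  have key := hlab.facetComplex_acyclic y hfin.toFinset (fun c hc => by simpa using hc)
    (fun c _ c' hc' _ => by simpa using hc')
  have : facetComplex y hfin.toFinset = largeChains (Set.Ioo ⊥ y) := by
    funext r
    ext s
    constructor
    · rintro ⟨c, hc, hs, hr⟩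
      have hc : IsMaximalChainBetween ⊥ y c := by simpa using hc
      refine ⟨chainFacet y c, hs, fun p hp => ?_,
        hc.isChain.mono fun p hp => (mem_chainFacet.1 hp).2, hr⟩
      obtain ⟨h1, h2⟩ := mem_chainFacet.1 hp
      obtain ⟨h3, h4⟩ := hc.lt_of_mem h2
      exact ⟨h3, lt_of_le_of_ne h4 h1⟩
    · rintro ⟨t, hst, htQ, ht, hr⟩
      obtain ⟨c, hc, htc⟩ := exists_maximalChain_superset hy.le t ht
        fun p hp => ⟨(htQ hp).1, (htQ hp).2.le⟩
      have htf : t ⊆ chainFacet y c := fun p hp => mem_chainFacet.2 ⟨(htQ hp).2.ne, htc p hp⟩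
      exact ⟨c, by simpa using hc, hst.trans htf, hr.trans (Finset.card_le_card htf)⟩
  rwa [this] at key

end LexShelling

/-! ## Truncations of sequentially acyclic posets -/

section Truncation

variable {P : Type*} [PartialOrder P]

/-- Deleting an antichain of maximal elements. -/
theorem IsSequentiallyAcyclic.sdiff [Finite P] {Q M : Set P} (hMQ : M ⊆ Q)
    (hmax : ∀ x ∈ M, ∀ y ∈ Q, x ≤ y → y = x) (hQ : IsSequentiallyAcyclic (largeChains Q))
    (hlink : ∀ x ∈ M, IsSequentiallyAcyclic (largeChains (Q ∩ Set.Iio x)))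
    (hext : ∀ t : Finset P, IsChain (· ≤ ·) (t : Set P) → (t : Set P) ⊆ Q \ M → t.Nonempty →
      ∃ x ∈ M, ∀ p ∈ t, p < x) :
    IsSequentiallyAcyclic (largeChains (Q \ M)) := by
  classical
  intro q r hqr z hz hbz
  -- An element of `M` on top gives one vertex more, so a filling in `Q` can be sought at index r +
  -- 1. This spare vertex pays for the later loss of an element of `M`.
  have hup : largeChains (Q \ M) r ⊆ largeChains Q (r + 1) := by
    rintro s ⟨t, h1, h2, h3, h4⟩
    obtain ⟨x, hx, hxt⟩ := hext t h3 h2 (Finset.card_pos.1 (by omega))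
    have hxn : x ∉ t := fun h => lt_irrefl _ (hxt x h)
    refine ⟨insert x t, h1.trans (Finset.subset_insert _ _), ?_, ?_, ?_⟩
    · rw [Finset.coe_insert]
      exact Set.insert_subset (hMQ hx) (h2.trans Set.sdiff_subset)
    · rw [Finset.coe_insert]
      exact h3.insert fun p hp _ => Or.inr (hxt p hp).le
    · rw [Finset.card_insert_of_notMem hxn]
      omega
  -- The elements of `M` are removed from a filling one at a time; outside the final complex, only
  -- those in `M'` may still occur. The part of `w` through x has a boundary without x, which is a
  -- cycle in the link of x. Filling it inside the link and substituting this filling for the part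
  -- through x removes x.
  have key : ∀ M' : Finset P, (M' : Set P) ⊆ M → ∀ w ∈ Finsupp.supported ℚ ℚ
      {s : Finset P | s.card = q + 1 ∧ (s ∈ largeChains (Q \ M) r ∨
        (s ∈ largeChains Q (r + 1) ∧ ∀ x ∈ s, x ∈ M → x ∈ M'))},
      simplicialBoundary P w = z → ∃ w' ∈ Finsupp.supported ℚ ℚ
        {s | s ∈ largeChains (Q \ M) r ∧ s.card = q + 1}, simplicialBoundary P w' = z := by
    intro M'
    induction M' using Finset.induction_on with
    | empty =>
      intro _ w hw hbw
      refine ⟨w, Finsupp.supported_mono ?_ hw, hbw⟩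
      rintro s ⟨hs, h | ⟨⟨t, h1, h2, h3, h4⟩, h5⟩⟩
      · exact ⟨h, hs⟩
      · refine ⟨⟨t.filter (· ∉ M), ?_, ?_, ?_, ?_⟩, hs⟩
        · intro p hp
          exact Finset.mem_filter.2 ⟨h1 hp, fun h => by simpa using h5 p hp h⟩
        · intro p hp
          obtain ⟨h6, h7⟩ := Finset.mem_filter.1 hp
          exact ⟨h2 h6, h7⟩
        · exact h3.mono (Finset.coe_subset.2 (Finset.filter_subset _ _))
        -- `M` is an antichain, so a chain with at least r + 1 elements keeps at least r of them
        -- outside `M`.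
        · have hcard : (t.filter (· ∈ M)).card ≤ 1 := by
            rw [Finset.card_le_one]
            intro a ha b hb
            obtain ⟨ha, ha'⟩ := Finset.mem_filter.1 ha
            obtain ⟨hb, hb'⟩ := Finset.mem_filter.1 hb
            rcases h3.total ha hb with h | h
            · exact (hmax a ha' b (hMQ hb') h).symm
            · exact hmax b hb' a (hMQ ha') h
          have := Finset.card_filter_add_card_filter_not (s := t) (· ∈ M)
          omega
    | insert x M' hxM' ih =>
      intro hM' w hw hbw
      have hxM : x ∈ M := hM' (by simp)
      set w0 := w.filter fun s => x ∈ s with hw0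
      have hw0s : w0 ∈ Finsupp.supported ℚ ℚ
          {s : Finset P | x ∈ s ∧ s ∈ largeChains Q (r + 1) ∧ s.card = q + 1} := by
        rw [Finsupp.mem_supported]
        intro s hs
        rw [hw0, Finsupp.support_filter, Finset.mem_coe, Finset.mem_filter] at hs
        obtain ⟨h1, h2⟩ := (Finsupp.mem_supported _ _).1 hw hs.1
        exact ⟨hs.2, h2.elim (fun h => hup h) fun h => h.1, h1⟩
      have hw1 : w - w0 = w.filter fun s => x ∉ s :=
        sub_eq_of_eq_add (by rw [add_comm]; exact (Finsupp.filter_add_filter_not w _).symm)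
      have hw1s : w - w0 ∈ Finsupp.supported ℚ ℚ
          {s : Finset P | s.card = q + 1 ∧ (s ∈ largeChains (Q \ M) r ∨
            (s ∈ largeChains Q (r + 1) ∧ ∀ x ∈ s, x ∈ M → x ∈ M'))} := by
        rw [hw1, Finsupp.mem_supported]
        intro s hs
        rw [Finsupp.support_filter, Finset.mem_coe, Finset.mem_filter] at hs
        obtain ⟨h1, h2⟩ := (Finsupp.mem_supported _ _).1 hw hs.1
        refine ⟨h1, h2.imp id fun h => ⟨h.1, fun y hy hyM => ?_⟩⟩
        rcases Finset.mem_insert.1 (h.2 y hy hyM) with rfl | h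
        · exact absurd hy hs.2
        · exact h
      have hw1x : w - w0 ∈ Finsupp.supported ℚ ℚ {s : Finset P | x ∉ s} := by
        rw [hw1, Finsupp.mem_supported]
        intro s hs
        rw [Finsupp.support_filter, Finset.mem_coe, Finset.mem_filter] at hs
        exact hs.2
      have hux : simplicialBoundary P w0 ∈ Finsupp.supported ℚ ℚ {s : Finset P | x ∉ s} := by
        have : simplicialBoundary P w0 = z - simplicialBoundary P (w - w0) := by
          rw [map_sub, hbw]; abel
        rw [this]
        refine Submodule.sub_mem _ (Finsupp.supported_mono (fun s hs hx => ?_) hz)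
          (simplicialBoundary_mem (X := {s : Finset P | x ∉ s})
            (Y := {s : Finset P | x ∉ s})
            (fun s hs p _ h => hs (Finset.mem_of_mem_erase h)) hw1x)
        exact (largeChains_coe_subset hs.1 hx).2 hxM
      have hu : simplicialBoundary P w0 ∈ Finsupp.supported ℚ ℚ
          {s | s ∈ largeChains (Q ∩ Set.Iio x) r ∧ s.card = q} := by
        have h1 : simplicialBoundary P w0 ∈ Finsupp.supported ℚ ℚ
            {s : Finset P | x ∉ s → s ∈ largeChains (Q ∩ Set.Iio x) r ∧ s.card = q} := by
          refine simplicialBoundary_mem (fun s hs p hp hxp => ?_) hw0s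
          obtain ⟨hxs, ⟨t, h1, h2, h3, h4⟩, hcard⟩ := hs
          have hpx : p = x := by
            by_contra h
            exact hxp (Finset.mem_erase.2 ⟨Ne.symm h, hxs⟩)
          subst hpx
          refine ⟨⟨t.erase p, Finset.erase_subset_erase _ h1, fun y hy => ?_,
            h3.mono (Finset.coe_subset.2 (Finset.erase_subset _ _)), ?_⟩, ?_⟩
          · obtain ⟨hyp, hyt⟩ := Finset.mem_erase.1 hy
            refine ⟨h2 hyt, lt_of_le_of_ne ?_ hyp⟩
            rcases h3.total hyt (h1 hxs) with h | h
            · exact h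
            · exact (hmax p hxM y (h2 hyt) h).le
          · rw [Finset.card_erase_of_mem (h1 hxs)]
            omega
          · rw [Finset.card_erase_of_mem hxs]
            omega
        rw [Finsupp.mem_supported] at h1 hux ⊢
        exact fun s hs => h1 hs (hux hs)
      obtain ⟨v, hv, hbv⟩ := hlink x hxM q r hqr _ hu
        (boundary_boundary (fun s hs => largeChains_isChain hs.2.1) hw0s)
      refine ih (fun y hy => hM' (by simp [Finset.mem_coe.1 hy])) ((w - w0) + v)
        (Submodule.add_mem _ hw1s (Finsupp.supported_mono (fun s hs => ?_) hv)) ?_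
      · refine ⟨hs.2, Or.inl ?_⟩
        obtain ⟨⟨t, h1, h2, h3⟩, -⟩ := hs
        refine ⟨t, h1, fun y hy => ⟨(h2 hy).1, fun hyM => ?_⟩, h3⟩
        exact (h2 hy).2.ne (hmax y hyM x (hMQ hxM) (h2 hy).2.le).symm
      · rw [map_add, hbv, map_sub, hbw]
        abel
  obtain ⟨w, hw, hbw⟩ := hQ q (r + 1) (by omega) z
    (Finsupp.supported_mono (fun s hs => And.intro (hup hs.1) hs.2) hz) hbz
  refine key M.toFinite.toFinset (by simp) w (Finsupp.supported_mono (fun s hs => ?_) hw) hbw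
  exact ⟨hs.2, Or.inr ⟨hs.1, fun x _ hx => by simpa using hx⟩⟩

theorem reducedBetti_eq_zero_of_fill {i : ℤ}
    (h : ∀ q : ℕ, (q : ℤ) = i + 1 → ∀ z ∈ Finsupp.supported ℚ ℚ
      {s : Finset P | IsChain (· ≤ ·) (s : Set P) ∧ s.card = q}, simplicialBoundary P z = 0 →
      ∃ w ∈ Finsupp.supported ℚ ℚ {s : Finset P | IsChain (· ≤ ·) (s : Set P) ∧ s.card = q + 1},
        simplicialBoundary P w = z) : reducedBetti P i = 0 := by
  have hle : reducedCycles P i ≤ reducedBoundaries P i := by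
    rintro z ⟨hz, hbz⟩
    by_cases hi : 0 ≤ i + 1
    · obtain ⟨q, hq⟩ := Int.eq_ofNat_of_zero_le hi
      obtain ⟨w, hw, hbw⟩ := h q hq.symm z
        (Finsupp.supported_mono (fun s hs => And.intro hs.1 (by have := hs.2; omega)) hz) hbz
      exact ⟨w, Finsupp.supported_mono (fun s hs => And.intro hs.1 (by have := hs.2; omega)) hw, hbw⟩
    · have : z = 0 := by
        rw [← Finsupp.support_eq_empty, Finset.eq_empty_iff_forall_notMem]
        intro s hs
        have := ((Finsupp.mem_supported _ _).1 hz hs).2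
        omega
      rw [this]
      exact Submodule.zero_mem _
  have : Subsingleton (ReducedHomology P i) := by
    rw [Submodule.Quotient.subsingleton_iff, Submodule.submoduleOf_eq_top]
    exact hle
  exact Module.finrank_zero_of_subsingleton

end Truncation

/-! ## Truncations of hereditary semilattices -/

section Hereditary

variable {L : Type*} [PartialOrder L] [OrderBot L] {dim : L → ℤ}

theorem exists_le_dim_eq (hher : ∀ x : L, x ≠ ⊥ → 0 < dim x → ∃ y, x < y ∧ dim y = dim x - 1)
    (j : ℕ) {x : L} (hx : x ≠ ⊥) (hj : (j : ℤ) ≤ dim x) : ∃ y, x ≤ y ∧ dim y = j := by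
  obtain ⟨n, hn⟩ : ∃ n : ℕ, dim x = j + n := ⟨(dim x - j).toNat, by omega⟩
  induction n generalizing x with
  | zero => exact ⟨x, le_rfl, by simpa using hn⟩
  | succ n ih =>
    obtain ⟨y, hxy, hy⟩ := hher x hx (by push_cast at hn; omega)
    obtain ⟨y', h1, h2⟩ := ih (x := y) (fun h => not_lt_bot (h ▸ hxy)) (by push_cast at hn; omega)
      (by push_cast at hn; omega)
    exact ⟨y', hxy.le.trans h1, h2⟩

/-- Induction on j, starting from the open interval (⊥, ⊤) of `WithTop L`. The elements of dimension
j are maximal in the truncation at j, with link the interval below them, and heredity provides one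
above each nonempty chain that avoids them. -/
theorem acyclic_truncation [Finite L] (hpos : ∀ x : L, x ≠ ⊥ → 0 ≤ dim x)
    (hanti : ∀ x y : L, x < y → dim y < dim x)
    (hher : ∀ x : L, x ≠ ⊥ → 0 < dim x → ∃ y, x < y ∧ dim y = dim x - 1)
    (hCL : IsCLShellable (WithTop L)) (j : ℕ) :
    IsSequentiallyAcyclic (largeChains {x : L | x ≠ ⊥ ∧ (j : ℤ) ≤ dim x}) := by
  have hcoe : ∀ (y : WithTop L) (Q : Set L), ⊥ < y → (∀ x : L, x ∈ Q ↔ x ≠ ⊥ ∧ (x : WithTop L) < y)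
      → IsSequentiallyAcyclic (largeChains Q) := by
    intro y Q hy hQ
    refine IsSequentiallyAcyclic.comap (WithTop.coeOrderHom) ?_
    convert hCL.acyclic_Ioo y hy using 2
    ext x
    constructor
    · rintro ⟨x, hx, rfl⟩
      obtain ⟨h1, h2⟩ := (hQ x).1 hx
      exact ⟨WithTop.coe_lt_coe.2 (bot_lt_iff_ne_bot.2 h1), h2⟩
    · rintro ⟨h1, h2⟩
      lift x to L using (h2.trans_le le_top).ne
      exact ⟨x, (hQ x).2 ⟨(WithTop.coe_lt_coe.1 h1).ne', h2⟩, rfl⟩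
  induction j with
  | zero =>
    refine hcoe ⊤ _ (WithTop.coe_lt_top _) fun x => ?_
    simp only [Set.mem_ofPred_eq, Nat.cast_zero, WithTop.coe_lt_top, and_true]
    exact ⟨fun h => h.1, fun h => ⟨h, hpos x h⟩⟩
  | succ j ih =>
    have hset : {x : L | x ≠ ⊥ ∧ ((j + 1 : ℕ) : ℤ) ≤ dim x} =
        {x : L | x ≠ ⊥ ∧ (j : ℤ) ≤ dim x} \ {x : L | x ≠ ⊥ ∧ dim x = j} := by
      ext x
      simp only [Set.mem_ofPred_eq, Set.mem_sdiff, not_and]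
      push_cast
      constructor
      · exact fun h => ⟨⟨h.1, by omega⟩, fun _ => by omega⟩
      · exact fun h => ⟨h.1.1, by have := h.2 h.1.1; have := h.1.2; omega⟩
    rw [hset]
    refine ih.sdiff (fun x hx => ⟨hx.1, hx.2.ge⟩) ?_ ?_ ?_
    · intro x hx y hy hxy
      rcases hxy.eq_or_lt with h | h
      · exact h.symm
      · have h1 := hanti x y h
        have h2 := hx.2
        have h3 := hy.2
        omega
    · intro x hx
      refine hcoe x _ (WithTop.coe_lt_coe.2 (bot_lt_iff_ne_bot.2 hx.1)) fun y => ?_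
      simp only [Set.mem_inter_iff, Set.mem_ofPred_eq, Set.mem_Iio, WithTop.coe_lt_coe]
      exact ⟨fun h => ⟨h.1.1, h.2⟩, fun h => ⟨⟨h.1, by
        have h1 := hanti y x h.2
        have h2 := hx.2
        omega⟩, h.2⟩⟩
    · intro t ht htQ hne
      obtain ⟨m, hm, hmax⟩ := t.exists_maximal hne
      obtain ⟨x, hmx, hx⟩ := exists_le_dim_eq hher j (htQ hm).1.1 (htQ hm).1.2
      have hmx' : m < x := lt_of_le_of_ne hmx fun h => (htQ hm).2 ⟨(htQ hm).1.1, h ▸ hx⟩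
      refine ⟨x, ⟨fun h => not_lt_bot (h ▸ hmx'), hx⟩, fun p hp => lt_of_le_of_lt ?_ hmx'⟩
      rcases ht.total hp hm with h | h
      · exact h
      · exact hmax hp h

/-- A maximal chain of a truncation extends to a maximal chain of the semilattice. -/
theorem exists_flag_ncard (hpos : ∀ x : L, x ≠ ⊥ → 0 ≤ dim x)
    (hanti : ∀ x y : L, x < y → dim y < dim x)
    (hher : ∀ x : L, x ≠ ⊥ → 0 < dim x → ∃ y, x < y ∧ dim y = dim x - 1) (j : ℕ)
    (s : Finset L) (hne : s.Nonempty) (hs : IsChain (· ≤ ·) (s : Set L))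
    (hsQ : ∀ x ∈ s, x ≠ ⊥ ∧ (j : ℤ) ≤ dim x)
    (hmax : ∀ x, x ≠ ⊥ → (j : ℤ) ≤ dim x → (∀ y ∈ s, x ≤ y ∨ y ≤ x) → x ∈ s) :
    ∃ t : Flag L, (t : Set L).ncard = s.card + j + 1 := by
  classical
  induction j generalizing s with
  | zero =>
    -- In the truncation at 0 only the least element of `L` is missing; it accounts for the summand
    -- 1.
    have hch : IsChain (· ≤ ·) ((insert ⊥ s : Finset L) : Set L) := by
      rw [Finset.coe_insert]
      exact hs.insert fun p _ _ => Or.inl bot_le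
    refine ⟨⟨(insert ⊥ s : Finset L), hch, ?_⟩, ?_⟩
    · intro u hu hsu
      refine hsu.antisymm fun x hx => ?_
      rw [Finset.coe_insert, Set.mem_insert_iff]
      by_cases hx0 : x = ⊥
      · exact Or.inl hx0
      · refine Or.inr (hmax x hx0 (by simpa using hpos x hx0) fun y hy => ?_)
        exact hu.total hx (hsu (by simp [hy]))
    · change ((insert ⊥ s : Finset L) : Set L).ncard = _
      rw [Set.ncard_coe_finset, Finset.card_insert_of_notMem fun h => (hsQ _ h).1 rfl]
  | succ j ih =>
    obtain ⟨m, hm, hmmax⟩ := s.exists_maximal hne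
    have hle : ∀ p ∈ s, p ≤ m := fun p hp => (hs.total hp hm).elim id fun h => hmmax hp h
    obtain ⟨hm0, hmj⟩ := hsQ m hm
    -- By heredity and maximality, `s` contains an element of dimension exactly j + 1. One element
    -- of dimension j above it makes the chain maximal for the next truncation.
    obtain ⟨x, hmx, hx⟩ := exists_le_dim_eq hher (j + 1) hm0 hmj
    have hx0 : x ≠ ⊥ := fun h => hm0 (le_bot_iff.1 (h ▸ hmx))
    have hxs : x ∈ s := hmax x hx0 hx.ge fun y hy => Or.inr ((hle y hy).trans hmx)
    obtain ⟨e, hxe, he⟩ := hher x hx0 (by rw [hx]; positivity)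
    have he0 : e ≠ ⊥ := fun h => not_lt_bot (h ▸ hxe)
    have hej : dim e = j := by rw [he, hx]; push_cast; ring
    have hlt : ∀ p ∈ s, p < e := fun p hp => ((hle p hp).trans hmx).trans_lt hxe
    have hes : e ∉ s := fun h => lt_irrefl _ (hlt e h)
    obtain ⟨t, ht⟩ := ih (insert e s) ⟨e, by simp⟩
      (by rw [Finset.coe_insert]; exact hs.insert fun p hp _ => Or.inr (hlt p hp).le)
      (fun y hy => by
        rcases Finset.mem_insert.1 hy with rfl | hy
        · exact ⟨he0, hej.ge⟩
        · have := hsQ y hy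
          push_cast at this
          exact ⟨this.1, by omega⟩)
      (fun y hy0 hyj hyc => by
        by_cases hyj' : ((j + 1 : ℕ) : ℤ) ≤ dim y
        · exact Finset.mem_insert_of_mem
            (hmax y hy0 hyj' fun p hp => hyc p (Finset.mem_insert_of_mem hp))
        · push_cast at hyj'
          rw [Finset.mem_insert]
          left
          rcases hyc e (Finset.mem_insert_self _ _) with h | h
          · by_contra hne
            have := hanti y e (lt_of_le_of_ne h hne)
            omega
          · by_contra hne
            have := hanti e y (lt_of_le_of_ne h (Ne.symm hne))
            omega)
    refine ⟨t, ?_⟩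
    rw [ht, Finset.card_insert_of_notMem hes]
    omega

/-- A maximal chain of the truncation with q = i + 1 elements yields a flag with i + j + 2 elements,
and a single element of dimension d yields one with d + 2. If these are not congruent, no such
maximal chain exists, all chains with q elements lie in larger ones, and acyclicity at r = q + 1
applies. -/
theorem reducedBetti_truncation_eq_zero [Finite L] (hpos : ∀ x : L, x ≠ ⊥ → 0 ≤ dim x)
    (hanti : ∀ x y : L, x < y → dim y < dim x)
    (hher : ∀ x : L, x ≠ ⊥ → 0 < dim x → ∃ y, x < y ∧ dim y = dim x - 1) {d m : ℕ}
    (hd : ∃ a : L, a ≠ ⊥ ∧ dim a = d) (hd' : ∀ x : L, x ≠ ⊥ → dim x ≤ d)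
    (hpure : ∀ s t : Flag L, ((s : Set L).ncard : ℤ) - 1 ≡ ((t : Set L).ncard : ℤ) - 1 [ZMOD m])
    (hCL : IsCLShellable (WithTop L)) (j : ℕ) (i : ℤ) (hj : j ≤ d)
    (hij : ¬ (i + (j : ℤ) ≡ (d : ℤ) [ZMOD (m : ℤ)])) :
    reducedBetti {x : L // x ≠ ⊥ ∧ (j : ℤ) ≤ dim x} i = 0 := by
  classical
  have hac := acyclic_truncation hpos hanti hher hCL j
  have hac' : IsSequentiallyAcyclic
      (largeChains (Set.univ : Set {x : L // x ≠ ⊥ ∧ (j : ℤ) ≤ dim x})) := by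
    refine IsSequentiallyAcyclic.comap (OrderEmbedding.subtype _) ?_
    convert hac using 2
    ext x
    simp
  refine reducedBetti_eq_zero_of_fill fun q hq z hz hbz => ?_
  obtain ⟨a, ha0, had⟩ := hd
  have hlarge : ∀ s : Finset {x : L // x ≠ ⊥ ∧ (j : ℤ) ≤ dim x},
      IsChain (· ≤ ·) (s : Set {x : L // x ≠ ⊥ ∧ (j : ℤ) ≤ dim x}) → s.card = q →
        s ∈ largeChains Set.univ (q + 1) := by
    intro s hs hsq
    by_contra hcon
    have hmax : ∀ x, (∀ y ∈ s, x ≤ y ∨ y ≤ x) → x ∈ s := by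
      intro x hx
      by_contra hxs
      refine hcon ⟨insert x s, Finset.subset_insert _ _, Set.subset_univ _, ?_, ?_⟩
      · rw [Finset.coe_insert]
        exact hs.insert fun p hp _ => hx p hp
      · rw [Finset.card_insert_of_notMem hxs, hsq]
    -- The case q = 0: since j ≤ d, the truncation contains `a`, and the empty chain is not maximal.
    have hne : s.Nonempty := by
      rw [Finset.nonempty_iff_ne_empty]
      rintro rfl
      simpa using hmax ⟨a, ha0, by rw [had]; exact_mod_cast hj⟩ (by simp)
    obtain ⟨t, ht⟩ := exists_flag_ncard hpos hanti hher j
      (s.map (Function.Embedding.subtype _)) (by simpa using hne)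
      (by
        rw [Finset.coe_map]
        rintro _ ⟨a, ha, rfl⟩ _ ⟨b, hb, rfl⟩ hab
        exact hs ha hb fun h => hab (by rw [h]))
      (by
        intro x hx
        obtain ⟨y, -, rfl⟩ := Finset.mem_map.1 hx
        exact y.2)
      (fun x hx0 hxj hxc => Finset.mem_map.2 ⟨⟨x, hx0, hxj⟩, hmax _ fun y hy =>
        hxc y (Finset.mem_map.2 ⟨y, hy, rfl⟩), rfl⟩)
    obtain ⟨t', ht'⟩ := exists_flag_ncard hpos hanti hher d {a} (by simp) (by simp)
      (by simp [ha0, had]) (fun x hx0 hxd hxc => by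
        rw [Finset.mem_singleton]
        have h1 := hd' x hx0
        rcases hxc a (by simp) with h | h
        · by_contra hne
          have := hanti x a (lt_of_le_of_ne h hne)
          omega
        · by_contra hne
          have := hanti a x (lt_of_le_of_ne h (Ne.symm hne))
          omega)
    have := hpure t t'
    rw [ht, ht', Finset.card_map, Finset.card_singleton, hsq] at this
    apply hij
    have h2 := this.sub_right 1
    push_cast at h2
    convert h2 using 1 <;> omega
  obtain ⟨w, hw, hbw⟩ := hac' q (q + 1) (by omega) z
    (Finsupp.supported_mono (fun s hs => And.intro (hlarge s hs.1 hs.2) hs.2) hz) hbz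
  exact ⟨w, Finsupp.supported_mono
    (fun s hs => And.intro (largeChains_isChain hs.1) hs.2) hw, hbw⟩

end Hereditary

/-! ## Flats of the `k`-equal arrangements

The coordinates are numbered from `1` to `n`, and the coordinate number `0` is identically zero, so
that the subspaces `x i₁ = ⋯ = x iₖ₋₁ = 0` are given by `k` equal coordinates as well. The
arrangement of type A is the case where `B` is false, and that of type B the case where `B` is
true. -/

section KEqualFlats

variable {F : Type*} [Field F] {n : ℕ} (B : Prop)

/-- The signs that are allowed in the equations. -/
def IsSign (c : F) : Prop := c = 1 ∨ (B ∧ c = -1)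

variable {B}

theorem isSign_one : IsSign B (1 : F) := Or.inl rfl

theorem IsSign.mul_self {c : F} (h : IsSign B c) : c * c = 1 := by
  rcases h with rfl | ⟨-, rfl⟩ <;> ring

theorem IsSign.ne_zero {c : F} (h : IsSign B c) : c ≠ 0 := by
  intro h0
  have := h.mul_self
  simp [h0] at this

theorem IsSign.mul {c d : F} (h : IsSign B c) (h' : IsSign B d) : IsSign B (c * d) := by
  rcases h with rfl | ⟨hB, rfl⟩ <;> rcases h' with rfl | ⟨hB', rfl⟩
  · exact Or.inl (by ring)
  · exact Or.inr ⟨hB', by ring⟩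
  · exact Or.inr ⟨hB, by ring⟩
  · exact Or.inl (by ring)

theorem IsSign.eq_or {c d : F} (h : IsSign B c) (h' : IsSign B d) : c = d ∨ (B ∧ c = -d) := by
  rcases h with rfl | ⟨hB, rfl⟩ <;> rcases h' with rfl | ⟨hB', rfl⟩
  · exact Or.inl rfl
  · exact Or.inr ⟨hB', by ring⟩
  · exact Or.inr ⟨hB, by ring⟩
  · exact Or.inl rfl

/-- The coordinates, the `0`-th one being zero. -/
def coord (p : Fin (n + 1)) : (Fin n → F) →ₗ[F] F :=
  Fin.cases (motive := fun _ => (Fin n → F) →ₗ[F] F) 0 (fun i => LinearMap.proj i) p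

@[simp] theorem coord_zero (v : Fin n → F) : coord 0 v = 0 := rfl

@[simp] theorem coord_succ (i : Fin n) (v : Fin n → F) : coord i.succ v = v i := rfl

theorem coord_mk {f : Fin (n + 1) → F} (hf : f 0 = 0) (p : Fin (n + 1)) :
    coord p (fun i : Fin n => f i.succ) = f p := by
  cases p using Fin.cases with
  | zero => simp [hf]
  | succ i => simp

theorem ext_coord {v w : Fin n → F} (h : ∀ p, coord p v = coord p w) : v = w := by
  ext i
  simpa using h i.succ

/-- The subspace where the coordinates in `S` agree up to the signs `ε`. -/
def eqSubspace (ε : Fin (n + 1) → F) (S : Finset (Fin (n + 1))) : Submodule F (Fin n → F) where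
  carrier := {v | ∀ a ∈ S, ∀ b ∈ S, ε a * coord a v = ε b * coord b v}
  zero_mem' := by intro a _ b _; simp
  add_mem' := by
    intro x y hx hy a ha b hb
    simp only [map_add, mul_add, hx a ha b hb, hy a ha b hb]
  smul_mem' := by
    intro t x hx a ha b hb
    simp only [map_smul, smul_eq_mul, mul_left_comm _ t, hx a ha b hb]

theorem mem_eqSubspace {ε : Fin (n + 1) → F} {S : Finset (Fin (n + 1))} {v : Fin n → F} :
    v ∈ eqSubspace ε S ↔ ∀ a ∈ S, ∀ b ∈ S, ε a * coord a v = ε b * coord b v := Iff.rfl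

/-- The subspace where two coordinates agree up to the sign `c`. -/
def eqHyperplane (c : F) (p q : Fin (n + 1)) : Submodule F (Fin n → F) :=
  LinearMap.ker (coord p - c • coord q)

theorem mem_eqHyperplane {c : F} {p q : Fin (n + 1)} {v : Fin n → F} :
    v ∈ eqHyperplane c p q ↔ coord p v = c * coord q v := by
  simp [eqHyperplane, sub_eq_zero]

theorem eqHyperplane_comm {c : F} (hc : c * c = 1) (p q : Fin (n + 1)) :
    eqHyperplane c p q = eqHyperplane c q p := by
  ext v
  rw [mem_eqHyperplane, mem_eqHyperplane]
  constructor <;> intro h <;> rw [h, ← mul_assoc, hc, one_mul]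

variable (B F n) in
/-- The `k`-equal arrangement of type A or B. -/
def kEqual (k : ℕ) : Set (Submodule F (Fin n → F)) :=
  {K | ∃ (ε : Fin (n + 1) → F) (S : Finset (Fin (n + 1))), S.card = k ∧ (∀ p, IsSign B (ε p)) ∧
    (¬ B → 0 ∉ S) ∧ K = eqSubspace ε S}

/-- The intersections of members of an arrangement. -/
def IsFlat {C : Type*} [CompleteLattice C] (A : Set C) (V : C) : Prop := ∃ S ⊆ A, V = sInf S

theorem IsFlat.inf {C : Type*} [CompleteLattice C] {A : Set C} {V W : C} (hV : IsFlat A V)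
    (hW : IsFlat A W) : IsFlat A (V ⊓ W) := by
  obtain ⟨S, hS, rfl⟩ := hV
  obtain ⟨T, hT, rfl⟩ := hW
  exact ⟨S ∪ T, Set.union_subset hS hT, sInf_union.symm⟩

theorem isFlat_of_mem {C : Type*} [CompleteLattice C] {A : Set C} {V : C} (hV : V ∈ A) :
    IsFlat A V := ⟨{V}, by simpa using hV, by simp⟩

variable (B) in
/-- Two coordinates agree up to sign on `V`. -/
def CoordRel (V : Submodule F (Fin n → F)) (p q : Fin (n + 1)) : Prop :=
  ∃ c : F, IsSign B c ∧ ∀ v ∈ V, coord p v = c * coord q v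

variable (B) in
/-- A coordinate that agrees up to sign with another one. -/
def Nontriv (V : Submodule F (Fin n → F)) (p : Fin (n + 1)) : Prop :=
  p ≠ 0 ∧ ∃ q, q ≠ p ∧ CoordRel B V q p

variable (B) in
/-- A coordinate that does not agree up to sign with a previous one. -/
def IsLeader (V : Submodule F (Fin n → F)) (p : Fin (n + 1)) : Prop := ∀ q < p, ¬ CoordRel B V q p

variable {V W U : Submodule F (Fin n → F)} {p q r : Fin (n + 1)} {k : ℕ}

theorem CoordRel.refl (V : Submodule F (Fin n → F)) (p : Fin (n + 1)) : CoordRel B V p p :=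
  ⟨1, isSign_one, by simp⟩

theorem CoordRel.symm (h : CoordRel B V p q) : CoordRel B V q p := by
  obtain ⟨c, hc, h⟩ := h
  exact ⟨c, hc, fun v hv => by rw [h v hv, ← mul_assoc, hc.mul_self, one_mul]⟩

theorem CoordRel.trans (h : CoordRel B V p q) (h' : CoordRel B V q r) : CoordRel B V p r := by
  obtain ⟨c, hc, h⟩ := h
  obtain ⟨d, hd, h'⟩ := h'
  exact ⟨c * d, hc.mul hd, fun v hv => by rw [h v hv, h' v hv, mul_assoc]⟩

theorem CoordRel.mono (hWV : W ≤ V) (h : CoordRel B V p q) : CoordRel B W p q := by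
  obtain ⟨c, hc, h⟩ := h
  exact ⟨c, hc, fun v hv => h v (hWV hv)⟩

theorem rel_zero_iff : CoordRel B V p 0 ↔ ∀ v ∈ V, coord p v = 0 := by
  constructor
  · rintro ⟨c, -, h⟩ v hv
    simpa using h v hv
  · exact fun h => ⟨1, isSign_one, fun v hv => by simpa using h v hv⟩

theorem Nontriv.mono (hWV : W ≤ V) (h : Nontriv B V p) : Nontriv B W p :=
  ⟨h.1, h.2.imp fun _ h => ⟨h.1, h.2.mono hWV⟩⟩

theorem IsLeader.mono (hWV : W ≤ V) (h : IsLeader B W p) : IsLeader B V p :=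
  fun q hq hr => h q hq (hr.mono hWV)

theorem isLeader_zero : IsLeader B V 0 := fun q hq => absurd hq (Fin.not_lt_zero q)

theorem CoordRel.nontriv_left (h : CoordRel B V p q) (hp : p ≠ 0) (hpq : p ≠ q) : Nontriv B V p :=
  ⟨hp, q, hpq.symm, h.symm⟩

theorem CoordRel.eq_of_leader (h : CoordRel B V p q) (hp : IsLeader B V p) (hq : IsLeader B V q) :
    p = q := by
  rcases lt_trichotomy p q with h1 | h1 | h1
  · exact absurd h (hq p h1)
  · exact h1
  · exact absurd h.symm (hp q h1)

theorem exists_leader (V : Submodule F (Fin n → F)) (p : Fin (n + 1)) :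
    ∃ m, IsLeader B V m ∧ CoordRel B V m p := by
  induction p using WellFoundedLT.induction with
  | ind p ih =>
    by_cases hp : IsLeader B V p
    · exact ⟨p, hp, CoordRel.refl V p⟩
    · unfold IsLeader at hp
      push Not at hp
      obtain ⟨q, hq, hqp⟩ := hp
      obtain ⟨m, hm, hmq⟩ := ih q hq
      exact ⟨m, hm, hmq.trans hqp⟩

theorem rel_inf_eqHyperplane {c : F} (hc : IsSign B c) : CoordRel B (V ⊓ eqHyperplane c p q) p q :=
  ⟨c, hc, fun _ hv => mem_eqHyperplane.1 hv.2⟩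

theorem rel_inf_eqSubspace {ε : Fin (n + 1) → F} (hε : ∀ p, IsSign B (ε p))
    {S : Finset (Fin (n + 1))} (hp : p ∈ S) (hq : q ∈ S) : CoordRel B (V ⊓ eqSubspace ε S) p q :=
  ⟨ε p * ε q, (hε p).mul (hε q), fun v hv => by
    rw [mul_assoc, ← mem_eqSubspace.1 hv.2 p hp q hq, ← mul_assoc, (hε p).mul_self, one_mul]⟩

/-- The part of a vector of a flat on a union of blocks is in the flat. -/
theorem IsFlat.exists_restrict (hV : IsFlat (kEqual F n B k) V) {T : Fin (n + 1) → Prop}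
    [DecidablePred T] (hT : ∀ p q, CoordRel B V p q → T p → T q) {u : Fin n → F} (hu : u ∈ V) :
    ∃ v ∈ V, ∀ q, coord q v = if T q then coord q u else 0 := by
  have hc := coord_mk (f := fun q => if T q then coord q u else 0) (by simp)
  refine ⟨_, ?_, hc⟩
  obtain ⟨A, hA, hVA⟩ := hV
  have hmem : ∀ K ∈ A, V ≤ K := fun K hK => hVA ▸ sInf_le hK
  rw [hVA, Submodule.mem_sInf]
  intro K hK
  obtain ⟨ε, S, hS, hε, -, rfl⟩ := hA hK
  intro a ha b hb
  rw [hc, hc]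
  have hrel : ∀ a ∈ S, ∀ b ∈ S, CoordRel B V a b := fun a ha b hb =>
    (rel_inf_eqSubspace (V := ⊤) hε ha hb).mono (le_inf le_top (hmem _ hK))
  by_cases h : T a
  · rw [if_pos h, if_pos (hT a b (hrel a ha b hb) h)]
    exact mem_eqSubspace.1 (hmem _ hK hu) a ha b hb
  · rw [if_neg h, if_neg (fun h' => h (hT b a (hrel b hb a ha) h')), mul_zero, mul_zero]

/-- Restrict to the block of p a vector of the flat that does not vanish at p, and rescale. Such
vectors tell the blocks apart. -/
theorem IsFlat.exists_block_vector (hV : IsFlat (kEqual F n B k) V) (hp : ¬ CoordRel B V p 0) :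
    ∃ v ∈ V, coord p v = 1 ∧ ∀ q, ¬ CoordRel B V q p → coord q v = 0 := by
  classical
  rw [rel_zero_iff] at hp
  push Not at hp
  obtain ⟨u, hu, hup⟩ := hp
  obtain ⟨v, hv, hvq⟩ := hV.exists_restrict (T := fun q => CoordRel B V q p)
    (fun a b hab ha => hab.symm.trans ha) hu
  refine ⟨(coord p u)⁻¹ • v, V.smul_mem _ hv, ?_, fun q hq => ?_⟩
  · rw [map_smul, hvq, if_pos (CoordRel.refl V p), smul_eq_mul, inv_mul_cancel₀ hup]
  · rw [map_smul, hvq, if_neg hq, smul_zero]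

theorem not_rel_zero_of_not_nontriv (hp0 : p ≠ 0) (hp : ¬ Nontriv B V p) : ¬ CoordRel B V p 0 :=
  fun h => hp ⟨hp0, 0, Ne.symm hp0, h.symm⟩

theorem IsFlat.exists_single (hV : IsFlat (kEqual F n B k) V) (hp0 : p ≠ 0)
    (hp : ¬ Nontriv B V p) :
    ∃ v ∈ V, ∀ q, coord q v = if q = p then (1 : F) else 0 := by
  obtain ⟨v, hv, h1, h2⟩ := hV.exists_block_vector (not_rel_zero_of_not_nontriv hp0 hp)
  refine ⟨v, hv, fun q => ?_⟩
  split_ifs with h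
  · rw [h, h1]
  · exact h2 q fun hr => hp ⟨hp0, q, h, hr⟩

/-- The coordinates that form a block on their own are free. -/
theorem IsFlat.exists_adjust (hV : IsFlat (kEqual F n B k) V) (T : Finset (Fin (n + 1)))
    (hT : ∀ p ∈ T, ¬ Nontriv B V p) (f : Fin (n + 1) → F) (hf : f 0 = 0) {v : Fin n → F}
    (hv : v ∈ V) : ∃ w ∈ V, ∀ q, coord q w = if q ∈ T then f q else coord q v := by
  classical
  induction T using Finset.induction_on with
  | empty => exact ⟨v, hv, by simp⟩
  | insert t T ht ih =>
    obtain ⟨w, hw, hwq⟩ := ih fun p hp => hT p (Finset.mem_insert_of_mem hp)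
    by_cases ht0 : t = 0
    · refine ⟨w, hw, fun q => ?_⟩
      by_cases hq : q = t
      · subst hq
        subst ht0
        rw [if_pos (Finset.mem_insert_self _ _), hf, coord_zero]
      · rw [hwq]
        simp [hq]
    · obtain ⟨e, he, heq⟩ := hV.exists_single ht0 (hT t (Finset.mem_insert_self _ _))
      refine ⟨w + (f t - coord t w) • e, V.add_mem hw (V.smul_mem _ he), fun q => ?_⟩
      rw [map_add, map_smul, heq]
      by_cases hq : q = t
      · subst hq
        simp
      · simp [hq, hwq]

/-- If no defining member involved p, the unit vector at p would lie in `V`, and p could not be tied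
to another coordinate. -/
theorem IsFlat.exists_eqSubspace_of_nontriv (hV : IsFlat (kEqual F n B k) V)
    (hp : Nontriv B V p) : ∃ (ε : Fin (n + 1) → F) (S : Finset (Fin (n + 1))), S.card = k ∧
      (∀ p, IsSign B (ε p)) ∧ (¬ B → 0 ∉ S) ∧ p ∈ S ∧ V ≤ eqSubspace ε S := by
  by_contra hcon
  push Not at hcon
  obtain ⟨hp0, q, hqp, c, hc, hrel⟩ := hp
  have hmk := coord_mk (f := fun q => if q = p then (1 : F) else 0) (by simp [Ne.symm hp0])
  have hmem : (fun i : Fin n => if i.succ = p then (1 : F) else 0) ∈ V := by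
    obtain ⟨A, hA, hVA⟩ := hV
    rw [hVA, Submodule.mem_sInf]
    intro K hK
    obtain ⟨ε, S, hS, hε, h0, rfl⟩ := hA hK
    have hpS : p ∉ S := fun h => hcon ε S hS hε h0 h (hVA ▸ sInf_le hK)
    intro a ha b hb
    have hap : a ≠ p := fun h => hpS (h ▸ ha)
    have hbp : b ≠ p := fun h => hpS (h ▸ hb)
    rw [hmk, hmk]
    simp [hap, hbp]
  have := hrel _ hmem
  rw [hmk, hmk] at this
  simp [hqp] at this
  exact hc.ne_zero this.symm

/-- The hyperplanes through a coordinate that is not free have flat intersections with a flat. -/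
theorem IsFlat.inf_eqHyperplane (hk : 2 ≤ k) (h2 : B → (2 : F) ≠ 0)
    (hV : IsFlat (kEqual F n B k) V) (hp : Nontriv B V p) {c : F} (hc : IsSign B c)
    (hq : ¬ B → q ≠ 0) : IsFlat (kEqual F n B k) (V ⊓ eqHyperplane c p q) := by
  classical
  obtain ⟨ε, S, hS, hε, h0, hpS, hVS⟩ := hV.exists_eqSubspace_of_nontriv hp
  -- For q outside `S`, exchange q for some element of `S` other than p. Modulo the equations of
  -- `V`, the new member of the arrangement imposes just the relation between p and q.
  have key : ∀ {q : Fin (n + 1)} {c : F}, IsSign B c → (¬ B → q ≠ 0) → q ∉ S →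
      IsFlat (kEqual F n B k) (V ⊓ eqHyperplane c p q) := by
    intro q c hc hq hqS
    obtain ⟨s, hs, hsp⟩ := Finset.exists_mem_ne (by omega : 1 < S.card) p
    have hqp : p ≠ q := fun h => hqS (h ▸ hpS)
    set ε' := Function.update ε q (ε p * c) with hε'
    have hε's : ∀ a ∈ S, ε' a = ε a := fun a ha =>
      Function.update_of_ne (fun h : a = q => hqS (h ▸ ha)) _ _
    have hε'q : ε' q = ε p * c := Function.update_self _ _ _
    have heq : V ⊓ eqHyperplane c p q = V ⊓ eqSubspace ε' (insert q (S.erase s)) := by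
      ext v
      simp only [Submodule.mem_inf]
      refine and_congr_right fun hv => ?_
      rw [mem_eqHyperplane, mem_eqSubspace]
      constructor
      · intro h
        have : ∀ a ∈ insert q (S.erase s), ε' a * coord a v = ε p * coord p v := by
          intro a ha
          rcases Finset.mem_insert.1 ha with rfl | ha
          · rw [hε'q, h, mul_assoc]
          · have ha := Finset.mem_of_mem_erase ha
            rw [hε's a ha]
            exact mem_eqSubspace.1 (hVS hv) a ha p hpS
        intro a ha b hb
        rw [this a ha, this b hb]
      · intro h
        have := h p (Finset.mem_insert_of_mem (Finset.mem_erase.2 ⟨hsp.symm, hpS⟩)) q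
          (Finset.mem_insert_self _ _)
        rw [hε's p hpS, hε'q, mul_assoc] at this
        exact mul_left_cancel₀ (hε p).ne_zero this
    rw [heq]
    refine hV.inf (isFlat_of_mem ⟨ε', insert q (S.erase s), ?_, fun a => ?_, fun hB h => ?_, rfl⟩)
    · rw [Finset.card_insert_of_notMem fun h => hqS (Finset.mem_of_mem_erase h),
        Finset.card_erase_of_mem hs]
      omega
    · by_cases ha : a = q
      · rw [ha, hε'q]
        exact (hε p).mul hc
      · rw [hε', Function.update_of_ne ha]
        exact hε a
    · rcases Finset.mem_insert.1 h with h | h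
      · exact hq hB h.symm
      · exact h0 hB (Finset.mem_of_mem_erase h)
  by_cases hqS : q ∈ S
  · have hpq : ∀ v ∈ V, coord p v = (ε p * ε q) * coord q v := fun v hv => by
      rw [mul_assoc, ← mem_eqSubspace.1 (hVS hv) p hpS q hqS, ← mul_assoc, (hε p).mul_self,
        one_mul]
    rcases hc.eq_or ((hε p).mul (hε q)) with h | ⟨hB, h⟩
    · have : V ⊓ eqHyperplane c p q = V :=
        inf_eq_left.2 fun v hv => mem_eqHyperplane.2 (h ▸ hpq v hv)
      rwa [this]
    -- The signs conflict, so the new equation says 2xₚ = 0, that is, xₚ = 0; this is the relation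
    -- between p and the zeroth coordinate.
    · have heq : V ⊓ eqHyperplane c p q = V ⊓ eqHyperplane 1 p 0 := by
        ext v
        simp only [Submodule.mem_inf]
        refine and_congr_right fun hv => ?_
        rw [mem_eqHyperplane, mem_eqHyperplane, coord_zero, mul_zero]
        have h1 := hpq v hv
        constructor
        · intro h3
          have : 2 * coord p v = 0 := by
            rw [h, neg_mul, ← h1] at h3
            linear_combination h3
          exact (mul_eq_zero.1 this).resolve_left (h2 hB)
        · intro h3
          rw [h3] at h1
          rw [h3, h, neg_mul, ← h1, neg_zero]
      rw [heq]
      by_cases h0S : 0 ∈ S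
      · have : V ⊓ eqHyperplane (1 : F) p 0 = V := by
          refine inf_eq_left.2 fun v hv => mem_eqHyperplane.2 ?_
          have := mem_eqSubspace.1 (hVS hv) p hpS 0 h0S
          rw [coord_zero, mul_zero] at this
          rw [coord_zero, mul_zero]
          exact (mul_eq_zero.1 this).resolve_left (hε p).ne_zero
        rwa [this]
      · exact key isSign_one (fun h => absurd hB h) h0S
  · exact key hc hq hqS

end KEqualFlats

/-! ## The steps from a flat to smaller flats -/

section Steps

variable {F : Type*} [Field F] {n : ℕ} {B : Prop} {V W U z : Submodule F (Fin n → F)}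
  {p q r a b c i j : Fin (n + 1)} {k : ℕ}

variable (B) in
/-- Two nontrivial blocks are merged, or a nontrivial block is merged into the zero block; the
block of the leader `b` is merged into a block with a smaller leader. -/
def IsMerge (V z : Submodule F (Fin n → F)) (b : Fin (n + 1)) : Prop :=
  ∃ (c : Fin (n + 1)) (s : F), c < b ∧ Nontriv B V b ∧ (c = 0 ∨ Nontriv B V c) ∧
    IsLeader B V b ∧ IsLeader B V c ∧ IsSign B s ∧ z = V ⊓ eqHyperplane s b c

variable (B) in
/-- A free coordinate is adjoined to a nontrivial block. -/
def IsAdjoin (V z : Submodule F (Fin n → F)) (a : Fin (n + 1)) : Prop :=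
  ∃ (i : Fin (n + 1)) (s : F), Nontriv B V i ∧ ¬ Nontriv B V a ∧ a ≠ 0 ∧ IsSign B s ∧
    z = V ⊓ eqHyperplane s a i

variable (B) in
/-- A new block of free coordinates, or a zero block of free coordinates, is created; its largest
element is `a`. -/
def IsNewBlock (k : ℕ) (V z : Submodule F (Fin n → F)) (a : Fin (n + 1)) : Prop :=
  ∃ (ε : Fin (n + 1) → F) (S : Finset (Fin (n + 1))), S.card = k ∧ (∀ p, IsSign B (ε p)) ∧
    (¬ B → 0 ∉ S) ∧ (∀ p ∈ S, ¬ Nontriv B V p) ∧ (0 ∈ S → ∀ p, p ≠ 0 → ¬ CoordRel B V p 0) ∧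
    a ∈ S ∧ (∀ p ∈ S, p ≤ a) ∧ z = V ⊓ eqSubspace ε S

/-- In type A all flats contain the vector with all entries 1, so no true coordinate vanishes on
them. -/
theorem IsFlat.zero_block (hW : IsFlat (kEqual F n B k) W) (h : CoordRel B W p 0) (hp : p ≠ 0) :
    B := by
  by_contra hB
  have hmk := coord_mk (F := F) (n := n) (f := fun q => if q = 0 then 0 else 1) (by simp)
  have hmem : (fun i : Fin n => if i.succ = 0 then (0 : F) else 1) ∈ W := by
    obtain ⟨A, hA, hWA⟩ := hW
    rw [hWA, Submodule.mem_sInf]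
    intro K hK
    obtain ⟨ε, S, hS, hε, h0, rfl⟩ := hA hK
    have hε1 : ∀ p, ε p = 1 := fun p => (hε p).elim id fun h => absurd h.1 hB
    intro a ha b hb
    have ha0 : a ≠ 0 := fun h => h0 hB (h ▸ ha)
    have hb0 : b ≠ 0 := fun h => h0 hB (h ▸ hb)
    rw [hmk, hmk]
    simp [ha0, hb0, hε1]
  have := rel_zero_iff.1 h _ hmem
  rw [hmk] at this
  simp [hp] at this

theorem inf_eqHyperplane_self (h2 : (2 : F) ≠ 0) (V : Submodule F (Fin n → F))
    (p : Fin (n + 1)) : V ⊓ eqHyperplane (-1) p p = V ⊓ eqHyperplane 1 p 0 := by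
  ext v
  simp only [Submodule.mem_inf, mem_eqHyperplane, coord_zero, mul_zero]
  refine and_congr_right fun _ => ⟨fun h => ?_, fun h => by rw [h, mul_zero]⟩
  have : 2 * coord p v = 0 := by linear_combination h
  exact (mul_eq_zero.1 this).resolve_left h2

theorem exists_merge_of_leaders (h2 : B → (2 : F) ≠ 0) (hp : IsLeader B V p)
    (hq : IsLeader B V q) (hpN : p = 0 ∨ Nontriv B V p) (hqN : q = 0 ∨ Nontriv B V q) {s : F}
    (hs : IsSign B s) (hV : ¬ V ≤ eqHyperplane s p q) :
    ∃ b, IsMerge B V (V ⊓ eqHyperplane s p q) b := by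
  rcases lt_trichotomy p q with h | rfl | h
  · exact ⟨q, p, s, h, hqN.resolve_left ((Fin.zero_le _).trans_lt h).ne', hpN, hq, hp, hs,
      by rw [eqHyperplane_comm hs.mul_self]⟩
  -- A nontrivial relation of p with itself is xₚ = -xₚ; it merges the block of p into the zero
  -- block.
  · have hp0 : p ≠ 0 := by
      rintro rfl
      exact hV fun v _ => mem_eqHyperplane.2 (by simp)
    rcases hs with rfl | ⟨hB, rfl⟩
    · exact absurd (fun v _ => mem_eqHyperplane.2 (one_mul _).symm) hV
    · exact ⟨p, 0, 1, Fin.pos_of_ne_zero hp0, hpN.resolve_left hp0, Or.inl rfl, hp,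
        isLeader_zero, isSign_one, inf_eqHyperplane_self (h2 hB) V p⟩
  · exact ⟨p, q, s, h, hpN.resolve_left ((Fin.zero_le _).trans_lt h).ne', hqN, hp, hq, hs, rfl⟩

theorem inf_eqHyperplane_congr {s d e : F} (hd : IsSign B d)
    (hp : ∀ v ∈ V, coord p v = d * coord i v) (hq : ∀ v ∈ V, coord q v = e * coord j v) :
    V ⊓ eqHyperplane s p q = V ⊓ eqHyperplane (d * s * e) i j := by
  ext v
  simp only [Submodule.mem_inf, mem_eqHyperplane]
  refine and_congr_right fun hv => ?_
  rw [hp v hv, hq v hv]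
  have h1 := hd.mul_self
  constructor
  · intro h
    linear_combination d * h - coord i v * h1
  · intro h
    rw [h]
    linear_combination (s * e * coord j v) * h1

theorem exists_merge_or_adjoin (h2 : B → (2 : F) ≠ 0) (hp : Nontriv B V p) {s : F}
    (hs : IsSign B s) (hV : ¬ V ≤ eqHyperplane s p q) :
    (∃ b, IsMerge B V (V ⊓ eqHyperplane s p q) b) ∨
      ∃ a, IsAdjoin B V (V ⊓ eqHyperplane s p q) a := by
  by_cases hq : q = 0 ∨ Nontriv B V q
  · left
    have hlead : ∀ p, (p = 0 ∨ Nontriv B V p) → ∃ m, IsLeader B V m ∧ (m = 0 ∨ Nontriv B V m) ∧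
        CoordRel B V p m := by
      intro p hp
      obtain ⟨m, hm, hmp⟩ := exists_leader (B := B) V p
      refine ⟨m, hm, or_iff_not_imp_left.2 fun hm0 => ?_, hmp.symm⟩
      by_cases hmp' : m = p
      · subst hmp'
        exact hp.resolve_left hm0
      · exact hmp.nontriv_left hm0 hmp'
    obtain ⟨m, hm, hmN, d, hd, hpm⟩ := hlead p (Or.inr hp)
    obtain ⟨m', hm', hmN', e, he, hqm⟩ := hlead q hq
    have heq := inf_eqHyperplane_congr (s := s) hd hpm hqm
    rw [heq]
    refine exists_merge_of_leaders h2 hm hm' hmN hmN' ((hd.mul hs).mul he) fun h => hV ?_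
    rw [← inf_eq_left, heq]
    exact inf_eq_left.2 h
  · right
    rw [not_or] at hq
    exact ⟨q, p, s, hp, hq.2, hq.1, hs, by rw [eqHyperplane_comm hs.mul_self]⟩

/-- Some defining member K of `W` does not contain `V`. If its index set meets a nontrivial block,
or contains 0 while `V` has a zero block, one equation of K that fails on `V` gives a merge or an
adjunction. Otherwise K as a whole is a new block. -/
theorem exists_step (hk : 2 ≤ k) (h2 : B → (2 : F) ≠ 0) (hV : IsFlat (kEqual F n B k) V)
    (hW : IsFlat (kEqual F n B k) W) (hWV : W < V) :
    ∃ U, W ≤ U ∧ U < V ∧ IsFlat (kEqual F n B k) U ∧ ((∃ b, IsMerge B V U b) ∨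
      (∃ a, IsAdjoin B V U a) ∨ ∃ a, IsNewBlock B k V U a) := by
  have hyper : ∀ (i j : Fin (n + 1)) (s : F), Nontriv B V i → IsSign B s → (¬ B → j ≠ 0) →
      W ≤ eqHyperplane s i j → ¬ V ≤ eqHyperplane s i j →
      ∃ U, W ≤ U ∧ U < V ∧ IsFlat (kEqual F n B k) U ∧ ((∃ b, IsMerge B V U b) ∨
        (∃ a, IsAdjoin B V U a) ∨ ∃ a, IsNewBlock B k V U a) := by
    intro i j s hi hs hj hWs hVs
    refine ⟨V ⊓ eqHyperplane s i j, le_inf hWV.le hWs, inf_lt_left.2 hVs,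
      hV.inf_eqHyperplane hk h2 hi hs hj, ?_⟩
    rcases exists_merge_or_adjoin h2 hi hs hVs with h | h
    · exact Or.inl h
    · exact Or.inr (Or.inl h)
  have hW' := hW
  obtain ⟨A, hA, hWA⟩ := hW'
  obtain ⟨K, hK, hVK⟩ : ∃ K ∈ A, ¬ V ≤ K := by
    by_contra hcon
    push Not at hcon
    exact hWV.not_ge (hWA ▸ le_sInf hcon)
  have hWK : W ≤ K := hWA ▸ sInf_le hK
  obtain ⟨ε, S, hS, hε, h0, rfl⟩ := hA hK
  by_cases hN : ∃ i ∈ S, Nontriv B V i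
  · obtain ⟨i, hiS, hi⟩ := hN
    obtain ⟨j, hjS, hj⟩ : ∃ j ∈ S, ¬ V ≤ eqHyperplane (ε i * ε j) i j := by
      by_contra hcon
      push Not at hcon
      refine hVK fun v hv => ?_
      have : ∀ j ∈ S, ε j * coord j v = ε i * coord i v := fun j hj => by
        rw [mem_eqHyperplane.1 (hcon j hj hv), ← mul_assoc, ← mul_assoc, (hε i).mul_self, one_mul]
      intro a ha b hb
      rw [this a ha, this b hb]
    refine hyper i j _ hi ((hε i).mul (hε j)) (fun hB h => h0 hB (h ▸ hjS)) (fun v hv => ?_) hj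
    rw [mem_eqHyperplane, mul_assoc, ← mem_eqSubspace.1 (hWK hv) i hiS j hjS, ← mul_assoc,
      (hε i).mul_self, one_mul]
  · push Not at hN
    by_cases hZ : 0 ∈ S ∧ ∃ i, i ≠ 0 ∧ CoordRel B V i 0
    · obtain ⟨h0S, i, hi0, hi⟩ := hZ
      have hB : B := by
        by_contra hB
        exact h0 hB h0S
      have hiV := rel_zero_iff.1 hi
      obtain ⟨j, hjS, hj⟩ : ∃ j ∈ S, ¬ V ≤ eqHyperplane 1 i j := by
        by_contra hcon
        push Not at hcon
        refine hVK fun v hv => ?_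
        have : ∀ j ∈ S, coord j v = 0 := fun j hj => by
          rw [← hiV v hv, mem_eqHyperplane.1 (hcon j hj hv), one_mul]
        intro a ha b hb
        rw [this a ha, this b hb, mul_zero, mul_zero]
      refine hyper i j 1 (hi.nontriv_left hi0 hi0) isSign_one (fun h => absurd hB h)
        (fun v hv => ?_) hj
      have h3 := mem_eqSubspace.1 (hWK hv) j hjS 0 h0S
      rw [coord_zero, mul_zero] at h3
      rw [mem_eqHyperplane, one_mul, hiV v (hWV.le hv),
        (mul_eq_zero.1 h3).resolve_left (hε j).ne_zero]
    · refine ⟨V ⊓ eqSubspace ε S, le_inf hWV.le hWK, inf_lt_left.2 hVK,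
        hV.inf (isFlat_of_mem (hA hK)), Or.inr (Or.inr ?_)⟩
      have hne : S.Nonempty := Finset.card_pos.1 (by omega)
      refine ⟨S.max' hne, ε, S, hS, hε, h0, hN, fun h p hp hr => hZ ⟨h, p, hp, hr⟩,
        S.max'_mem hne, fun p hp => S.le_max' p hp, rfl⟩

end Steps

/-! ## The labels -/

section Labels

variable {F : Type*} [Field F] {n : ℕ} (B : Prop) {V W U z : Submodule F (Fin n → F)}
  {p q r a b c i j : Fin (n + 1)} {k : ℕ}

open Classical in
/-- The coordinates that are free on `V`, but not on `W`. -/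
noncomputable def newIndices (V W : Submodule F (Fin n → F)) : Finset (Fin (n + 1)) :=
  Finset.univ.filter fun p => Nontriv B W p ∧ ¬ Nontriv B V p

open Classical in
/-- The leaders of blocks of `V` that are not leaders on `W`. -/
noncomputable def lostLeaders (V W : Submodule F (Fin n → F)) : Finset (Fin (n + 1)) :=
  Finset.univ.filter fun p => IsLeader B V p ∧ ¬ IsLeader B W p

open Classical in
/-- The label of the step from `V` to `W`: the largest coordinate that ceases to be free, or, if
there is none, the largest leader that gets lost, in this case with a shift to make these labels
smaller than the others. -/
noncomputable def stepLabel (V W : Submodule F (Fin n → F)) : ℤ :=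
  if (newIndices B V W).Nonempty then (((newIndices B V W).sup fun p => (p : ℕ) : ℕ) : ℤ)
  else (((lostLeaders B V W).sup fun p => (p : ℕ) : ℕ) : ℤ) - (n + 1)

variable {B}

theorem mem_newIndices : p ∈ newIndices B V W ↔ Nontriv B W p ∧ ¬ Nontriv B V p := by
  simp [newIndices]

theorem mem_lostLeaders : p ∈ lostLeaders B V W ↔ IsLeader B V p ∧ ¬ IsLeader B W p := by
  simp [lostLeaders]

theorem merge_label_neg (b : Fin (n + 1)) : (b : ℤ) - (n + 1) < 0 := by
  have := b.2
  omega

theorem stepLabel_le_of_new (h : ∀ p, Nontriv B W p → ¬ Nontriv B V p → p ≤ a) :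
    stepLabel B V W ≤ (a : ℕ) := by
  unfold stepLabel
  split_ifs with hne
  · rw [Nat.cast_le, Finset.sup_le_iff]
    exact fun p hp => h p (mem_newIndices.1 hp).1 (mem_newIndices.1 hp).2
  · have : ((lostLeaders B V W).sup fun p => (p : ℕ)) ≤ n :=
      Finset.sup_le fun p _ => by have := p.2; omega
    have : 0 ≤ ((a : ℕ) : ℤ) := by positivity
    omega

theorem stepLabel_le_of_lost (h : ∀ p, Nontriv B W p → Nontriv B V p)
    (h' : ∀ p, IsLeader B V p → ¬ IsLeader B W p → p ≤ b) :
    stepLabel B V W ≤ ((b : ℕ) : ℤ) - (n + 1) := by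
  have hne : ¬ (newIndices B V W).Nonempty := by
    rintro ⟨p, hp⟩
    exact (mem_newIndices.1 hp).2 (h p (mem_newIndices.1 hp).1)
  rw [stepLabel, if_neg hne, sub_le_sub_iff_right, Nat.cast_le, Finset.sup_le_iff]
  exact fun p hp => h' p (mem_lostLeaders.1 hp).1 (mem_lostLeaders.1 hp).2

theorem le_stepLabel_of_new (h : Nontriv B W a) (h' : ¬ Nontriv B V a) :
    ((a : ℕ) : ℤ) ≤ stepLabel B V W := by
  have ha := mem_newIndices.2 ⟨h, h'⟩
  rw [stepLabel, if_pos ⟨a, ha⟩, Nat.cast_le]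
  exact Finset.le_sup (f := fun p : Fin (n + 1) => (p : ℕ)) ha

theorem le_stepLabel_of_lost (h : IsLeader B V b) (h' : ¬ IsLeader B W b) :
    ((b : ℕ) : ℤ) - (n + 1) ≤ stepLabel B V W := by
  unfold stepLabel
  split_ifs with hne
  · have := merge_label_neg b
    have h3 : 0 ≤ (((newIndices B V W).sup fun p => (p : ℕ) : ℕ) : ℤ) := by positivity
    omega
  · rw [sub_le_sub_iff_right, Nat.cast_le]
    exact Finset.le_sup (f := fun p : Fin (n + 1) => (p : ℕ)) (mem_lostLeaders.2 ⟨h, h'⟩)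

/-- Labels are defined for all pairs, so a bound for any flat on the way is also one for a cover
below it, and the auxiliary steps need not be covers. Both index sets grow as `W` shrinks, and a
first new index only raises the label from negative to nonnegative. -/
theorem stepLabel_mono (hWU : W ≤ U) : stepLabel B V U ≤ stepLabel B V W := by
  have hsub : newIndices B V U ⊆ newIndices B V W := fun p hp =>
    mem_newIndices.2 ⟨(mem_newIndices.1 hp).1.mono hWU, (mem_newIndices.1 hp).2⟩
  have hsub' : lostLeaders B V U ⊆ lostLeaders B V W := fun p hp =>
    mem_lostLeaders.2 ⟨(mem_lostLeaders.1 hp).1, fun h => (mem_lostLeaders.1 hp).2 (h.mono hWU)⟩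
  by_cases hU : (newIndices B V U).Nonempty
  · rw [stepLabel, stepLabel, if_pos hU, if_pos (hU.mono hsub), Nat.cast_le]
    exact Finset.sup_mono hsub
  · by_cases hW : (newIndices B V W).Nonempty
    · rw [stepLabel, stepLabel, if_neg hU, if_pos hW]
      have : ((lostLeaders B V U).sup fun p => (p : ℕ)) ≤ n :=
        Finset.sup_le fun p _ => by have := p.2; omega
      omega
    · rw [stepLabel, stepLabel, if_neg hU, if_neg hW, sub_le_sub_iff_right, Nat.cast_le]
      exact Finset.sup_mono hsub'

/-- A coordinate stays free when only other coordinates are affected. -/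
theorem IsFlat.not_nontriv_of_single (hV : IsFlat (kEqual F n B k) V) (hp : ¬ Nontriv B V p)
    (hU : ∀ v ∈ V, (∀ q, coord q v = if q = p then (1 : F) else 0) → v ∈ U) :
    ¬ Nontriv B U p := by
  rintro ⟨hp0, q, hqp, c, hc, h⟩
  obtain ⟨v, hv, hvq⟩ := hV.exists_single hp0 hp
  have := h v (hU v hv hvq)
  rw [hvq, hvq, if_neg hqp, if_pos rfl, mul_one] at this
  exact hc.ne_zero this.symm

theorem IsFlat.nontriv_inf_eqHyperplane (hV : IsFlat (kEqual F n B k) V) {s : F}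
    (h : Nontriv B (V ⊓ eqHyperplane s i j) p) : Nontriv B V p ∨ p = i ∨ p = j := by
  by_contra hcon
  push Not at hcon
  refine hV.not_nontriv_of_single hcon.1 (fun v hv hvq => Submodule.mem_inf.2 ⟨hv, ?_⟩) h
  rw [mem_eqHyperplane, hvq, hvq, if_neg hcon.2.1.symm, if_neg hcon.2.2.symm,
    mul_zero]

theorem IsFlat.nontriv_inf_eqSubspace (hV : IsFlat (kEqual F n B k) V)
    {ε : Fin (n + 1) → F} {S : Finset (Fin (n + 1))}
    (h : Nontriv B (V ⊓ eqSubspace ε S) p) : Nontriv B V p ∨ p ∈ S := by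
  by_contra hcon
  push Not at hcon
  refine hV.not_nontriv_of_single hcon.1 (fun v hv hvq => Submodule.mem_inf.2 ⟨hv, ?_⟩) h
  intro a ha b hb
  have hap : a ≠ p := fun h => hcon.2 (h ▸ ha)
  have hbp : b ≠ p := fun h => hcon.2 (h ▸ hb)
  simp [hvq, hap, hbp]

/-- A leader above b is tied neither to i nor to j, so a vector carried by its block satisfies the
new equation and shows that it stays a leader. Here i and j need not be leaders themselves. -/
theorem IsFlat.stepLabel_inf_eqHyperplane_le (hV : IsFlat (kEqual F n B k) V) (s : F)
    (hi : i = 0 ∨ Nontriv B V i) (hj : j = 0 ∨ Nontriv B V j) (hib : i ≤ b) (hjb : j ≤ b) :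
    stepLabel B V (V ⊓ eqHyperplane s i j) ≤ ((b : ℕ) : ℤ) - (n + 1) := by
  refine stepLabel_le_of_lost (fun p hp => ?_) fun p hp hp' => ?_
  · rcases hV.nontriv_inf_eqHyperplane hp with h | rfl | rfl
    · exact h
    · exact hi.resolve_left hp.1
    · exact hj.resolve_left hp.1
  · by_contra hbp
    rw [not_le] at hbp
    have hp0 : ¬ CoordRel B V p 0 := fun h => hp 0 ((Fin.zero_le _).trans_lt hbp) h.symm
    obtain ⟨v, hv, hvp, hvq⟩ := hV.exists_block_vector hp0
    refine hp' fun q hq hr => ?_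
    obtain ⟨c, hc, hr⟩ := hr
    have hv' : v ∈ V ⊓ eqHyperplane s i j := by
      refine ⟨hv, ?_⟩
      rw [SetLike.mem_coe, mem_eqHyperplane, hvq i (hp i (hib.trans_lt hbp)),
        hvq j (hp j (hjb.trans_lt hbp)), mul_zero]
    have := hr v hv'
    rw [hvp, hvq q (hp q hq), mul_one] at this
    exact hc.ne_zero this.symm

theorem IsMerge.stepLabel_eq (hV : IsFlat (kEqual F n B k) V) (h : IsMerge B V z b) :
    stepLabel B V z = ((b : ℕ) : ℤ) - (n + 1) := by
  obtain ⟨c, s, hcb, hb, hc, hbl, -, hs, rfl⟩ := h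
  exact le_antisymm (hV.stepLabel_inf_eqHyperplane_le s (Or.inr hb) hc le_rfl hcb.le)
    (le_stepLabel_of_lost hbl fun h => h c hcb (rel_inf_eqHyperplane hs).symm)

theorem IsAdjoin.nontriv (h : IsAdjoin B V z a) : Nontriv B z a := by
  obtain ⟨i, s, hi, ha, ha0, hs, rfl⟩ := h
  exact ⟨ha0, i, fun h => ha (h ▸ hi), (rel_inf_eqHyperplane hs).symm⟩

theorem IsAdjoin.nontriv_imp (hV : IsFlat (kEqual F n B k) V) (h : IsAdjoin B V z a)
    (hp : Nontriv B z p) : Nontriv B V p ∨ p = a := by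
  obtain ⟨i, s, hi, ha, ha0, hs, rfl⟩ := h
  rcases hV.nontriv_inf_eqHyperplane hp with h | h | rfl
  · exact Or.inl h
  · exact Or.inr h
  · exact Or.inl hi

theorem IsAdjoin.stepLabel_eq (hV : IsFlat (kEqual F n B k) V) (h : IsAdjoin B V z a) :
    stepLabel B V z = (a : ℕ) := by
  refine le_antisymm (stepLabel_le_of_new fun p hp hp' => ?_)
    (le_stepLabel_of_new h.nontriv ?_)
  · exact ((h.nontriv_imp hV hp).resolve_left hp').le
  · obtain ⟨i, s, hi, ha, -⟩ := h
    exact ha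

theorem nontriv_inf_eqSubspace_of_mem {ε : Fin (n + 1) → F} (hε : ∀ p, IsSign B (ε p))
    {S : Finset (Fin (n + 1))} (hS : 2 ≤ S.card) (hp : p ∈ S) (hp0 : p ≠ 0) :
    Nontriv B (V ⊓ eqSubspace ε S) p := by
  obtain ⟨q, hq, hqp⟩ := Finset.exists_mem_ne (by omega : 1 < S.card) p
  exact ⟨hp0, q, hqp, rel_inf_eqSubspace hε hq hp⟩

theorem IsNewBlock.ne_zero (hk : 2 ≤ k) (h : IsNewBlock B k V z a) : a ≠ 0 := by
  obtain ⟨ε, S, hS, -, -, -, -, ha, hmax, -⟩ := h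
  rintro rfl
  obtain ⟨q, hq, hq0⟩ := Finset.exists_mem_ne (by omega : 1 < S.card) 0
  exact hq0 (Fin.le_zero_iff.1 (hmax q hq))

theorem IsNewBlock.stepLabel_eq (hk : 2 ≤ k) (hV : IsFlat (kEqual F n B k) V)
    (h : IsNewBlock B k V z a) : stepLabel B V z = (a : ℕ) := by
  have ha0 := h.ne_zero hk
  obtain ⟨ε, S, hS, hε, h0, hN, hZ, ha, hmax, rfl⟩ := h
  refine le_antisymm (stepLabel_le_of_new fun p hp hp' => ?_) (le_stepLabel_of_new ?_ (hN a ha))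
  · exact hmax p ((hV.nontriv_inf_eqSubspace hp).resolve_left hp')
  · exact nontriv_inf_eqSubspace_of_mem hε (by omega) ha ha0

end Labels

/-! ## Steps with small labels -/

section Tools

variable {F : Type*} [Field F] {n : ℕ} {B : Prop} {V W U z : Submodule F (Fin n → F)}
  {p q r a b c i j : Fin (n + 1)} {k : ℕ}

theorem mem_eqSubspace_iff {ε : Fin (n + 1) → F} (hε : ∀ p, IsSign B (ε p))
    {S : Finset (Fin (n + 1))} (ha : a ∈ S) {v : Fin n → F} :
    v ∈ eqSubspace ε S ↔ ∀ p ∈ S, coord p v = ε p * ε a * coord a v := by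
  constructor
  · intro h p hp
    rw [mul_assoc, ← h p hp a ha, ← mul_assoc, (hε p).mul_self, one_mul]
  · intro h p hp q hq
    rw [h p hp, h q hq, ← mul_assoc, ← mul_assoc, ← mul_assoc, ← mul_assoc, (hε p).mul_self,
      (hε q).mul_self]

theorem mem_eqSubspace_of_zero_mem {ε : Fin (n + 1) → F} (hε : ∀ p, IsSign B (ε p))
    {S : Finset (Fin (n + 1))} (h0 : 0 ∈ S) {v : Fin n → F} :
    v ∈ eqSubspace ε S ↔ ∀ p ∈ S, coord p v = 0 := by
  rw [mem_eqSubspace_iff hε h0]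
  simp

theorem rel_zero_of_conflict (h2 : (2 : F) ≠ 0) {s : F} (hs : IsSign B s)
    (h : ∀ v ∈ W, coord p v = s * coord q v) (h' : ∀ v ∈ W, coord p v = -s * coord q v) :
    CoordRel B W q 0 := by
  rw [rel_zero_iff]
  intro v hv
  have h3 : (2 * s) * coord q v = 0 := by linear_combination h' v hv - h v hv
  exact (mul_eq_zero.1 h3).resolve_left (mul_ne_zero h2 hs.ne_zero)

/-- This lemma and the next two turn relations valid on `W` into a step towards `W` with a
controlled label. They contradict a lower bound for labels at the start of an interval, and supply
the small label after a cover that is not the least. -/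
theorem exists_merge_le (hk : 2 ≤ k) (h2 : B → (2 : F) ≠ 0) (hV : IsFlat (kEqual F n B k) V)
    (hW : IsFlat (kEqual F n B k) W) (hWV : W ≤ V) (hi : Nontriv B V i)
    (hj : j = 0 ∨ Nontriv B V j) (hWr : CoordRel B W i j) (hVr : ¬ CoordRel B V i j)
    (hib : i ≤ b) (hjb : j ≤ b) : ∃ U, IsFlat (kEqual F n B k) U ∧ W ≤ U ∧ U < V ∧
      stepLabel B V U ≤ ((b : ℕ) : ℤ) - (n + 1) := by
  have hjB : ¬ B → j ≠ 0 := fun hB hj => hB (hW.zero_block (hj ▸ hWr) hi.1)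
  obtain ⟨s, hs, hWr⟩ := hWr
  refine ⟨V ⊓ eqHyperplane s i j, hV.inf_eqHyperplane hk h2 hi hs hjB,
    le_inf hWV fun v hv => mem_eqHyperplane.2 (hWr v hv), inf_lt_left.2 fun h => hVr ⟨s, hs,
      fun v hv => mem_eqHyperplane.1 (h hv)⟩, ?_⟩
  exact hV.stepLabel_inf_eqHyperplane_le s (Or.inr hi) hj hib hjb

theorem exists_adjoin_le (hk : 2 ≤ k) (h2 : B → (2 : F) ≠ 0) (hV : IsFlat (kEqual F n B k) V)
    (hWV : W ≤ V) (hi : Nontriv B V i) (ha : ¬ Nontriv B V a) (ha0 : a ≠ 0)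
    (hWr : CoordRel B W i a) : ∃ U, IsFlat (kEqual F n B k) U ∧ W ≤ U ∧ U < V ∧
      stepLabel B V U ≤ (a : ℕ) := by
  have hia : i ≠ a := fun h => ha (h ▸ hi)
  obtain ⟨s, hs, hWr⟩ := hWr
  refine ⟨V ⊓ eqHyperplane s i a, hV.inf_eqHyperplane hk h2 hi hs fun _ => ha0,
    le_inf hWV fun v hv => mem_eqHyperplane.2 (hWr v hv), inf_lt_left.2 fun h => ha
      ⟨ha0, i, hia, s, hs, fun v hv => mem_eqHyperplane.1 (h hv)⟩, ?_⟩
  have : IsAdjoin B V (V ⊓ eqHyperplane s i a) a :=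
    ⟨i, s, hi, ha, ha0, hs, by rw [eqHyperplane_comm hs.mul_self]⟩
  exact (this.stepLabel_eq hV).le

theorem exists_newBlock_le (hk : 2 ≤ k) (hV : IsFlat (kEqual F n B k) V) (hWV : W ≤ V)
    (T : Finset (Fin (n + 1))) (hT : k ≤ T.card) (hTN : ∀ p ∈ T, ¬ Nontriv B V p)
    (h0 : 0 ∈ T → B) (hWr : ∀ p ∈ T, CoordRel B W p q) (hTa : ∀ p ∈ T, p ≤ a) :
    ∃ U, IsFlat (kEqual F n B k) U ∧ W ≤ U ∧ U < V ∧ stepLabel B V U ≤ (a : ℕ) := by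
  classical
  -- Any k elements of `T` will do; the signs are those with which their coordinates agree with that
  -- of q on `W`.
  obtain ⟨S, hST, hS⟩ := Finset.exists_subset_card_eq hT
  have hex : ∀ p, ∃ c : F, IsSign B c ∧ (p ∈ T → ∀ v ∈ W, coord p v = c * coord q v) := by
    intro p
    by_cases hp : p ∈ T
    · obtain ⟨c, hc, h⟩ := hWr p hp
      exact ⟨c, hc, fun _ => h⟩
    · exact ⟨1, isSign_one, fun h => absurd h hp⟩
  choose ε hε hεW using hex
  refine ⟨V ⊓ eqSubspace ε S, hV.inf (isFlat_of_mem ⟨ε, S, hS, hε, fun hB h => hB (h0 (hST h)),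
    rfl⟩), le_inf hWV fun v hv a ha b hb => ?_, inf_lt_left.2 fun h => ?_,
    stepLabel_le_of_new fun p hp hp' => ?_⟩
  · rw [hεW a (hST ha) v hv, hεW b (hST hb) v hv, ← mul_assoc, ← mul_assoc, (hε a).mul_self,
      (hε b).mul_self]
  · obtain ⟨p, hp, hp0⟩ := Finset.exists_mem_ne (by omega : 1 < S.card) 0
    have := nontriv_inf_eqSubspace_of_mem (V := V) hε (by omega) hp hp0
    rw [inf_eq_left.2 h] at this
    exact hTN p (hST hp) this
  · exact hTa p (hST ((hV.nontriv_inf_eqSubspace hp).resolve_left hp'))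

/-- A lower bound for the labels of the steps from `V` in the direction of `W`. -/
def LabelBound (B : Prop) (k : ℕ) (V W : Submodule F (Fin n → F)) (l : ℤ) : Prop :=
  ∀ U, IsFlat (kEqual F n B k) U → W ≤ U → U < V → l ≤ stepLabel B V U

variable {l : ℤ}

/-- Otherwise merging the two blocks would be a step towards `W` with a label below the bound. -/
theorem LabelBound.rel (hl : LabelBound B k V W l) (hk : 2 ≤ k) (h2 : B → (2 : F) ≠ 0)
    (hV : IsFlat (kEqual F n B k) V) (hW : IsFlat (kEqual F n B k) W) (hWV : W ≤ V)
    (hi : i = 0 ∨ Nontriv B V i) (hj : j = 0 ∨ Nontriv B V j) (hib : i ≤ b) (hjb : j ≤ b)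
    (hb : ((b : ℕ) : ℤ) - (n + 1) < l) (hr : CoordRel B W i j) : CoordRel B V i j := by
  have key : ∀ {i j : Fin (n + 1)}, Nontriv B V i → (j = 0 ∨ Nontriv B V j) → i ≤ b → j ≤ b →
      CoordRel B W i j → CoordRel B V i j := by
    intro i j hi hj hib hjb hr
    by_contra hcon
    obtain ⟨U, h1, h3, h4, h5⟩ := exists_merge_le hk h2 hV hW hWV hi hj hr hcon hib hjb
    exact absurd (h5.trans_lt hb) (hl U h1 h3 h4).not_gt
  rcases hi with rfl | hi
  · rcases hj with rfl | hj
    · exact CoordRel.refl V 0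
    · exact (key hj (Or.inl rfl) hjb hib hr.symm).symm
  · exact key hi hj hib hjb hr

theorem LabelBound.rel_of_nonneg (hl : LabelBound B k V W l) (hk : 2 ≤ k) (h2 : B → (2 : F) ≠ 0)
    (hV : IsFlat (kEqual F n B k) V) (hW : IsFlat (kEqual F n B k) W) (hWV : W ≤ V) (h0 : 0 ≤ l)
    (hi : i = 0 ∨ Nontriv B V i) (hj : j = 0 ∨ Nontriv B V j)
    (hr : CoordRel B W i j) : CoordRel B V i j :=
  hl.rel hk h2 hV hW hWV hi hj (Fin.le_last i) (Fin.le_last j)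
    ((merge_label_neg _).trans_le h0) hr

theorem LabelBound.le_of_adjoin (hl : LabelBound B k V W l) (hk : 2 ≤ k) (h2 : B → (2 : F) ≠ 0)
    (hV : IsFlat (kEqual F n B k) V) (hWV : W ≤ V) (hi : Nontriv B V i) (ha : ¬ Nontriv B V a)
    (ha0 : a ≠ 0) (hr : CoordRel B W i a) : l ≤ (a : ℕ) := by
  obtain ⟨U, h1, h3, h4, h5⟩ := exists_adjoin_le hk h2 hV hWV hi ha ha0 hr
  exact (hl U h1 h3 h4).trans h5

/-- Otherwise k elements of `T` would form a new block with all elements, hence its label, below a.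
-/
theorem LabelBound.not_block (hl : LabelBound B k V W (a : ℕ)) (hk : 2 ≤ k)
    (hV : IsFlat (kEqual F n B k) V) (hWV : W ≤ V) (T : Finset (Fin (n + 1))) (hT : k ≤ T.card)
    (hTN : ∀ p ∈ T, ¬ Nontriv B V p) (h0 : 0 ∈ T → B) (hr : ∀ p ∈ T, CoordRel B W p q)
    (hTa : ∀ p ∈ T, p < a) : False := by
  have hTne : T.Nonempty := Finset.card_pos.1 (by omega)
  obtain ⟨U, h1, h3, h4, h5⟩ := exists_newBlock_le (a := T.max' hTne) hk hV hWV T hT hTN h0 hr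
    fun p hp => T.le_max' p hp
  have h6 := (hl U h1 h3 h4).trans h5
  have h7 := hTa _ (T.max'_mem hTne)
  rw [Nat.cast_le] at h6
  exact absurd h7 (not_lt_of_ge h6)

theorem not_nontriv_zero : ¬ Nontriv B V 0 := fun h => h.1 rfl

/-- When all of a block of free coordinates is zero on `W`, a smaller zero block is possible. -/
theorem LabelBound.not_zero_block (hl : LabelBound B k V W (a : ℕ)) (hk : 2 ≤ k)
    (hV : IsFlat (kEqual F n B k) V) (hWV : W ≤ V) (hB : B) (S : Finset (Fin (n + 1)))
    (hS : S.card = k) (hSN : ∀ p ∈ S, ¬ Nontriv B V p) (h0 : 0 ∉ S) (haS : a ∈ S)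
    (hmax : ∀ p ∈ S, p ≤ a) (hr : ∀ p ∈ S, CoordRel B W p 0) : False := by
  classical
  -- Exchanging `a` for 0 keeps k elements and lowers the largest one.
  refine hl.not_block (q := 0) hk hV hWV (insert 0 (S.erase a)) ?_ ?_ (fun _ => hB) ?_ ?_
  · rw [Finset.card_insert_of_notMem fun h => h0 (Finset.mem_of_mem_erase h),
      Finset.card_erase_of_mem haS]
    omega
  · intro p hp
    rcases Finset.mem_insert.1 hp with rfl | hp
    · exact not_nontriv_zero
    · exact hSN p (Finset.mem_of_mem_erase hp)
  · intro p hp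
    rcases Finset.mem_insert.1 hp with rfl | hp
    · exact CoordRel.refl W 0
    · exact hr p (Finset.mem_of_mem_erase hp)
  · intro p hp
    rcases Finset.mem_insert.1 hp with rfl | hp
    · exact Fin.pos_of_ne_zero fun h => h0 (h ▸ haS)
    · obtain ⟨h1, h3⟩ := Finset.mem_erase.1 hp
      exact lt_of_le_of_ne (hmax p h3) h1

end Tools

/-! ## The step with the least label is unique -/

section Unique

variable {F : Type*} [Field F] {n : ℕ} {B : Prop} {V W U z z' : Submodule F (Fin n → F)}
  {p q r a b c i j : Fin (n + 1)} {k : ℕ}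

/-- Two partners c and c' of b would be identified on `W`, and opposite signs would make c vanish
there. Each would allow a merge of leaders below b. -/
theorem IsMerge.unique (hk : 2 ≤ k) (h2 : B → (2 : F) ≠ 0) (hV : IsFlat (kEqual F n B k) V)
    (hW : IsFlat (kEqual F n B k) W) (hWV : W ≤ V)
    (hl : LabelBound B k V W (((b : ℕ) : ℤ) - (n + 1)))
    (hz : IsMerge B V z b) (hz' : IsMerge B V z' b) (hWz : W ≤ z) (hWz' : W ≤ z') : z = z' := by
  obtain ⟨c, s, hcb, hb, hc, hbl, hcl, hs, rfl⟩ := hz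
  obtain ⟨c', s', hcb', -, hc', -, hcl', hs', rfl⟩ := hz'
  have hr := (rel_inf_eqHyperplane (V := V) (p := b) (q := c) hs).mono hWz
  have hr' := (rel_inf_eqHyperplane (V := V) (p := b) (q := c') hs').mono hWz'
  have key : ∀ {i j : Fin (n + 1)}, i < b → j < b → (i = 0 ∨ Nontriv B V i) →
      (j = 0 ∨ Nontriv B V j) → CoordRel B W i j → CoordRel B V i j := by
    intro i j hib hjb hi hj hr
    refine hl.rel (b := max i j) hk h2 hV hW hWV hi hj (le_max_left _ _) (le_max_right _ _) ?_ hr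
    have : max i j < b := max_lt hib hjb
    rw [Fin.lt_def] at this
    omega
  have hcc : c = c' :=
    (key hcb hcb' hc hc' (hr.symm.trans hr')).eq_of_leader hcl hcl'
  subst hcc
  rcases hs.eq_or hs' with rfl | ⟨hB, rfl⟩
  · rfl
  · by_cases hc0 : c = 0
    · subst hc0
      ext v
      simp [mem_eqHyperplane]
    · have h0 : CoordRel B W c 0 := rel_zero_of_conflict (h2 hB) hs'
        (fun v hv => mem_eqHyperplane.1 (hWz' hv).2) (fun v hv => mem_eqHyperplane.1 (hWz hv).2)
      exact absurd (key hcb ((Fin.zero_le _).trans_lt hcb) hc (Or.inl rfl) h0).symm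
        (hcl 0 (Fin.pos_of_ne_zero hc0))

/-- The bound is nonnegative, so no merge towards `W` is possible. Hence both receiving blocks
agree, and opposite signs can occur only for the zero block, where signs do not matter. -/
theorem IsAdjoin.unique (hk : 2 ≤ k) (h2 : B → (2 : F) ≠ 0) (hV : IsFlat (kEqual F n B k) V)
    (hW : IsFlat (kEqual F n B k) W) (hWV : W ≤ V) (hl : LabelBound B k V W (a : ℕ))
    (hz : IsAdjoin B V z a) (hz' : IsAdjoin B V z' a) (hWz : W ≤ z) (hWz' : W ≤ z') : z = z' := by
  obtain ⟨i, s, hi, ha, ha0, hs, rfl⟩ := hz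
  obtain ⟨i', s', hi', -, -, hs', rfl⟩ := hz'
  have hr := (rel_inf_eqHyperplane (V := V) (p := a) (q := i) hs).mono hWz
  have hr' := (rel_inf_eqHyperplane (V := V) (p := a) (q := i') hs').mono hWz'
  have key : ∀ {i j : Fin (n + 1)}, (i = 0 ∨ Nontriv B V i) →
      (j = 0 ∨ Nontriv B V j) → CoordRel B W i j → CoordRel B V i j := fun hi hj hr =>
    hl.rel_of_nonneg hk h2 hV hW hWV (by positivity) hi hj hr
  obtain ⟨d, hd, hii⟩ := key (Or.inr hi') (Or.inr hi) (hr'.symm.trans hr)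
  have heq : V ⊓ eqHyperplane s' a i' = V ⊓ eqHyperplane (1 * s' * d) a i :=
    inf_eqHyperplane_congr (B := B) isSign_one (fun v _ => (one_mul _).symm) hii
  rw [one_mul] at heq
  rw [heq] at hWz' ⊢
  rcases hs.eq_or (hs'.mul hd) with h | ⟨hB, h⟩
  · rw [h]
  · have h0 : CoordRel B W i 0 := rel_zero_of_conflict (h2 hB) (hs'.mul hd)
        (fun v hv => mem_eqHyperplane.1 (hWz' hv).2)
        (fun v hv => by rw [← h]; exact mem_eqHyperplane.1 (hWz hv).2)
    have hi0 := rel_zero_iff.1 (key (Or.inr hi) (Or.inl rfl) h0)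
    ext v
    simp only [Submodule.mem_inf, mem_eqHyperplane]
    exact and_congr_right fun hv => by rw [hi0 v hv, mul_zero, mul_zero]

/-- Another element q of the new block is tied to i on `W`. If q ≠ 0, then q < a could be adjoined
instead; q = 0 would put i into the zero block of `V`, which a new zero block excludes. -/
theorem IsAdjoin.not_newBlock (hk : 2 ≤ k) (h2 : B → (2 : F) ≠ 0)
    (hV : IsFlat (kEqual F n B k) V)
    (hW : IsFlat (kEqual F n B k) W) (hWV : W ≤ V) (hl : LabelBound B k V W (a : ℕ))
    (hz : IsAdjoin B V z a) (hz' : IsNewBlock B k V z' a) (hWz : W ≤ z) (hWz' : W ≤ z') :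
    False := by
  obtain ⟨i, s, hi, ha, ha0, hs, rfl⟩ := hz
  obtain ⟨ε, S, hS, hε, h0, hN, hZ, haS, hmax, rfl⟩ := hz'
  have hr := (rel_inf_eqHyperplane (V := V) (p := a) (q := i) hs).mono hWz
  obtain ⟨q, hq, hqa⟩ := Finset.exists_mem_ne (by omega : 1 < S.card) a
  have hr' := (rel_inf_eqSubspace (V := V) hε haS hq).mono hWz'
  by_cases hq0 : q = 0
  · subst hq0
    exact hZ hq i hi.1 (hl.rel_of_nonneg hk h2 hV hW hWV (by positivity) (Or.inr hi) (Or.inl rfl)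
      (hr.symm.trans hr'))
  · have h3 := hl.le_of_adjoin hk h2 hV hWV hi (hN q hq) hq0 (hr.symm.trans hr')
    have h4 := lt_of_le_of_ne (hmax q hq) hqa
    rw [Nat.cast_le] at h3
    exact absurd h4 (not_lt_of_ge h3)

/-- The union of two different index sets, without `a`, still has k elements and gives a smaller
label. For equal sets without 0, a sign conflict makes all of them vanish on `W`, and 0 can take the
place of `a`. -/
theorem IsNewBlock.unique (hk : 2 ≤ k) (h2 : B → (2 : F) ≠ 0) (hV : IsFlat (kEqual F n B k) V)
    (hWV : W ≤ V) (hl : LabelBound B k V W (a : ℕ))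
    (hz : IsNewBlock B k V z a) (hz' : IsNewBlock B k V z' a) (hWz : W ≤ z) (hWz' : W ≤ z') :
    z = z' := by
  classical
  obtain ⟨ε, S, hS, hε, h0, hN, hZ, haS, hmax, rfl⟩ := hz
  obtain ⟨ε', S', hS', hε', h0', hN', hZ', haS', hmax', rfl⟩ := hz'
  have hr : ∀ p ∈ S, CoordRel B W p a := fun p hp =>
    (rel_inf_eqSubspace (V := V) hε hp haS).mono hWz
  have hr' : ∀ p ∈ S', CoordRel B W p a := fun p hp =>
    (rel_inf_eqSubspace (V := V) hε' hp haS').mono hWz'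
  have hSS : S = S' := by
    by_contra hne
    refine hl.not_block (q := a) hk hV hWV ((S ∪ S').erase a) ?_ ?_ ?_ ?_ ?_
    · rw [Finset.card_erase_of_mem (Finset.mem_union_left _ haS)]
      have : S.card < (S ∪ S').card := by
        refine Finset.card_lt_card (Finset.ssubset_iff_subset_ne.2
          ⟨Finset.subset_union_left, fun h => hne ?_⟩)
        refine (Finset.eq_of_subset_of_card_le (h ▸ Finset.subset_union_right) ?_).symm
        omega
      omega
    · intro p hp
      rcases Finset.mem_union.1 (Finset.mem_of_mem_erase hp) with hp | hp
      · exact hN p hp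
      · exact hN' p hp
    · intro hp
      by_contra hB
      rcases Finset.mem_union.1 (Finset.mem_of_mem_erase hp) with hp | hp
      · exact h0 hB hp
      · exact h0' hB hp
    · intro p hp
      rcases Finset.mem_union.1 (Finset.mem_of_mem_erase hp) with hp | hp
      · exact hr p hp
      · exact hr' p hp
    · intro p hp
      obtain ⟨hpa, hp⟩ := Finset.mem_erase.1 hp
      refine lt_of_le_of_ne ?_ hpa
      rcases Finset.mem_union.1 hp with hp | hp
      · exact hmax p hp
      · exact hmax' p hp
  subst hSS
  by_cases h0S : 0 ∈ S
  · ext v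
    rw [Submodule.mem_inf, Submodule.mem_inf, mem_eqSubspace_of_zero_mem hε h0S,
      mem_eqSubspace_of_zero_mem hε' h0S]
  by_cases hsign : ∀ p ∈ S, ε p * ε a = ε' p * ε' a
  · ext v
    rw [Submodule.mem_inf, Submodule.mem_inf, mem_eqSubspace_iff hε haS,
      mem_eqSubspace_iff hε' haS]
    refine and_congr_right fun _ => forall₂_congr fun p hp => by rw [hsign p hp]
  · push Not at hsign
    obtain ⟨p, hp, hne⟩ := hsign
    obtain ⟨hB, h⟩ := (((hε p).mul (hε a)).eq_or ((hε' p).mul (hε' a))).resolve_left hne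
    have ha0 : CoordRel B W a 0 := rel_zero_of_conflict (h2 hB) ((hε' p).mul (hε' a))
      (fun v hv => (mem_eqSubspace_iff hε' haS).1 (hWz' hv).2 p hp)
      (fun v hv => by rw [← h]; exact (mem_eqSubspace_iff hε haS).1 (hWz hv).2 p hp)
    exact (hl.not_zero_block hk hV hWV hB S hS hN h0S haS hmax
      fun p hp => (hr p hp).trans ha0).elim

end Unique

/-! ## Labels after the step with the least label -/

section Ascent

variable {F : Type*} [Field F] {n : ℕ} {B : Prop} {V W U w z z' : Submodule F (Fin n → F)}
  {p q r a b c i j : Fin (n + 1)} {k : ℕ}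

theorem IsMerge.le (h : IsMerge B V z b) : z ≤ V := by
  obtain ⟨c, s, -, -, -, -, -, -, rfl⟩ := h
  exact inf_le_left

theorem IsAdjoin.le (h : IsAdjoin B V z a) : z ≤ V := by
  obtain ⟨c, s, -, -, -, -, rfl⟩ := h
  exact inf_le_left

theorem IsNewBlock.le (h : IsNewBlock B k V z a) : z ≤ V := by
  obtain ⟨ε, S, -, -, -, -, -, -, -, rfl⟩ := h
  exact inf_le_left

theorem IsMerge.nontriv_imp (hV : IsFlat (kEqual F n B k) V) (h : IsMerge B V z b)
    (hp : Nontriv B z p) : Nontriv B V p := by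
  obtain ⟨c, s, hcb, hb, hc, -, -, -, rfl⟩ := h
  rcases hV.nontriv_inf_eqHyperplane hp with h | rfl | rfl
  · exact h
  · exact hb
  · exact hc.resolve_left hp.1

/-- A later merge of some b' < b was possible at `V`, against the bound; b itself is no longer a
leader. All other labels are nonnegative. -/
theorem IsMerge.ascent (hk : 2 ≤ k) (h2 : B → (2 : F) ≠ 0) (hV : IsFlat (kEqual F n B k) V)
    (hzf : IsFlat (kEqual F n B k) z) (hW : IsFlat (kEqual F n B k) W) (hWw : W ≤ w)
    (hl : LabelBound B k V W (((b : ℕ) : ℤ) - (n + 1))) (hz : IsMerge B V z b)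
    (hw : (∃ b, IsMerge B z w b) ∨ (∃ a, IsAdjoin B z w a) ∨ ∃ a, IsNewBlock B k z w a) :
    ((b : ℕ) : ℤ) - (n + 1) < stepLabel B z w := by
  rcases hw with ⟨b', hw⟩ | ⟨a, hw⟩ | ⟨a, hw⟩
  · rw [hw.stepLabel_eq hzf, sub_lt_sub_iff_right, Nat.cast_lt]
    by_contra hlt
    have hWV : W ≤ V := hWw.trans (hw.le.trans hz.le)
    have himp := fun p => hz.nontriv_imp (p := p) hV
    have hzV := hz.le
    obtain ⟨c, s, hcb, hb, hc, hbl, hcl, hs, hzeq⟩ := hz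
    obtain ⟨c', s', hcb', hb', hc', hbl', hcl', hs', hweq⟩ := hw
    have hr : CoordRel B W b' c' := by
      rw [hweq] at hWw
      exact (rel_inf_eqHyperplane hs').mono hWw
    have hne : b' ≠ b := by
      rintro rfl
      rw [hzeq] at hbl'
      exact hbl' c hcb (rel_inf_eqHyperplane hs).symm
    have hlt' : b' < b := lt_of_le_of_ne (not_lt.1 hlt) hne
    refine hcb'.ne' ((hl.rel (b := b') hk h2 hV hW hWV (Or.inr (himp _ hb')) (hc'.imp id (himp _))
      le_rfl hcb'.le ?_ hr).eq_of_leader (hbl'.mono hzV) (hcl'.mono hzV))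
    rw [Fin.lt_def] at hlt'
    omega
  · rw [hw.stepLabel_eq hzf]
    exact (merge_label_neg b).trans_le (by positivity)
  · rw [hw.stepLabel_eq hk hzf]
    exact (merge_label_neg b).trans_le (by positivity)

/-- Every nontrivial block of `z` contains a coordinate that is nontrivial on `V` (`hrep`), so a
later step with a label of at most a has a counterpart at `V` below the bound. -/
theorem IsAdjoin.ascent (hk : 2 ≤ k) (h2 : B → (2 : F) ≠ 0) (hV : IsFlat (kEqual F n B k) V)
    (hzf : IsFlat (kEqual F n B k) z) (hW : IsFlat (kEqual F n B k) W) (hWw : W ≤ w)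
    (hl : LabelBound B k V W (a : ℕ)) (hz : IsAdjoin B V z a)
    (hw : (∃ b, IsMerge B z w b) ∨ (∃ a, IsAdjoin B z w a) ∨ ∃ a, IsNewBlock B k z w a) :
    ((a : ℕ) : ℤ) < stepLabel B z w := by
  have hzV := hz.le
  have haz := hz.nontriv
  have hrep : ∀ p, Nontriv B z p → ∃ q, Nontriv B V q ∧ CoordRel B z p q := by
    intro p hp
    rcases hz.nontriv_imp hV hp with h | rfl
    · exact ⟨p, h, CoordRel.refl z p⟩
    · obtain ⟨i, s, hi, -, -, hs, rfl⟩ := hz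
      exact ⟨i, hi, rel_inf_eqHyperplane hs⟩
  have hrep' : ∀ p, (p = 0 ∨ Nontriv B z p) →
      ∃ q, (q = 0 ∨ Nontriv B V q) ∧ CoordRel B z p q := by
    rintro p (rfl | hp)
    · exact ⟨0, Or.inl rfl, CoordRel.refl z 0⟩
    · obtain ⟨q, hq, hr⟩ := hrep p hp
      exact ⟨q, Or.inr hq, hr⟩
  rcases hw with ⟨b', hw⟩ | ⟨a', hw⟩ | ⟨a', hw⟩
  · exfalso
    have hWz : W ≤ z := hWw.trans hw.le
    obtain ⟨c', s', hcb', hb', hc', hbl', hcl', hs', rfl⟩ := hw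
    have hr : CoordRel B W b' c' := (rel_inf_eqHyperplane hs').mono hWw
    obtain ⟨p, hp, hbp⟩ := hrep' b' (Or.inr hb')
    obtain ⟨q, hq, hcq⟩ := hrep' c' hc'
    have h3 : CoordRel B V p q := hl.rel_of_nonneg hk h2 hV hW (hWz.trans hzV) (by positivity) hp hq
      ((hbp.mono hWz).symm.trans (hr.trans (hcq.mono hWz)))
    exact hcb'.ne' ((hbp.trans ((h3.mono hzV).trans hcq.symm)).eq_of_leader hbl' hcl')
  · rw [hw.stepLabel_eq hzf, Nat.cast_lt]
    by_contra hlt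
    have hWz : W ≤ z := hWw.trans hw.le
    obtain ⟨i', s', hi', ha', ha0', hs', rfl⟩ := hw
    obtain ⟨q, hq, hiq⟩ := hrep i' hi'
    have hr : CoordRel B W a' i' := (rel_inf_eqHyperplane hs').mono hWw
    have h3 := hl.le_of_adjoin hk h2 hV (hWz.trans hzV) hq (fun h => ha' (h.mono hzV)) ha0'
      ((hiq.mono hWz).symm.trans hr.symm)
    rw [Nat.cast_le] at h3
    exact ha' ((Fin.ext (le_antisymm (not_lt.1 hlt) h3) : a' = a) ▸ haz)
  · rw [hw.stepLabel_eq hk hzf, Nat.cast_lt]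
    by_contra hlt
    have hWz : W ≤ z := hWw.trans hw.le
    obtain ⟨ε, S, hS, hε, h0, hN, hZ, haS, hmax, rfl⟩ := hw
    refine hl.not_block (q := a') hk hV (hWz.trans hzV) S hS.ge
      (fun p hp h => hN p hp (h.mono hzV)) (fun h => by_contra fun hB => h0 hB h)
      (fun p hp => (rel_inf_eqSubspace hε hp haS).mono hWw) fun p hp => ?_
    refine lt_of_le_of_ne ((hmax p hp).trans (not_lt.1 hlt)) ?_
    rintro rfl
    exact hN p hp haz

/-- Only steps that involve the block S itself are new. Merging it with a nontrivial block would
have allowed the adjunction of another element of S, smaller than a, at `V`; merging it with the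
zero block, a zero block with 0 in place of a. Adjoining a' < a to S corresponds to S with a
replaced by a'. -/
theorem IsNewBlock.ascent (hk : 2 ≤ k) (h2 : B → (2 : F) ≠ 0) (hV : IsFlat (kEqual F n B k) V)
    (hzf : IsFlat (kEqual F n B k) z) (hW : IsFlat (kEqual F n B k) W) (hWw : W ≤ w)
    (hl : LabelBound B k V W (a : ℕ)) (hz : IsNewBlock B k V z a)
    (hw : (∃ b, IsMerge B z w b) ∨ (∃ a, IsAdjoin B z w a) ∨ ∃ a, IsNewBlock B k z w a) :
    ((a : ℕ) : ℤ) < stepLabel B z w := by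
  classical
  have hzV := hz.le
  have ha0 := hz.ne_zero hk
  obtain ⟨ε, S, hS, hε, h0, hN, hZ, haS, hmax, hzeq⟩ := hz
  have hNz : ∀ p ∈ S, p ≠ 0 → Nontriv B z p := fun p hp hp0 =>
    hzeq ▸ nontriv_inf_eqSubspace_of_mem hε (by omega) hp hp0
  have hNz' : ∀ p, Nontriv B z p → Nontriv B V p ∨ p ∈ S := fun p hp =>
    hV.nontriv_inf_eqSubspace (hzeq ▸ hp)
  have hrS : ∀ p ∈ S, ∀ q ∈ S, CoordRel B z p q := fun p hp q hq =>
    hzeq ▸ rel_inf_eqSubspace hε hp hq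
  -- the new block cannot be merged
  have hmerge : ∀ p q, W ≤ z → IsLeader B z p → IsLeader B z q → p ≠ q → p ∈ S → p ≠ 0 →
      (q = 0 ∨ Nontriv B z q) → CoordRel B W p q → False := by
    intro p q hWz hp hq hpq hpS hp0 hqN hr
    have h0S : 0 ∉ S := fun h => hp0 ((hrS p hpS 0 h).eq_of_leader hp isLeader_zero)
    have hqS : q ∉ S := fun h => hpq ((hrS p hpS q h).eq_of_leader hp hq)
    by_cases hq0 : q = 0
    · subst hq0
      exact hl.not_zero_block hk hV (hWz.trans hzV) (hW.zero_block hr hp0) S hS hN h0S haS hmax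
        fun t ht => ((hrS t ht p hpS).mono hWz).trans hr
    · have hqV := (hNz' q (hqN.resolve_left hq0)).resolve_right hqS
      obtain ⟨t, ht, hta⟩ := Finset.exists_mem_ne (by omega : 1 < S.card) a
      have h3 := hl.le_of_adjoin hk h2 hV (hWz.trans hzV) hqV (hN t ht) (fun h => h0S (h ▸ ht))
        (hr.symm.trans ((hrS p hpS t ht).mono hWz))
      rw [Nat.cast_le] at h3
      exact hta (le_antisymm (hmax t ht) h3)
  rcases hw with ⟨b', hw⟩ | ⟨a', hw⟩ | ⟨a', hw⟩
  · exfalso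
    have hWz : W ≤ z := hWw.trans hw.le
    obtain ⟨c', s', hcb', hb', hc', hbl', hcl', hs', rfl⟩ := hw
    have hr : CoordRel B W b' c' := (rel_inf_eqHyperplane hs').mono hWw
    by_cases hbV : Nontriv B V b'
    · by_cases hcV : c' = 0 ∨ Nontriv B V c'
      · have h3 : CoordRel B V b' c' := hl.rel_of_nonneg hk h2 hV hW (hWz.trans hzV)
          (by positivity) (Or.inr hbV) hcV hr
        exact hcb'.ne' ((h3.mono hzV).eq_of_leader hbl' hcl')
      · rw [not_or] at hcV
        exact hmerge c' b' hWz hcl' hbl' hcb'.ne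
          ((hNz' c' (hc'.resolve_left hcV.1)).resolve_left hcV.2) hcV.1 (Or.inr hb') hr.symm
    · exact hmerge b' c' hWz hbl' hcl' hcb'.ne' ((hNz' b' hb').resolve_left hbV) hb'.1 hc' hr
  · rw [hw.stepLabel_eq hzf, Nat.cast_lt]
    by_contra hlt
    have hWz : W ≤ z := hWw.trans hw.le
    obtain ⟨i', s', hi', ha', ha0', hs', rfl⟩ := hw
    have hr : CoordRel B W a' i' := (rel_inf_eqHyperplane hs').mono hWw
    have hlt' : a' < a := lt_of_le_of_ne (not_lt.1 hlt) fun h => ha' (h ▸ hNz a haS ha0)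
    rcases hNz' i' hi' with hiV | hiS
    · have h3 := hl.le_of_adjoin hk h2 hV (hWz.trans hzV) hiV (fun h => ha' (h.mono hzV)) ha0'
        hr.symm
      rw [Nat.cast_le] at h3
      exact absurd hlt' (not_lt_of_ge h3)
    · have haS' : a' ∉ S := fun h => ha' (hNz a' h ha0')
      refine hl.not_block (q := i') hk hV (hWz.trans hzV) (insert a' (S.erase a)) ?_ ?_ ?_ ?_ ?_
      · rw [Finset.card_insert_of_notMem fun h => haS' (Finset.mem_of_mem_erase h),
          Finset.card_erase_of_mem haS]
        omega
      · intro p hp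
        rcases Finset.mem_insert.1 hp with rfl | hp
        · exact fun h => ha' (h.mono hzV)
        · exact hN p (Finset.mem_of_mem_erase hp)
      · intro hp
        rcases Finset.mem_insert.1 hp with h | hp
        · exact absurd h.symm ha0'
        · exact by_contra fun hB => h0 hB (Finset.mem_of_mem_erase hp)
      · intro p hp
        rcases Finset.mem_insert.1 hp with rfl | hp
        · exact hr
        · exact (hrS p (Finset.mem_of_mem_erase hp) i' hiS).mono hWz
      · intro p hp
        rcases Finset.mem_insert.1 hp with rfl | hp
        · exact hlt'
        · obtain ⟨h1, h3⟩ := Finset.mem_erase.1 hp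
          exact lt_of_le_of_ne (hmax p h3) h1
  · rw [hw.stepLabel_eq hk hzf, Nat.cast_lt]
    by_contra hlt
    have hWz : W ≤ z := hWw.trans hw.le
    obtain ⟨ε', S', hS', hε', h0', hN', hZ', haS', hmax', rfl⟩ := hw
    refine hl.not_block (q := a') hk hV (hWz.trans hzV) S' hS'.ge
      (fun p hp h => hN' p hp (h.mono hzV)) (fun h => by_contra fun hB => h0' hB h)
      (fun p hp => (rel_inf_eqSubspace hε' hp haS').mono hWw) fun p hp => ?_
    refine lt_of_le_of_ne ((hmax' p hp).trans (not_lt.1 hlt)) ?_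
    rintro rfl
    exact hN' p hp (hNz p haS ha0)

end Ascent

/-! ## Labels after other steps -/

section Descent

variable {F : Type*} [Field F] {n : ℕ} {B : Prop} {V W U w z z' : Submodule F (Fin n → F)}
  {p q r a a' b c i j : Fin (n + 1)} {k : ℕ}

/-- The coordinates in question are outside `T`, so a vector of `V` can be moved into `z` without
changing them. -/
theorem rel_of_adjustable (T : Finset (Fin (n + 1))) (hTN : ∀ p ∈ T, ¬ Nontriv B V p)
    (hT : ∀ v ∈ V, ∃ v' ∈ z, ∀ q ∉ T, coord q v' = coord q v)
    (hp : p = 0 ∨ Nontriv B V p) (hq : q = 0 ∨ Nontriv B V q) (hr : CoordRel B z p q) :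
    CoordRel B V p q := by
  obtain ⟨s, hs, hr⟩ := hr
  refine ⟨s, hs, fun v hv => ?_⟩
  obtain ⟨v', hv', hvv⟩ := hT v hv
  have key : ∀ {p}, (p = 0 ∨ Nontriv B V p) → coord p v' = coord p v := by
    rintro p (rfl | hp)
    · rw [coord_zero, coord_zero]
    · exact hvv p fun h => hTN p h hp
  rw [← key hp, ← key hq]
  exact hr v' hv'

theorem IsAdjoin.rel_of_rel (hV : IsFlat (kEqual F n B k) V) (hz : IsAdjoin B V z a)
    (hp : p = 0 ∨ Nontriv B V p) (hq : q = 0 ∨ Nontriv B V q) (hr : CoordRel B z p q) :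
    CoordRel B V p q := by
  obtain ⟨i, s, hi, ha, ha0, hs, rfl⟩ := hz
  refine rel_of_adjustable {a} (by simpa using ha) (fun v hv => ?_) hp hq hr
  obtain ⟨v', hv', hvq⟩ := hV.exists_adjust {a} (by simpa using ha)
    (fun q => if q = 0 then 0 else s * coord i v) (by simp) hv
  refine ⟨v', ⟨hv', ?_⟩, fun q hq => by rw [hvq, if_neg hq]⟩
  have hia : i ≠ a := fun h => ha (h ▸ hi)
  rw [SetLike.mem_coe, mem_eqHyperplane, hvq, hvq]
  simp [hia, ha0]

theorem IsNewBlock.rel_of_rel (hV : IsFlat (kEqual F n B k) V) (hz : IsNewBlock B k V z a)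
    (hp : p = 0 ∨ Nontriv B V p) (hq : q = 0 ∨ Nontriv B V q) (hr : CoordRel B z p q) :
    CoordRel B V p q := by
  obtain ⟨ε, S, hS, hε, h0, hN, hZ, haS, hmax, rfl⟩ := hz
  refine rel_of_adjustable S hN (fun v hv => ?_) hp hq hr
  obtain ⟨v', hv', hvq⟩ := hV.exists_adjust S hN 0 rfl hv
  refine ⟨v', ⟨hv', fun a ha b hb => ?_⟩, fun q hq => by rw [hvq, if_neg hq]⟩
  rw [hvq, hvq, if_pos ha, if_pos hb]
  simp

/-- Distinct leaders are not identified by a merge of a larger leader. -/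
theorem IsMerge.not_rel (hV : IsFlat (kEqual F n B k) V) (hz : IsMerge B V z a)
    (hba : b < a) (hcb : c < b) (hb : IsLeader B V b) (hc : IsLeader B V c) :
    ¬ CoordRel B z b c := by
  obtain ⟨q, s, hqa, ha, hq, hal, hql, hs, rfl⟩ := hz
  rintro ⟨d, hd, hr⟩
  have hnz : ∀ {p q}, IsLeader B V p → q < p → ¬ CoordRel B V p 0 := fun hp hqp h =>
    hp 0 ((Fin.zero_le _).trans_lt hqp) h.symm
  have hnr : ∀ {p q}, IsLeader B V p → IsLeader B V q → q ≠ p → ¬ CoordRel B V q p :=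
    fun hp hq hne h => hne (h.eq_of_leader hq hp)
  obtain ⟨β, hβ, hβb, hβq⟩ := hV.exists_block_vector (hnz hb hcb)
  -- The vector β on the block of b separates b from c. Only if a is merged into this very block
  -- does β leave the merged flat; then a multiple of a vector on the block of a corrects it.
  by_cases hqb : q = b
  · subst hqb
    obtain ⟨α, hα, hαa, hαq⟩ := hV.exists_block_vector (hnz hal hba)
    have h1 : coord q α = 0 := hαq q (hnr hal hql hba.ne)
    have h3 : coord c α = 0 := hαq c (hnr hal hc (hcb.trans hba).ne)
    have h4 : coord a β = 0 := hβq a (hnr hql hal hba.ne')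
    have h5 : coord c β = 0 := hβq c (hnr hql hc hcb.ne)
    have := hr (β + s • α) ⟨V.add_mem hβ (V.smul_mem _ hα), by
      simp [mem_eqHyperplane, h1, h4, hαa, hβb]⟩
    simp [h1, h3, h5, hβb] at this
  · have h5 : coord c β = 0 := hβq c (hnr hb hc hcb.ne)
    have := hr β ⟨hβ, by
      rw [SetLike.mem_coe, mem_eqHyperplane, hβq a (hnr hb hal hba.ne'), hβq q (hnr hb hql hqb),
        mul_zero]⟩
    simp [h5, hβb] at this

/-- The other step, having a larger label, does not identify b with c, so the merge of b and c is
still to be done, with a smaller label. -/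
theorem IsMerge.descent (hk : 2 ≤ k) (h2 : B → (2 : F) ≠ 0) (hV : IsFlat (kEqual F n B k) V)
    (hzf : IsFlat (kEqual F n B k) z') (hW : IsFlat (kEqual F n B k) W)
    (hz : IsMerge B V z b) (hWz : W ≤ z) (hWz' : W ≤ z')
    (hz' : (∃ b, IsMerge B V z' b) ∨ (∃ a, IsAdjoin B V z' a) ∨ ∃ a, IsNewBlock B k V z' a)
    (hlt : ((b : ℕ) : ℤ) - (n + 1) < stepLabel B V z') :
    ∃ U, IsFlat (kEqual F n B k) U ∧ W ≤ U ∧ U < z' ∧ stepLabel B z' U ≤ stepLabel B V z' := by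
  obtain ⟨c, s, hcb, hb, hc, hbl, hcl, hs, rfl⟩ := hz
  have hr : CoordRel B W b c := (rel_inf_eqHyperplane hs).mono hWz
  have hnV : ¬ CoordRel B V b c := fun h => hcb.ne' (h.eq_of_leader hbl hcl)
  have key : z' ≤ V ∧ ¬ CoordRel B z' b c := by
    rcases hz' with ⟨b', hz'⟩ | ⟨a, hz'⟩ | ⟨a, hz'⟩
    · rw [hz'.stepLabel_eq hV, sub_lt_sub_iff_right, Nat.cast_lt] at hlt
      exact ⟨hz'.le, hz'.not_rel hV hlt hcb hbl hcl⟩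
    · exact ⟨hz'.le, fun h => hnV (hz'.rel_of_rel hV (Or.inr hb) hc h)⟩
    · exact ⟨hz'.le, fun h => hnV (hz'.rel_of_rel hV (Or.inr hb) hc h)⟩
  obtain ⟨U, h1, h3, h4, h5⟩ := exists_merge_le hk h2 hzf hW hWz' (hb.mono key.1)
    (hc.imp id fun h => h.mono key.1) hr key.2 le_rfl hcb.le
  exact ⟨U, h1, h3, h4, h5.trans hlt.le⟩

/-- If a is still free, adjoin it now. Otherwise a new block has taken it up, and this block must
still be merged with that of i, with a negative label; if it were tied to i already, the cover z'
would be an adjunction of a, whose label is too small. -/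
theorem IsAdjoin.descent (hk : 2 ≤ k) (h2 : B → (2 : F) ≠ 0) (hV : IsFlat (kEqual F n B k) V)
    (hzf : IsFlat (kEqual F n B k) z') (hW : IsFlat (kEqual F n B k) W)
    (hz : IsAdjoin B V z a) (hWz : W ≤ z) (hWz' : W ≤ z')
    (hcov : ∀ U, IsFlat (kEqual F n B k) U → z' ≤ U → U < V → U = z')
    (hz' : (∃ b, IsMerge B V z' b) ∨ (∃ a, IsAdjoin B V z' a) ∨ ∃ a, IsNewBlock B k V z' a)
    (hlt : ((a : ℕ) : ℤ) < stepLabel B V z') :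
    ∃ U, IsFlat (kEqual F n B k) U ∧ W ≤ U ∧ U < z' ∧ stepLabel B z' U ≤ stepLabel B V z' := by
  obtain ⟨i, s, hi, ha, ha0, hs, rfl⟩ := hz
  have hr : CoordRel B W a i := (rel_inf_eqHyperplane hs).mono hWz
  have hfree : z' ≤ V → ¬ Nontriv B z' a → ∃ U, IsFlat (kEqual F n B k) U ∧ W ≤ U ∧ U < z' ∧
      stepLabel B z' U ≤ stepLabel B V z' := by
    intro hzV haz
    obtain ⟨U, h1, h3, h4, h5⟩ := exists_adjoin_le hk h2 hzf hWz' (hi.mono hzV) haz ha0 hr.symm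
    exact ⟨U, h1, h3, h4, h5.trans hlt.le⟩
  rcases hz' with ⟨b', hz'⟩ | ⟨a', hz'⟩ | ⟨a', hz'⟩
  · rw [hz'.stepLabel_eq hV] at hlt
    have h3 := merge_label_neg b'
    have h4 : 0 ≤ ((a : ℕ) : ℤ) := by positivity
    omega
  · refine hfree hz'.le fun h => ?_
    rw [hz'.stepLabel_eq hV, Nat.cast_lt] at hlt
    rcases hz'.nontriv_imp hV h with h | rfl
    · exact ha h
    · exact lt_irrefl _ hlt
  · have hzV := hz'.le
    by_cases haz : Nontriv B z' a
    · by_cases hai : CoordRel B z' a i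
      · exfalso
        obtain ⟨d, hd, hai⟩ := hai
        have hadj : IsAdjoin B V (V ⊓ eqHyperplane d a i) a := ⟨i, d, hi, ha, ha0, hd, rfl⟩
        have hflat : IsFlat (kEqual F n B k) (V ⊓ eqHyperplane d a i) := by
          rw [eqHyperplane_comm hd.mul_self]
          exact hV.inf_eqHyperplane hk h2 hi hd fun _ => ha0
        have heq := hcov _ hflat (le_inf hzV fun v hv => mem_eqHyperplane.2 (hai v hv))
          (inf_lt_left.2 fun h => ha ((show CoordRel B V a i from
            ⟨d, hd, fun v hv => mem_eqHyperplane.1 (h hv)⟩).nontriv_left ha0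
              fun h => ha (h ▸ hi)))
        rw [heq] at hadj
        rw [hadj.stepLabel_eq hV] at hlt
        exact lt_irrefl _ hlt
      · obtain ⟨U, h1, h3, h4, h5⟩ := exists_merge_le (b := Fin.last n) hk h2 hzf hW hWz' haz
          (Or.inr (hi.mono hzV)) hr hai (Fin.le_last _) (Fin.le_last _)
        refine ⟨U, h1, h3, h4, h5.trans ((merge_label_neg _).le.trans ?_)⟩
        rw [hz'.stepLabel_eq hk hV]
        positivity
    · exact hfree hzV haz

/-- If S is still free, form it now. Otherwise the other step created a block S' that meets S in t.
A nonzero element of S outside S' can be adjoined to it. If there is none, then either 0 ∈ S and t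
has to be merged into the zero block (were it there already, the cover z' would equal z), or S = S',
against the labels. -/
theorem IsNewBlock.descent (hk : 2 ≤ k) (h2 : B → (2 : F) ≠ 0) (hV : IsFlat (kEqual F n B k) V)
    (hzf : IsFlat (kEqual F n B k) z') (hW : IsFlat (kEqual F n B k) W)
    (hz : IsNewBlock B k V z a) (hzflat : IsFlat (kEqual F n B k) z) (hzlt : z < V)
    (hWz : W ≤ z) (hWz' : W ≤ z')
    (hcov : ∀ U, IsFlat (kEqual F n B k) U → z' ≤ U → U < V → U = z')
    (hz' : (∃ b, IsMerge B V z' b) ∨ (∃ a, IsAdjoin B V z' a) ∨ ∃ a, IsNewBlock B k V z' a)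
    (hlt : ((a : ℕ) : ℤ) < stepLabel B V z') :
    ∃ U, IsFlat (kEqual F n B k) U ∧ W ≤ U ∧ U < z' ∧ stepLabel B z' U ≤ stepLabel B V z' := by
  have hstep := hz.stepLabel_eq hk hV
  obtain ⟨ε, S, hS, hε, h0, hN, hZ, haS, hmax, hzeq⟩ := hz
  have hr : ∀ p ∈ S, ∀ q ∈ S, CoordRel B W p q := fun p hp q hq =>
    (hzeq ▸ rel_inf_eqSubspace hε hp hq : CoordRel B z p q).mono hWz
  have hfree : (∀ p ∈ S, ¬ Nontriv B z' p) → ∃ U, IsFlat (kEqual F n B k) U ∧ W ≤ U ∧ U < z' ∧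
      stepLabel B z' U ≤ stepLabel B V z' := by
    intro h
    obtain ⟨U, h1, h3, h4, h5⟩ := exists_newBlock_le (q := a) hk hzf hWz' S hS.ge h
      (fun h => by_contra fun hB => h0 hB h) (fun p hp => hr p hp a haS) hmax
    exact ⟨U, h1, h3, h4, h5.trans hlt.le⟩
  rcases hz' with ⟨b', hz'⟩ | ⟨a', hz'⟩ | ⟨a', hz'⟩
  · rw [hz'.stepLabel_eq hV] at hlt
    have h3 := merge_label_neg b'
    have h4 : 0 ≤ ((a : ℕ) : ℤ) := by positivity
    omega
  · refine hfree fun p hp h => ?_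
    rw [hz'.stepLabel_eq hV, Nat.cast_lt] at hlt
    rcases hz'.nontriv_imp hV h with h | rfl
    · exact hN p hp h
    · exact absurd hlt (not_lt_of_ge (hmax p hp))
  · have hzV := hz'.le
    have hlt' := hlt
    rw [hz'.stepLabel_eq hk hV, Nat.cast_lt] at hlt'
    have hpos : 0 ≤ stepLabel B V z' := by
      rw [hz'.stepLabel_eq hk hV]
      positivity
    by_cases hdisj : ∀ p ∈ S, ¬ Nontriv B z' p
    · exact hfree hdisj
    push Not at hdisj
    obtain ⟨t, htS, ht⟩ := hdisj
    obtain ⟨ε', S', hS', hε', h0', hN', hZ', haS', hmax', hzeq'⟩ := hz'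
    have himp : ∀ p, Nontriv B z' p → Nontriv B V p ∨ p ∈ S' := fun p hp =>
      hV.nontriv_inf_eqSubspace (hzeq' ▸ hp)
    have htS' : t ∈ S' := (himp t ht).resolve_left (hN t htS)
    by_cases hs : ∃ u ∈ S, u ≠ 0 ∧ u ∉ S'
    · obtain ⟨u, huS, hu0, huS'⟩ := hs
      obtain ⟨U, h1, h3, h4, h5⟩ := exists_adjoin_le hk h2 hzf hWz' ht
        (fun h => (himp u h).elim (hN u huS) huS') hu0 (hr t htS u huS)
      refine ⟨U, h1, h3, h4, h5.trans (le_trans ?_ hlt.le)⟩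
      rw [Nat.cast_le]
      exact hmax u huS
    · push Not at hs
      by_cases h0S : 0 ∈ S
      · have hB : B := by_contra fun hB => h0 hB h0S
        by_cases ht0 : CoordRel B z' t 0
        · exfalso
          have hle : z' ≤ z := by
            rw [hzeq]
            refine le_inf hzV fun v hv => (mem_eqSubspace_of_zero_mem hε h0S).2 fun p hp => ?_
            by_cases hp0 : p = 0
            · rw [hp0, coord_zero]
            · have h3 : CoordRel B z' p t := by
                rw [hzeq']
                exact rel_inf_eqSubspace hε' (hs p hp hp0) htS'
              exact rel_zero_iff.1 (h3.trans ht0) v hv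
          rw [← hcov z hzflat hle hzlt, hstep] at hlt
          exact lt_irrefl _ hlt
        · obtain ⟨U, h1, h3, h4, h5⟩ := exists_merge_le (b := Fin.last n) hk h2 hzf hW hWz' ht
            (Or.inl rfl) (hr t htS 0 h0S) ht0 (Fin.le_last _) (Fin.le_last _)
          exact ⟨U, h1, h3, h4, h5.trans ((merge_label_neg _).le.trans hpos)⟩
      · exfalso
        have hSS : S = S' := Finset.eq_of_subset_of_card_le
          (fun p hp => hs p hp fun h => h0S (h ▸ hp)) (by omega)
        exact absurd hlt' (not_lt_of_ge (hmax a' (hSS ▸ haS')))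

end Descent

/-! ## The lattice of flats -/

section FlatPoset

variable {C : Type*} [CompleteLattice C]

/-- All intersections of members of an arrangement, ordered by reverse inclusion. -/
abbrev FlatPoset (A : Set C) : Type _ := {x : Cᵒᵈ // IsFlat A (OrderDual.ofDual x)}

theorem IntersectionSemilattice.isFlat {A : Set C} (x : IntersectionSemilattice A) :
    IsFlat A (OrderDual.ofDual x.1) := by
  obtain ⟨S, hS, h, -⟩ := x.2
  exact ⟨S, hS, h⟩

theorem finite_isFlat {A : Set C} (hA : A.Finite) : {x : C | IsFlat A x}.Finite := by
  refine (hA.finite_subsets.image sInf).subset ?_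
  rintro x ⟨S, hS, rfl⟩
  exact ⟨S, hS, rfl⟩

theorem finite_flatPoset {A : Set C} (hA : A.Finite) : Finite (FlatPoset A) :=
  (finite_isFlat hA).to_subtype

theorem finite_intersectionSemilattice {A : Set C} (hA : A.Finite) :
    Finite (IntersectionSemilattice A) := by
  have := finite_flatPoset hA
  refine Finite.of_injective (fun x => (⟨x.1, x.isFlat⟩ : FlatPoset A)) fun x y h => ?_
  exact Subtype.ext (congrArg (fun z : FlatPoset A => z.1) h)

theorem IntersectionSemilattice.ne_bot {A : Set C} {x : IntersectionSemilattice A} (hx : x ≠ ⊥) :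
    OrderDual.ofDual x.1 ≠ ⊥ := by
  obtain ⟨S, hS, h, rfl | h'⟩ := x.2
  · exact absurd (Subtype.ext (by rw [sInf_empty] at h; exact h)) hx
  · exact h'

instance (A : Set C) : OrderTop (FlatPoset A) where
  top := ⟨OrderDual.toDual (sInf A), A, subset_rfl, rfl⟩
  le_top x := by
    obtain ⟨S, hS, h⟩ := x.2
    change sInf A ≤ OrderDual.ofDual x.1
    rw [h]
    exact sInf_le_sInf hS

/-- The poset of all intersections always has a greatest element. If the empty subspace is an
intersection, it plays the role of 1̂; otherwise a further top is added. The degenerate case ⊥ = ⊤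
belongs to the second kind, since the semilattice keeps the whole space. -/
theorem isCLShellable_of_isGreedyLabeling {A : Set C} (hA : A.Finite)
    {lab : FlatPoset A → FlatPoset A → ℤ} (h : IsGreedyLabeling lab) :
    IsCLShellable (WithTop (IntersectionSemilattice A)) := by
  classical
  have := finite_intersectionSemilattice hA
  have hemb : ∀ x y : IntersectionSemilattice A,
      ((⟨x.1, x.isFlat⟩ : FlatPoset A) ≤ ⟨y.1, y.isFlat⟩ ↔ x ≤ y) := fun x y => Iff.rfl
  by_cases hbot : IsFlat A ⊥ ∧ (⊥ : C) ≠ ⊤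
  · let f : WithTop (IntersectionSemilattice A) ↪o FlatPoset A :=
      OrderEmbedding.ofMapLEIff
        (WithTop.recTopCoe ⟨OrderDual.toDual ⊥, hbot.1⟩ fun x => ⟨x.1, x.isFlat⟩) (by
          intro x y
          induction y using WithTop.recTopCoe with
          | top =>
            refine iff_of_true ?_ le_top
            change (⊥ : C) ≤ _
            exact bot_le
          | coe y =>
            induction x using WithTop.recTopCoe with
            | top =>
              refine iff_of_false (fun hle => ?_) (by simp)
              change OrderDual.ofDual y.1 ≤ ⊥ at hle
              have hy := le_bot_iff.1 hle
              obtain ⟨S, hS, h1, rfl | h2⟩ := y.2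
              · rw [sInf_empty, hy] at h1
                exact hbot.2 h1
              · exact h2 hy
            | coe x => exact (hemb x y).trans WithTop.coe_le_coe.symm)
    have hsurj : Function.Surjective f := by
      rintro ⟨y, hy⟩
      by_cases hyb : OrderDual.ofDual y = ⊥
      · exact ⟨⊤, Subtype.ext hyb.symm⟩
      · obtain ⟨S, hS, hyS⟩ := hy
        exact ⟨((⟨y, S, hS, hyS, Or.inr hyb⟩ : IntersectionSemilattice A) :
          WithTop (IntersectionSemilattice A)), rfl⟩
    exact (h.comp_orderIso (RelIso.ofSurjective f hsurj)).isCLShellable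
  · let f : IntersectionSemilattice A ↪o FlatPoset A :=
      OrderEmbedding.ofMapLEIff (fun x => ⟨x.1, x.isFlat⟩) hemb
    have hsurj : Function.Surjective f := by
      rintro ⟨y, hy⟩
      by_cases hyb : OrderDual.ofDual y = ⊥
      · have htop : (⊥ : C) = ⊤ := by
          by_contra hne
          exact hbot ⟨hyb ▸ hy, hne⟩
        refine ⟨⟨y, ∅, Set.empty_subset _, ?_, Or.inl rfl⟩, rfl⟩
        rw [sInf_empty, hyb, htop]
      · obtain ⟨S, hS, hyS⟩ := hy
        exact ⟨⟨y, S, hS, hyS, Or.inr hyb⟩, rfl⟩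
    exact (h.withTop.comp_orderIso
      (OrderIso.withTopCongr (RelIso.ofSurjective f hsurj))).isCLShellable

/-- A projective member may be the empty subspace, of dimension -1; nonemptiness is therefore asked
only of members of nonnegative dimension, which suffices for one of dimension d. -/
theorem reducedBetti_arrangement_eq_zero {dim : C → ℤ} {A : Set C} (hA : A.Finite)
    (hnn : ∀ K : C, K ≠ ⊥ → 0 ≤ dim K) (hmono : ∀ K K' : C, K ≠ ⊥ → K < K' → dim K < dim K')
    (hAdim : ∀ K ∈ A, K ≠ ⊤ ∧ (0 ≤ dim K → K ≠ ⊥)) {d m : ℕ}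
    (hd : IsGreatest (dim '' A) (d : ℤ)) (hher : IsHereditary dim A) (hpure : IsModPure A m)
    (hCL : IsCLShellable (WithTop (IntersectionSemilattice A))) (j : ℕ) (i : ℤ) (hj : j ≤ d)
    (hij : ¬ (i + (j : ℤ) ≡ (d : ℤ) [ZMOD (m : ℤ)])) :
    reducedBetti (Truncation dim A j) i = 0 := by
  have := finite_intersectionSemilattice hA
  refine reducedBetti_truncation_eq_zero (L := IntersectionSemilattice A)
    (dim := fun x : IntersectionSemilattice A => dim (OrderDual.ofDual x.1))
    (fun x hx => hnn _ (IntersectionSemilattice.ne_bot hx)) (fun x y hxy => ?_) hher ?_ ?_ hpure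
    hCL j i hj hij
  · exact hmono _ _ (IntersectionSemilattice.ne_bot fun h => not_lt_bot (h ▸ hxy)) hxy
  · obtain ⟨K, hK, hKd⟩ := hd.1
    obtain ⟨h1, h2⟩ := hAdim K hK
    refine ⟨⟨OrderDual.toDual K, {K}, by simpa using hK, by simp,
      Or.inr (h2 (hKd ▸ by positivity))⟩, fun h => h1 ?_, hKd⟩
    exact congrArg (fun x => OrderDual.ofDual x.1) h
  · intro x hx
    obtain ⟨S, hS, h, -⟩ := x.2
    obtain ⟨K, hK⟩ : S.Nonempty := by
      rw [Set.nonempty_iff_ne_empty]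
      rintro rfl
      exact hx (Subtype.ext (by rw [sInf_empty] at h; exact h))
    refine le_trans ?_ (hd.2 ⟨K, hS hK, rfl⟩)
    have hle : OrderDual.ofDual x.1 ≤ K := h ▸ sInf_le hK
    rcases hle.eq_or_lt with h3 | h3
    · rw [h3]
    · exact (hmono _ _ (IntersectionSemilattice.ne_bot hx) h3).le

end FlatPoset

/-! ### Monotonicity of projective and affine dimension. -/

section Dimension

variable {F : Type*} [Field F] {n : ℕ}

theorem projDim_nonneg {K : Submodule F (Fin n → F)} (hK : K ≠ ⊥) : 0 ≤ projDim K := by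
  have : 0 < Module.finrank F K := by
    rw [Nat.pos_iff_ne_zero, Ne, Submodule.finrank_eq_zero]
    exact hK
  unfold projDim
  omega

theorem projDim_lt {K K' : Submodule F (Fin n → F)} (h : K < K') : projDim K < projDim K' := by
  have := Submodule.finrank_lt_finrank_of_lt h
  unfold projDim
  omega

theorem ne_bot_of_projDim_nonneg {K : Submodule F (Fin n → F)} (h : 0 ≤ projDim K) : K ≠ ⊥ := by
  rintro rfl
  simp [projDim] at h

theorem affDim_lt {K K' : AffineSubspace F (Fin n → F)} (hK : K ≠ ⊥) (h : K < K') :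
    affDim K < affDim K' := by
  have := Submodule.finrank_lt_finrank_of_lt
    (AffineSubspace.direction_lt_of_nonempty h ((AffineSubspace.nonempty_iff_ne_bot K).2 hK))
  unfold affDim
  omega

end Dimension

/-! ## The `k`-equal arrangements are hereditary, pure modulo `k - 2` and CL-shellable -/

section KEqual

variable {F : Type*} [Field F] {n : ℕ} {B : Prop} {k : ℕ}

theorem kEqual_finite (F : Type*) [Field F] (n : ℕ) (B : Prop) (k : ℕ) :
    (kEqual F n B k).Finite := by
  classical
  refine (Set.finite_range fun x : (Fin (n + 1) → Bool) × Finset (Fin (n + 1)) =>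
    eqSubspace (F := F) (fun p => if x.1 p then 1 else -1) x.2).subset ?_
  rintro K ⟨ε, S, -, hε, -, rfl⟩
  refine ⟨(fun p => decide (ε p = 1), S), ?_⟩
  change eqSubspace _ S = eqSubspace ε S
  congr 1
  funext p
  rcases hε p with h | ⟨-, h⟩
  · simp [h]
  · by_cases h1 : ε p = 1
    · simp [h1]
    · rw [h] at h1
      simp [h, h1]

theorem exists_cover_step (hk : 2 ≤ k) (h2 : B → (2 : F) ≠ 0)
    {x z : FlatPoset (kEqual F n B k)} (h : x ⋖ z) :
    (∃ b, IsMerge B (OrderDual.ofDual x.1) (OrderDual.ofDual z.1) b) ∨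
      (∃ a, IsAdjoin B (OrderDual.ofDual x.1) (OrderDual.ofDual z.1) a) ∨
      ∃ a, IsNewBlock B k (OrderDual.ofDual x.1) (OrderDual.ofDual z.1) a := by
  obtain ⟨U, h1, h3, h4, h5⟩ := exists_step hk h2 x.2 z.2 h.lt
  have : (⟨OrderDual.toDual U, h4⟩ : FlatPoset (kEqual F n B k)) = z := by
    by_contra hne
    exact h.2 (c := ⟨OrderDual.toDual U, h4⟩) h3 (lt_of_le_of_ne h1 hne)
  rw [← this]
  exact h5

/-- Choose a cover z of least label; by monotonicity its label bounds those of all flats in the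
interval. The uniqueness lemmas make the minimum strict, the ascent lemmas treat the edges after z,
and the descent lemmas give a flat below any other cover, on the way to which lies the required
cover. -/
theorem isGreedyLabeling_kEqual (hk : 2 ≤ k) (h2 : B → (2 : F) ≠ 0) :
    IsGreedyLabeling fun x y : FlatPoset (kEqual F n B k) =>
      stepLabel B (OrderDual.ofDual x.1) (OrderDual.ofDual y.1) := by
  have := finite_flatPoset (kEqual_finite F n B k)
  intro x y hxy
  obtain ⟨z₀, hz₀, hz₀y⟩ := exists_covBy_le_of_lt hxy
  obtain ⟨z, ⟨hxz, hzy⟩, hmin⟩ := Set.exists_min_image {z | x ⋖ z ∧ z ≤ y}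
    (fun z => stepLabel B (OrderDual.ofDual x.1) (OrderDual.ofDual z.1)) (Set.toFinite _)
    ⟨z₀, hz₀, hz₀y⟩
  have hl : LabelBound B k (OrderDual.ofDual x.1) (OrderDual.ofDual y.1)
      (stepLabel B (OrderDual.ofDual x.1) (OrderDual.ofDual z.1)) := by
    intro U hU hyU hUx
    obtain ⟨w, hw, hwU⟩ := exists_covBy_le_of_lt
      (show x < (⟨OrderDual.toDual U, hU⟩ : FlatPoset (kEqual F n B k)) from hUx)
    exact (hmin w ⟨hw, hwU.trans hyU⟩).trans (stepLabel_mono hwU)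
  have hcov : ∀ {z' : FlatPoset (kEqual F n B k)}, x ⋖ z' → ∀ U, IsFlat (kEqual F n B k) U →
      OrderDual.ofDual z'.1 ≤ U → U < OrderDual.ofDual x.1 → U = OrderDual.ofDual z'.1 := by
    intro z' hz' U hU h1 h3
    by_contra hne
    exact hz'.2 (c := ⟨OrderDual.toDual U, hU⟩) h3 (lt_of_le_of_ne h1 fun h =>
      hne (congrArg (fun t : FlatPoset (kEqual F n B k) => OrderDual.ofDual t.1) h))
  have hWV : OrderDual.ofDual y.1 ≤ OrderDual.ofDual x.1 := hxy.le
  refine ⟨z, hxz, hzy, fun w hzw hwy => ?_, fun z' hxz' hzy' hne => ?_⟩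
  · have hstep := exists_cover_step hk h2 hzw
    change stepLabel B (OrderDual.ofDual x.1) (OrderDual.ofDual z.1) <
      stepLabel B (OrderDual.ofDual z.1) (OrderDual.ofDual w.1)
    rcases exists_cover_step hk h2 hxz with ⟨b, h⟩ | ⟨a, h⟩ | ⟨a, h⟩
    · have hs := h.stepLabel_eq x.2
      rw [hs] at hl ⊢
      exact h.ascent hk h2 x.2 z.2 y.2 hwy hl hstep
    · have hs := h.stepLabel_eq x.2
      rw [hs] at hl ⊢
      exact h.ascent hk h2 x.2 z.2 y.2 hwy hl hstep
    · have hs := h.stepLabel_eq hk x.2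
      rw [hs] at hl ⊢
      exact h.ascent hk h2 x.2 z.2 y.2 hwy hl hstep
  · have hstep' := exists_cover_step hk h2 hxz'
    have hlt : stepLabel B (OrderDual.ofDual x.1) (OrderDual.ofDual z.1) <
        stepLabel B (OrderDual.ofDual x.1) (OrderDual.ofDual z'.1) := by
      refine lt_of_le_of_ne (hmin z' ⟨hxz', hzy'⟩) fun heq => hne (Subtype.ext ?_)
      change OrderDual.ofDual z'.1 = OrderDual.ofDual z.1
      have hnn : ∀ a b : Fin (n + 1), ((a : ℕ) : ℤ) ≠ ((b : ℕ) : ℤ) - (n + 1) := fun a b h => by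
        have h3 := merge_label_neg b
        omega
      rcases exists_cover_step hk h2 hxz with ⟨b, h⟩ | ⟨a, h⟩ | ⟨a, h⟩
      · rw [h.stepLabel_eq x.2] at heq hl
        rcases hstep' with ⟨b', h'⟩ | ⟨a', h'⟩ | ⟨a', h'⟩
        · rw [h'.stepLabel_eq x.2, sub_left_inj, Nat.cast_inj] at heq
          obtain rfl := Fin.ext heq
          exact h'.unique hk h2 x.2 y.2 hWV hl h hzy' hzy
        · rw [h'.stepLabel_eq x.2] at heq
          exact absurd heq.symm (hnn _ _)
        · rw [h'.stepLabel_eq hk x.2] at heq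
          exact absurd heq.symm (hnn _ _)
      · rw [h.stepLabel_eq x.2] at heq hl
        rcases hstep' with ⟨b', h'⟩ | ⟨a', h'⟩ | ⟨a', h'⟩
        · rw [h'.stepLabel_eq x.2] at heq
          exact absurd heq (hnn _ _)
        · rw [h'.stepLabel_eq x.2, Nat.cast_inj] at heq
          obtain rfl := Fin.ext heq
          exact h'.unique hk h2 x.2 y.2 hWV hl h hzy' hzy
        · rw [h'.stepLabel_eq hk x.2, Nat.cast_inj] at heq
          obtain rfl := Fin.ext heq
          exact (h.not_newBlock hk h2 x.2 y.2 hWV hl h' hzy hzy').elim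
      · rw [h.stepLabel_eq hk x.2] at heq hl
        rcases hstep' with ⟨b', h'⟩ | ⟨a', h'⟩ | ⟨a', h'⟩
        · rw [h'.stepLabel_eq x.2] at heq
          exact absurd heq (hnn _ _)
        · rw [h'.stepLabel_eq x.2, Nat.cast_inj] at heq
          obtain rfl := Fin.ext heq
          exact (h'.not_newBlock hk h2 x.2 y.2 hWV hl h hzy' hzy).elim
        · rw [h'.stepLabel_eq hk x.2, Nat.cast_inj] at heq
          obtain rfl := Fin.ext heq
          exact h'.unique hk h2 x.2 hWV hl h hzy' hzy
    refine ⟨hlt, ?_⟩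
    obtain ⟨U, hU, hyU, hUz, hle⟩ : ∃ U, IsFlat (kEqual F n B k) U ∧ OrderDual.ofDual y.1 ≤ U ∧
        U < OrderDual.ofDual z'.1 ∧ stepLabel B (OrderDual.ofDual z'.1) U ≤
          stepLabel B (OrderDual.ofDual x.1) (OrderDual.ofDual z'.1) := by
      rcases exists_cover_step hk h2 hxz with ⟨b, h⟩ | ⟨a, h⟩ | ⟨a, h⟩
      · rw [h.stepLabel_eq x.2] at hlt
        exact h.descent hk h2 x.2 z'.2 y.2 hzy hzy' hstep' hlt
      · rw [h.stepLabel_eq x.2] at hlt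
        exact h.descent hk h2 x.2 z'.2 y.2 hzy hzy' (hcov hxz') hstep' hlt
      · rw [h.stepLabel_eq hk x.2] at hlt
        exact h.descent hk h2 x.2 z'.2 y.2 z.2 hxz.lt hzy hzy' (hcov hxz') hstep' hlt
    obtain ⟨w, hw, hwU⟩ := exists_covBy_le_of_lt
      (show z' < (⟨OrderDual.toDual U, hU⟩ : FlatPoset (kEqual F n B k)) from hUz)
    exact ⟨w, hw, hwU.trans hyU, (stepLabel_mono hwU).trans hle⟩

theorem isCLShellable_kEqual (hk : 2 ≤ k) (h2 : B → (2 : F) ≠ 0) :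
    IsCLShellable (WithTop (IntersectionSemilattice (kEqual F n B k))) :=
  isCLShellable_of_isGreedyLabeling (kEqual_finite F n B k) (isGreedyLabeling_kEqual hk h2)

end KEqual

/-! ## Lengths of maximal chains -/

section FlagLength

variable {P : Type*} [PartialOrder P] [OrderBot P] [Finite P] {f : P → ℤ} {m : ℤ}

/-- Neighbours in a maximal chain are in a covering relation in the whole poset, so `f` drops by one
modulo m at each step up from `⊥`. -/
theorem Flag.ncard_lt_modEq (hf : ∀ x y : P, x ⋖ y → f x ≡ f y + 1 [ZMOD m]) (s : Flag P) (x : s) :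
    ({y : s | y < x}.ncard : ℤ) ≡ f ⊥ - f x [ZMOD m] := by
  classical
  induction x using WellFoundedLT.induction with
  | ind x ih =>
    by_cases hx : {y : s | y < x}.Nonempty
    · obtain ⟨z, hz⟩ := ((Set.toFinite {y : s | y < x}).exists_maximal hx)
      have hzx : z ⋖ x := ⟨hz.1, fun w hw hwx => (hz.2 hwx hw.le).not_gt hw⟩
      have heq : {y : s | y < x} = insert z {y : s | y < z} := by
        ext y
        constructor
        · intro hy
          rcases lt_trichotomy y z with h | h | h
          · exact Or.inr h
          · exact Or.inl h
          · exact absurd hy (hzx.2 h)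
        · rintro (rfl | h)
          · exact hz.1
          · exact lt_trans h hz.1
      rw [heq, Set.ncard_insert_of_notMem
        (show z ∉ {y : s | y < z} from fun h => lt_irrefl z h), Nat.cast_add, Nat.cast_one]
      have h1 := hf z x (Flag.coe_covBy_coe.2 hzx)
      have h2 := (ih z hz.1).add_right 1
      refine h2.trans ?_
      have h3 : f ⊥ - f z + 1 ≡ f ⊥ - (f x + 1) + 1 [ZMOD m] := (h1.sub_left _).add_right 1
      refine h3.trans (by ring_nf; rfl)
    · rw [Set.not_nonempty_iff_eq_empty] at hx
      have : (x : P) = ⊥ := by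
        have hb : (⊥ : P) ∈ s := Flag.bot_mem s
        by_contra hne
        have : (⟨⊥, hb⟩ : s) ∈ {y : s | y < x} := bot_lt_iff_ne_bot.2 hne
        rw [hx] at this
        exact this
      rw [hx, this]
      simp

theorem Flag.exists_isMax_ncard_modEq (hf : ∀ x y : P, x ⋖ y → f x ≡ f y + 1 [ZMOD m])
    (s : Flag P) :
    ∃ t : P, IsMax t ∧ ((s : Set P).ncard : ℤ) - 1 ≡ f ⊥ - f t [ZMOD m] := by
  classical
  have : Nonempty s := ⟨⟨⊥, Flag.bot_mem s⟩⟩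
  obtain ⟨t, ht⟩ := Finite.exists_max (id : s → s)
  refine ⟨t, fun u htu => ?_, ?_⟩
  · have hu : u ∈ s := by
      by_contra hu
      have hchain : IsChain (· ≤ ·) (insert u (s : Set P)) :=
        s.chain_le.insert fun b hb _ => Or.inr (le_trans (show b ≤ (t : P) from ht ⟨b, hb⟩) htu)
      have := s.max_chain' hchain (Set.subset_insert _ _)
      have hus : u ∈ s.carrier := by
        rw [this]
        exact Set.mem_insert _ _
      exact hu hus
    exact ht ⟨u, hu⟩
  · have h1 : (s : Set P).ncard = {y : s | y < t}.ncard + 1 := by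
      rw [← Set.ncard_insert_of_notMem (fun h => lt_irrefl _ h : t ∉ {y : s | y < t}),
        show insert t {y : s | y < t} = Set.univ from
          Set.eq_univ_of_forall fun y => (ht y).eq_or_lt, Set.ncard_univ]
      rfl
    rw [h1, Nat.cast_add, Nat.cast_one, add_sub_cancel_right]
    exact Flag.ncard_lt_modEq hf s t

theorem Flag.ncard_modEq (hf : ∀ x y : P, x ⋖ y → f x ≡ f y + 1 [ZMOD m])
    (hmax : ∀ x y : P, IsMax x → IsMax y → f x = f y) (s t : Flag P) :
    ((s : Set P).ncard : ℤ) - 1 ≡ ((t : Set P).ncard : ℤ) - 1 [ZMOD m] := by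
  obtain ⟨x, hx, hs⟩ := Flag.exists_isMax_ncard_modEq hf s
  obtain ⟨y, hy, ht⟩ := Flag.exists_isMax_ncard_modEq hf t
  rw [hmax x y hx hy] at hs
  exact hs.trans ht.symm

end FlagLength

/-! ### Dimension drops, heredity and purity of the k-equal arrangements. -/

section KEqualDimension

variable {F : Type*} [Field F] {n : ℕ} {B : Prop} {k : ℕ} {V : Submodule F (Fin n → F)}

theorem finrank_inf_ker {E E' : Type*} [AddCommGroup E] [Module F E] [AddCommGroup E']
    [Module F E'] [FiniteDimensional F E] (V : Submodule F E) (φ : E →ₗ[F] E')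
    (h : ∀ u, ∃ v ∈ V, φ v = u) :
    Module.finrank F (V ⊓ LinearMap.ker φ : Submodule F E) + Module.finrank F E' =
      Module.finrank F V := by
  have hr : LinearMap.range (φ.domRestrict V) = ⊤ := by
    rw [LinearMap.range_eq_top]
    intro u
    obtain ⟨v, hv, rfl⟩ := h u
    exact ⟨⟨v, hv⟩, rfl⟩
  have h1 := LinearMap.finrank_range_add_finrank_ker (φ.domRestrict V)
  rw [hr, finrank_top] at h1
  have h2 : Module.finrank F (LinearMap.ker (φ.domRestrict V)) =
      Module.finrank F (V ⊓ LinearMap.ker φ : Submodule F E) := by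
    rw [← Submodule.map_comap_subtype, LinearMap.domRestrict, LinearMap.ker_comp]
    exact (LinearEquiv.finrank_eq
      (Submodule.equivMapOfInjective _ V.injective_subtype _))
  omega

theorem finrank_inf_eqHyperplane {c : F} {p q : Fin (n + 1)} (h : ¬ V ≤ eqHyperplane c p q) :
    Module.finrank F (V ⊓ eqHyperplane c p q : Submodule F (Fin n → F)) + 1 =
      Module.finrank F V := by
  have := finrank_inf_ker V (coord p - c • coord q) fun u => by
    obtain ⟨v, hv, hvn⟩ := SetLike.not_le_iff_exists.1 h
    have hvn : (coord p - c • coord q : (Fin n → F) →ₗ[F] F) v ≠ 0 := hvn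
    refine ⟨(u / (coord p - c • coord q : (Fin n → F) →ₗ[F] F) v) • v, V.smul_mem _ hv, ?_⟩
    rw [map_smul, smul_eq_mul, div_mul_cancel₀ _ hvn]
  rwa [Module.finrank_self] at this

/-- The equations that compare the elements of `S` with one of them are independent on `V`, because
free coordinates can be prescribed at will. -/
theorem IsFlat.finrank_inf_eqSubspace (hV : IsFlat (kEqual F n B k) V) {ε : Fin (n + 1) → F}
    (hε : ∀ p, IsSign B (ε p)) {S : Finset (Fin (n + 1))} (hS : S.Nonempty)
    (hfree : ∀ p ∈ S, ¬ Nontriv B V p) :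
    Module.finrank F (V ⊓ eqSubspace ε S : Submodule F (Fin n → F)) + (S.card - 1) =
      Module.finrank F V := by
  classical
  -- If 0 ∈ S, it must be the reference element, as the zeroth coordinate cannot be prescribed.
  obtain ⟨a, ha, ha0⟩ : ∃ a ∈ S, 0 ∉ S.erase a := by
    by_cases h0 : 0 ∈ S
    · exact ⟨0, h0, Finset.notMem_erase _ _⟩
    · obtain ⟨a, ha⟩ := hS
      exact ⟨a, ha, fun h => h0 (Finset.mem_of_mem_erase h)⟩
  let φ : (Fin n → F) →ₗ[F] (S.erase a → F) :=
    LinearMap.pi fun p => ε p • coord p.1 - ε a • coord a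
  have hφ : ∀ v p, φ v p = ε p * coord p.1 v - ε a * coord a v := fun v p => rfl
  have hker : LinearMap.ker φ = eqSubspace ε S := by
    ext v
    rw [LinearMap.mem_ker, mem_eqSubspace]
    constructor
    · intro h
      have h1 : ∀ p ∈ S, ε p * coord p v = ε a * coord a v := by
        intro p hp
        by_cases hpa : p = a
        · rw [hpa]
        · have := congrFun h ⟨p, Finset.mem_erase.2 ⟨hpa, hp⟩⟩
          rw [hφ] at this
          exact sub_eq_zero.1 this
      exact fun p hp q hq => (h1 p hp).trans (h1 q hq).symm
    · intro h
      funext p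
      rw [hφ, h p (Finset.mem_of_mem_erase p.2) a ha, sub_self]
      rfl
  have := finrank_inf_ker V φ fun u => by
    obtain ⟨w, hw, hwq⟩ := hV.exists_adjust S hfree
      (fun p => if h : p ∈ S.erase a then ε p * u ⟨p, h⟩ else 0) (dif_neg ha0) V.zero_mem
    refine ⟨w, hw, funext fun p => ?_⟩
    rw [hφ, hwq, hwq, if_pos (Finset.mem_of_mem_erase p.2), if_pos ha, dif_pos p.2,
      dif_neg (Finset.notMem_erase _ _), ← mul_assoc, (hε p).mul_self]
    simp
  rwa [hker, Module.finrank_fintype_fun_eq_card, Fintype.card_coe,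
    Finset.card_erase_of_mem ha] at this

/-- A proper flat has a nontrivial coordinate p. If xₚ determined all coordinates up to sign, the
flat would be at most a point of projective space; so some q lies in another block, and xₚ = x_q
cuts out a flat of codimension one. -/
theorem isHereditary_kEqual (hk : 2 ≤ k) (h2 : B → (2 : F) ≠ 0) :
    IsHereditary projDim (kEqual F n B k) := by
  intro x hx hdim
  set V := OrderDual.ofDual x.1 with hVdef
  have hV : IsFlat (kEqual F n B k) V := x.isFlat
  obtain ⟨p, hp⟩ : ∃ p, Nontriv B V p := by
    by_contra hcon
    push Not at hcon
    have htop : V = ⊤ := by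
      rw [eq_top_iff]
      intro v _
      obtain ⟨w, hw, hwq⟩ := hV.exists_adjust Finset.univ (fun p _ => hcon p)
        (fun p => coord p v) rfl V.zero_mem
      have : w = v := ext_coord fun p => by rw [hwq, if_pos (Finset.mem_univ _)]
      exact this ▸ hw
    exact hx (Subtype.ext (congrArg OrderDual.toDual htop))
  obtain ⟨q, hq, hpq⟩ : ∃ q, (¬ B → q ≠ 0) ∧ ¬ CoordRel B V q p := by
    by_contra hcon
    push Not at hcon
    have hinj : Function.Injective ((coord p : (Fin n → F) →ₗ[F] F).domRestrict V) := by
      rw [← LinearMap.ker_eq_bot, LinearMap.ker_eq_bot']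
      rintro ⟨v, hv⟩ h
      have h : coord p v = 0 := h
      refine Subtype.ext (ext_coord fun q => ?_)
      cases q using Fin.cases with
      | zero => rfl
      | succ i =>
        obtain ⟨c, -, hc⟩ := hcon i.succ fun _ => Fin.succ_ne_zero i
        change coord i.succ v = coord i.succ 0
        rw [hc v hv, h, mul_zero, map_zero]
    have := LinearMap.finrank_le_finrank_of_injective hinj
    rw [Module.finrank_self] at this
    unfold projDim at hdim
    omega
  have hr := finrank_inf_eqHyperplane (V := V) (c := 1) (p := p) (q := q) fun hle =>
    hpq (CoordRel.symm ⟨1, isSign_one, fun v hv => mem_eqHyperplane.1 (hle hv)⟩)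
  have hU := hV.inf_eqHyperplane hk h2 hp (isSign_one (B := B) (F := F)) hq
  set U := V ⊓ eqHyperplane 1 p q with hUdef
  have hUV : U < V := lt_of_le_of_ne inf_le_left fun h => by
    rw [h] at hr
    omega
  unfold projDim at hdim
  have hUb : U ≠ ⊥ := by
    rintro h
    rw [h, finrank_bot] at hr
    omega
  obtain ⟨S, hS, hUS⟩ := hU
  refine ⟨⟨OrderDual.toDual U, S, hS, hUS, Or.inr hUb⟩, hUV, ?_⟩
  change (Module.finrank F U : ℤ) - 1 = (Module.finrank F V : ℤ) - 1 - 1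
  omega

/-- Merges and adjunctions add one equation, while a new block adds k - 1 = 1 + (k - 2). -/
theorem projDim_covBy_modEq (hk : 2 ≤ k) (h2 : B → (2 : F) ≠ 0)
    {x y : IntersectionSemilattice (kEqual F n B k)} (h : x ⋖ y) :
    projDim (OrderDual.ofDual x.1) ≡ projDim (OrderDual.ofDual y.1) + 1
      [ZMOD ((k - 2 : ℕ) : ℤ)] := by
  have hyb := IntersectionSemilattice.ne_bot h.lt.ne_bot
  obtain ⟨U, hyU, hUx, ⟨S, hS, hUS⟩, hstep⟩ := exists_step hk h2 x.isFlat y.isFlat h.lt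
  have hU : U = OrderDual.ofDual y.1 := by
    by_contra hne
    exact h.2 (c := ⟨OrderDual.toDual U, S, hS, hUS, Or.inr fun h =>
      hyb (le_bot_iff.1 (hyU.trans_eq h))⟩) hUx (lt_of_le_of_ne hyU fun h =>
        hne (congrArg (fun t : IntersectionSemilattice (kEqual F n B k) => OrderDual.ofDual t.1) h))
  subst hU
  have hhyp : ∀ (s : F) (a b : Fin (n + 1)),
      OrderDual.ofDual y.1 = OrderDual.ofDual x.1 ⊓ eqHyperplane s a b →
      projDim (OrderDual.ofDual x.1) = projDim (OrderDual.ofDual y.1) + 1 := by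
    intro s a b hy
    have := finrank_inf_eqHyperplane (V := OrderDual.ofDual x.1) (c := s) (p := a) (q := b)
      fun hle => hUx.ne (hy.trans (inf_eq_left.2 hle))
    rw [← hy] at this
    unfold projDim
    omega
  rcases hstep with ⟨b, c, s, -, -, -, -, -, -, hy⟩ | ⟨a, i, s, -, -, -, -, hy⟩ |
    ⟨a, ε, S, hS, hε, -, hfree, -, haS, -, hy⟩
  · rw [hhyp _ _ _ hy]
  · rw [hhyp _ _ _ hy]
  · have := x.isFlat.finrank_inf_eqSubspace hε ⟨a, haS⟩ hfree
    rw [← hy, hS] at this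
    have h3 : projDim (OrderDual.ofDual x.1) =
        projDim (OrderDual.ofDual y.1) + 1 + ((k - 2 : ℕ) : ℤ) := by
      unfold projDim
      omega
    rw [h3]
    exact Int.add_modEq_right

/-- By heredity the maximal elements have dimension 0, unless the whole space is the only element.
-/
theorem isModPure_kEqual (hk : 2 ≤ k) (h2 : B → (2 : F) ≠ 0) :
    IsModPure (kEqual F n B k) (k - 2) := by
  have := finite_intersectionSemilattice (kEqual_finite F n B k)
  have hmax : ∀ x : IntersectionSemilattice (kEqual F n B k), IsMax x → x ≠ ⊥ →
      projDim (OrderDual.ofDual x.1) = 0 := by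
    intro x hx hxb
    by_contra hne
    obtain ⟨y, hxy, -⟩ := isHereditary_kEqual hk h2 x hxb
      ((projDim_nonneg (IntersectionSemilattice.ne_bot hxb)).lt_of_ne (Ne.symm hne))
    exact hx.not_lt hxy
  intro s t
  refine Flag.ncard_modEq (P := IntersectionSemilattice (kEqual F n B k))
    (f := fun x : IntersectionSemilattice (kEqual F n B k) => projDim (OrderDual.ofDual x.1))
    (fun x y h => projDim_covBy_modEq hk h2 h) (fun x y hx hy => ?_) s t
  by_cases hxb : x = ⊥
  · rw [hx.eq_of_le (hxb ▸ bot_le : x ≤ y)]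
  · by_cases hyb : y = ⊥
    · rw [hy.eq_of_le (hyb ▸ bot_le : y ≤ x)]
    · exact (hmax x hx hxb).trans (hmax y hy hyb).symm

/-! ### Identification of the uniform arrangement with types A and B. -/

theorem eqSubspace_map_succ (ε : Fin (n + 1) → F) (δ : Fin n → ℤˣ)
    (h : ∀ i, ε i.succ = ((δ i : ℤ) : F)) (S : Finset (Fin n)) :
    eqSubspace ε (S.map (Fin.succEmb n)) = signedEqualSubspace F n δ S := by
  ext v
  rw [mem_eqSubspace]
  simp only [Finset.forall_mem_map, Fin.coe_succEmb, coord_succ, h]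
  rfl

theorem eqSubspace_insert_zero {ε : Fin (n + 1) → F} (hε : ∀ p, ε p ≠ 0) (S : Finset (Fin n)) :
    eqSubspace ε (insert 0 (S.map (Fin.succEmb n))) = zeroSubspace F n S := by
  ext v
  have h0 : v ∈ zeroSubspace F n S ↔ ∀ i ∈ S, v i = 0 := Iff.rfl
  rw [h0]
  constructor
  · intro h i hi
    have := h i.succ (Finset.mem_insert_of_mem (Finset.mem_map.2 ⟨i, hi, rfl⟩)) 0
      (Finset.mem_insert_self _ _)
    rw [coord_zero, mul_zero, coord_succ] at this
    exact (mul_eq_zero.1 this).resolve_left (hε _)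
  · intro h
    have hc : ∀ p ∈ insert 0 (S.map (Fin.succEmb n)), coord p v = 0 := by
      intro p hp
      rcases Finset.mem_insert.1 hp with rfl | hp
      · rfl
      · obtain ⟨i, hi, rfl⟩ := Finset.mem_map.1 hp
        exact h i hi
    intro a ha b hb
    rw [hc a ha, hc b hb, mul_zero, mul_zero]

theorem exists_map_succ {S : Finset (Fin (n + 1))} (h : 0 ∉ S) :
    ∃ T : Finset (Fin n), S = T.map (Fin.succEmb n) := by
  classical
  refine ⟨Finset.univ.filter fun i => i.succ ∈ S, ?_⟩
  ext p
  cases p using Fin.cases with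
  | zero => simp [h, Fin.succ_ne_zero]
  | succ i => simp

theorem kEqualA_eq (k : ℕ) : kEqualA F n k = kEqual F n False k := by
  ext K
  constructor
  · rintro ⟨S, hS, rfl⟩
    refine ⟨fun _ => 1, S.map (Fin.succEmb n), by simpa using hS, fun _ => isSign_one,
      fun _ => by simp [Fin.succ_ne_zero], (eqSubspace_map_succ _ _ (by simp) S).symm⟩
  · rintro ⟨ε, S, hS, hε, h0, rfl⟩
    obtain ⟨T, rfl⟩ := exists_map_succ (h0 id)
    exact ⟨T, by simpa using hS, eqSubspace_map_succ _ _
      (fun i => by simpa using (hε i.succ).elim id fun h => h.1.elim) T⟩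

theorem kEqualB_eq (hk : 2 ≤ k) : kEqualB F n k = kEqual F n True k := by
  classical
  ext K
  constructor
  · rintro (⟨S, δ, hS, rfl⟩ | ⟨S, hS, rfl⟩)
    · refine ⟨Fin.cases 1 fun i => ((δ i : ℤ) : F), S.map (Fin.succEmb n), by simpa using hS,
        fun p => ?_, fun h => (h trivial).elim, (eqSubspace_map_succ _ _ (fun _ => rfl) S).symm⟩
      cases p using Fin.cases with
      | zero => exact isSign_one
      | succ i =>
        rcases Int.units_eq_one_or (δ i) with h | h
        · exact Or.inl (by simp [h])
        · exact Or.inr ⟨trivial, by simp [h]⟩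
    · refine ⟨fun _ => 1, insert 0 (S.map (Fin.succEmb n)), ?_, fun _ => isSign_one,
        fun h => (h trivial).elim, (eqSubspace_insert_zero (fun _ => one_ne_zero) S).symm⟩
      rw [Finset.card_insert_of_notMem (by simp [Fin.succ_ne_zero]), Finset.card_map, hS]
      omega
  · rintro ⟨ε, S, hS, hε, -, rfl⟩
    by_cases h0 : 0 ∈ S
    · right
      obtain ⟨T, hT⟩ := exists_map_succ (Finset.notMem_erase 0 S)
      refine ⟨T, ?_, ?_⟩
      · rw [← hS, ← Finset.card_erase_of_mem h0, hT, Finset.card_map]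
      · rw [← Finset.insert_erase h0, hT, eqSubspace_insert_zero fun p => (hε p).ne_zero]
    · left
      obtain ⟨T, rfl⟩ := exists_map_succ h0
      refine ⟨T, fun i => if ε i.succ = 1 then 1 else -1, by simpa using hS,
        eqSubspace_map_succ _ _ (fun i => ?_) T⟩
      rcases hε i.succ with h | ⟨-, h⟩
      · simp [h]
      · by_cases h1 : ε i.succ = 1
        · simp [h1]
        · rw [if_neg h1, h]
          simp

end KEqualDimension

theorem theoremM {F : Type*} [Field F] (n : ℕ) :
    -- projective arrangements
    (∀ (A : Set (Submodule F (Fin n → F))) (d m : ℕ), A.Finite → (∀ K ∈ A, K ≠ ⊤) →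
      IsGreatest (projDim '' A) (d : ℤ) →
      IsHereditary projDim A → IsModPure A m → IsCLShellable (WithTop (IntersectionSemilattice A)) →
      ∀ (j : ℕ) (i : ℤ), j ≤ d → ¬ (i + (j : ℤ) ≡ (d : ℤ) [ZMOD (m : ℤ)]) →
        reducedBetti (Truncation projDim A j) i = 0) ∧
    -- affine arrangements
    (∀ (A : Set (AffineSubspace F (Fin n → F))) (d m : ℕ), A.Finite → (∀ K ∈ A, K ≠ ⊥ ∧ K ≠ ⊤) →
      IsGreatest (affDim '' A) (d : ℤ) →
      IsHereditary affDim A → IsModPure A m → IsCLShellable (WithTop (IntersectionSemilattice A)) →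
      ∀ (j : ℕ) (i : ℤ), j ≤ d → ¬ (i + (j : ℤ) ≡ (d : ℤ) [ZMOD (m : ℤ)]) →
        reducedBetti (Truncation affDim A j) i = 0) ∧
    -- the projective `k`-equal arrangements of types A and B satisfy the conditions with `m = k - 2`
    (∀ k : ℕ, 2 ≤ k →
      (IsHereditary projDim (kEqualA F n k) ∧ IsModPure (kEqualA F n k) (k - 2) ∧
        IsCLShellable (WithTop (IntersectionSemilattice (kEqualA F n k)))) ∧
      ((2 : F) ≠ 0 →
        IsHereditary projDim (kEqualB F n k) ∧ IsModPure (kEqualB F n k) (k - 2) ∧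
          IsCLShellable (WithTop (IntersectionSemilattice (kEqualB F n k))))) := by
  refine ⟨fun A d m hA htop hd hher hpure hCL j i hj hij => ?_,
    fun A d m hA htop hd hher hpure hCL j i hj hij => ?_, fun k hk => ⟨?_, fun h2 => ?_⟩⟩
  · exact reducedBetti_arrangement_eq_zero hA (fun K => projDim_nonneg)
      (fun K K' _ h => projDim_lt h) (fun K hK => ⟨htop K hK, ne_bot_of_projDim_nonneg⟩)
      hd hher hpure hCL j i hj hij
  · exact reducedBetti_arrangement_eq_zero hA (fun K _ => Int.natCast_nonneg _)
      (fun K K' hK h => affDim_lt hK h) (fun K hK => ⟨(htop K hK).2, fun _ => (htop K hK).1⟩)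
      hd hher hpure hCL j i hj hij
  · rw [kEqualA_eq]
    exact ⟨isHereditary_kEqual hk False.elim, isModPure_kEqual hk False.elim,
      isCLShellable_kEqual hk False.elim⟩
  · rw [kEqualB_eq hk]
    exact ⟨isHereditary_kEqual hk fun _ => h2, isModPure_kEqual hk fun _ => h2,
      isCLShellable_kEqual hk fun _ => h2⟩
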